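/- An \emph{asynchronous graph} is a (small, directed) graph $G$ with a set $\diamond$ of pairs of parallel paths of length $2$, called permutation tiles, such that: (1) $p\diamond q$ implies $q\diamond p$; (2) $p\diamond q$ and $p\diamond q'$ imply $q=q'$; (3) for all parallel paths $u_1u_2u_3$ and $v_1v_2v_3$ of length $3$, there are edges $w_3,u_2',v_2'$ with $u_2u_3\diamond u_2'w_3$, $u_1u_2'\diamond v_1v_2'$, $v_2'w_3\diamond v_2v_3$ if and only if there are edges $w_1,u_2'',v_2''$ with $u_1u_2\diamond w_1u_2''$, $u_2''u_3\diamond v_2''v_3$, $w_1v_2''\diamond v_1v_2$. Asynchronous graphs and the graph homomorphisms that preserve permutation tiles form the category $\mathbf{Asynch}$. It is symmetric monoidal for the shuffle product $G\mathbin{\sqcup\!\sqcup} H$, whose vertices are the pairs $(x,y)$ of a vertex of $G$ and a vertex of $H$, whose edges are the $(u,y):(x,y)\to(x',y)$ and $(x,v):(x,y)\to(x,y')$ for edges $u:x\to x'$ of $G$ and $v:y\to y'$ of $H$, and whose tiles are those of $G$ at a fixed vertex of $H$, those of $H$ at a fixed vertex of $G$, and $(u,y)(x',v)\diamond(x,v)(u,y')$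 and its inverse for all such $u,v$. The unit $\mathbf I$ has one vertex and no edge. Let $\mathbf{2}\text{-}\mathbf{Cat}$ be the category of small 2-categories and 2-functors, with the symmetric monoidal structure given by the Gray tensor product $\boxtimes$, whose unit is the terminal 2-category $\mathbf 1$. Explicitly, the objects of $\mathcal A\boxtimes\mathcal B$ are the pairs $(a,b)$ of an object of $\mathcal A$ and an object of $\mathcal B$; its 1-cells are generated by the $(f,b):(a,b)\to(a',b)$ and $(a,g):(a,b)\to(a,b')$ for 1-cells $f:a\to a'$ of $\mathcal A$ and $g:b\to b'$ of $\mathcal B$, modulo functoriality in $f$ and in $g$; and the canonical 2-functor $\mathcal A\boxtimes\mathcal B\to\mathcal A\times\mathcal B$ is locally fully faithful, that is, a 2-cell between two parallel 1-cells is a pair of 2-cells between their projections in $\mathcal A$ and in $\mathcal B$. For an asynchronous graph $G$ let $[G]$ be the 2-category whose objects are the vertices of $G$, whose 1-cells are the paths of $G$, and whose 2-cells $f\Rightarrow g$ are the reschedulings: the bijections from the positions of $f$ to the positions of $g$ that are induced by some finite sequence of permutation steps $h_1\cdot p\cdot h_2\Rightarrow h_1\cdot q\cdot h_2$ (with $p\diamond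 q$) from $f$ to $g$, where such a step exchanges the two positions of $p$ and fixes the others. A homomorphism $F:G\to H$ acts edgewise on paths and leaves the bijections unchanged. This defines a functor $[-]:\mathbf{Asynch}\to\mathbf{2}\text{-}\mathbf{Cat}$. \textbf{Theorem.} The functor $[-]$ carries the structure of a symmetric (strong) monoidal functor $$[-]:(\mathbf{Asynch},\mathbin{\sqcup\!\sqcup},\mathbf I)\longrightarrow(\mathbf{2}\text{-}\mathbf{Cat},\boxtimes,\mathbf 1),$$ that is, there are isomorphisms of 2-categories $[G]\boxtimes[H]\cong[G\mathbin{\sqcup\!\sqcup} H]$, natural in $G$ and $H$, and $\mathbf 1\cong[\mathbf I]$, compatible with the associativity, unit and symmetry isomorphisms. Moreover $[-]$ preserves equalizers, but it does not preserve binary cartesian products. -/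

import Mathlib

open CategoryTheory Bicategory

universe u

/-! ### The category of small (strict) 2-categories -/

/-- A small (strict) 2-category. -/
structure TwoCat : Type (u + 1) where
  carrier : Type u
  [bicategory : Bicategory.{u, u} carrier]
  [strict : Bicategory.Strict carrier]

namespace TwoCat

instance : CoeSort TwoCat.{u} (Type u) := ⟨TwoCat.carrier⟩

attribute [instance] TwoCat.bicategory TwoCat.strict

theorem functor_ext {A B : Type u} [Bicategory.{u, u} A] [Bicategory.Strict A]
    [Bicategory.{u, u} B] [Bicategory.Strict B] {F G : StrictPseudofunctor A B}
    (h : F.toFunctor = G.toFunctor)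
    (h₂ : ∀ {a b : A} {f g : a ⟶ b} (η : f ⟶ g), F.map₂ η ≍ G.map₂ η) : F = G := by
  obtain ⟨⟨F, hFi, hFi'⟩, hFc, hFc'⟩ := F
  obtain ⟨⟨G, hGi, hGi'⟩, hGc, hGc'⟩ := G
  obtain ⟨F, Fi, Fc, _, _, _, _, _⟩ := F
  obtain ⟨G, Gi, Gc, _, _, _, _, _⟩ := G
  obtain ⟨F, _, _⟩ := F
  obtain ⟨G, _, _⟩ := G
  obtain ⟨⟨Fo, Fm⟩, F2⟩ := F
  obtain ⟨⟨Go, Gm⟩, G2⟩ := G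
  dsimp [StrictPseudofunctor.toFunctor] at h
  injection h with ho hm
  subst ho
  have hm' : @Fm = @Gm := eq_of_heq hm
  subst hm'
  obtain rfl : @F2 = @G2 := by
    funext a b f g η
    exact eq_of_heq (h₂ η)
  obtain rfl : Fi = Gi := funext fun X => (hFi' X).trans (hGi' X).symm
  obtain rfl : @Fc = @Gc := by
    funext a b c f g
    exact (hFc' f g).trans (hGc' f g).symm
  rfl

/-- The category of small 2-categories and (strict) 2-functors. -/
instance : Category TwoCat.{u} where
  Hom A B := StrictPseudofunctor A B
  id A := StrictPseudofunctor.id A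
  comp F G := F.comp G
  id_comp _ := functor_ext rfl fun _ => HEq.rfl
  comp_id _ := functor_ext rfl fun _ => HEq.rfl
  assoc _ _ _ := functor_ext rfl fun _ => HEq.rfl

end TwoCat

/-! ### The funny tensor product of two categories -/

/-- The objects `(a, b)` of the funny tensor product of `A` and `B`. A structure rather than `A × B`,
which already carries the cartesian product category. -/
structure FunnyObj (A B : Type u) : Type u where
  fst : A
  snd : B

namespace Funny

section
variable {A B : Type u} [Category.{u} A] [Category.{u} B]

/-- Formal composites of the generating morphisms `(f, b)` and `(a, g)`. -/
inductive Word : FunnyObj A B → FunnyObj A B → Type u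
  | id (X : FunnyObj A B) : Word X X
  | comp {X Y Z : FunnyObj A B} (v : Word X Y) (w : Word Y Z) : Word X Z
  | left {a a' : A} (f : a ⟶ a') (b : B) : Word ⟨a, b⟩ ⟨a', b⟩
  | right (a : A) {b b' : B} (g : b ⟶ b') : Word ⟨a, b⟩ ⟨a, b'⟩

/-- The relation generating the congruence on words: the category laws, and functoriality of
`(-, b)` and `(a, -)`. No relation identifies `(f, b)(a', g)` with `(a, g)(f, b')`. -/
inductive Rel : ∀ {X Y : FunnyObj A B}, Word X Y → Word X Y → Prop
  | id_comp {X Y : FunnyObj A B} (w : Word X Y) : Rel ((Word.id X).comp w) w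
  | comp_id {X Y : FunnyObj A B} (w : Word X Y) : Rel (w.comp (Word.id Y)) w
  | assoc {X Y Z W : FunnyObj A B} (u : Word X Y) (v : Word Y Z) (w : Word Z W) :
      Rel ((u.comp v).comp w) (u.comp (v.comp w))
  | comp_left {X Y Z : FunnyObj A B} (v : Word X Y) {w w' : Word Y Z} (h : Rel w w') :
      Rel (v.comp w) (v.comp w')
  | comp_right {X Y Z : FunnyObj A B} {v v' : Word X Y} (h : Rel v v') (w : Word Y Z) :
      Rel (v.comp w) (v'.comp w)
  | left_id (a : A) (b : B) : Rel (Word.left (𝟙 a) b) (Word.id ⟨a, b⟩)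
  | left_comp {a a' a'' : A} (f : a ⟶ a') (f' : a' ⟶ a'') (b : B) :
      Rel ((Word.left f b).comp (Word.left f' b)) (Word.left (f ≫ f') b)
  | right_id (a : A) (b : B) : Rel (Word.right a (𝟙 b)) (Word.id ⟨a, b⟩)
  | right_comp (a : A) {b b' b'' : B} (g : b ⟶ b') (g' : b' ⟶ b'') :
      Rel ((Word.right a g).comp (Word.right a g')) (Word.right a (g ≫ g'))

/-- The funny tensor product of the categories `A` and `B`: the pushout in `Cat` of `ob A × B` and
`A × ob B` over `ob A × ob B`, by generators and relations. -/
instance category : Category.{u} (FunnyObj A B) where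
  Hom X Y := Quot (@Rel A B _ _ X Y)
  id X := Quot.mk _ (Word.id X)
  comp f g := Quot.liftOn₂ f g (fun v w => Quot.mk _ (v.comp w))
    (fun v _ _ h => Quot.sound (Rel.comp_left v h))
    (fun _ _ w h => Quot.sound (Rel.comp_right h w))
  id_comp := by rintro _ _ ⟨w⟩; exact Quot.sound (Rel.id_comp w)
  comp_id := by rintro _ _ ⟨w⟩; exact Quot.sound (Rel.comp_id w)
  assoc := by rintro _ _ _ _ ⟨u⟩ ⟨v⟩ ⟨w⟩; exact Quot.sound (Rel.assoc u v w)

variable (A) in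
/-- The functor `(-, b)`. -/
def inl (b : B) : A ⥤ FunnyObj A B where
  obj a := ⟨a, b⟩
  map f := Quot.mk _ (Word.left f b)
  map_id a := Quot.sound (Rel.left_id a b)
  map_comp f g := (Quot.sound (Rel.left_comp f g b)).symm

variable (B) in
/-- The functor `(a, -)`. -/
def inr (a : A) : B ⥤ FunnyObj A B where
  obj b := ⟨a, b⟩
  map g := Quot.mk _ (Word.right a g)
  map_id b := Quot.sound (Rel.right_id a b)
  map_comp f g := (Quot.sound (Rel.right_comp a f g)).symm

theorem hom_induction {P : ∀ {X Y : FunnyObj A B}, (X ⟶ Y) → Prop}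
    (id : ∀ X : FunnyObj A B, P (𝟙 X))
    (comp : ∀ {X Y Z : FunnyObj A B} (f : X ⟶ Y) (g : Y ⟶ Z), P f → P g → P (f ≫ g))
    (left : ∀ {a a' : A} (f : a ⟶ a') (b : B), P ((inl A b).map f))
    (right : ∀ (a : A) {b b' : B} (g : b ⟶ b'), P ((inr B a).map g))
    {X Y : FunnyObj A B} (f : X ⟶ Y) : P f := by
  refine Quot.ind (fun w => ?_) f
  clear f
  induction w with
  | id X => exact id X
  | comp v w hv hw => exact comp (Quot.mk _ v) (Quot.mk _ w) hv hw
  | left f b => exact left f b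
  | right a g => exact right a g

variable {C : Type u} [Category.{u} C]

/-- A family of functors `A ⥤ C`, `B ⥤ C` that agree on objects: the data of a functor out of the
funny tensor product. -/
structure LiftData (A B C : Type u) [Category.{u} A] [Category.{u} B] [Category.{u} C] where
  obj : A → B → C
  left : ∀ {a a' : A} (_ : a ⟶ a') (b : B), obj a b ⟶ obj a' b
  right : ∀ (a : A) {b b' : B} (_ : b ⟶ b'), obj a b ⟶ obj a b'
  left_id : ∀ (a : A) (b : B), left (𝟙 a) b = 𝟙 (obj a b)
  left_comp : ∀ {a a' a'' : A} (f : a ⟶ a') (f' : a' ⟶ a'') (b : B),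
    left (f ≫ f') b = left f b ≫ left f' b
  right_id : ∀ (a : A) (b : B), right a (𝟙 b) = 𝟙 (obj a b)
  right_comp : ∀ (a : A) {b b' b'' : B} (g : b ⟶ b') (g' : b' ⟶ b''),
    right a (g ≫ g') = right a g ≫ right a g'

def LiftData.word (D : LiftData A B C) : ∀ {X Y : FunnyObj A B}, Word X Y →
    (D.obj X.fst X.snd ⟶ D.obj Y.fst Y.snd)
  | _, _, .id _ => 𝟙 _
  | _, _, .comp v w => D.word v ≫ D.word w
  | _, _, .left f b => D.left f b
  | _, _, .right a g => D.right a g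

theorem LiftData.word_rel (D : LiftData A B C) {X Y : FunnyObj A B} {v w : Word X Y}
    (h : Rel v w) : D.word v = D.word w := by
  induction h <;> simp_all [LiftData.word, D.left_id, D.left_comp, D.right_id, D.right_comp]

def lift (D : LiftData A B C) : FunnyObj A B ⥤ C where
  obj X := D.obj X.fst X.snd
  map f := Quot.liftOn f D.word (fun _ _ h => D.word_rel h)
  map_id _ := rfl
  map_comp := by rintro _ _ _ ⟨v⟩ ⟨w⟩; rfl

theorem functor_ext {F G : FunnyObj A B ⥤ C} (hl : ∀ b, inl A b ⋙ F = inl A b ⋙ G)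
    (hr : ∀ a, inr B a ⋙ F = inr B a ⋙ G) : F = G := by
  have hobj : ∀ X, F.obj X = G.obj X := fun X => Functor.congr_obj (hl X.snd) X.fst
  refine CategoryTheory.Functor.ext hobj fun X Y f => ?_
  induction f using hom_induction with
  | id X => simp
  | comp f g hf hg => simp [hf, hg]
  | left f b => exact Functor.congr_hom (hl b) f
  | right a g => exact Functor.congr_hom (hr a) g

def fst : FunnyObj A B ⥤ A := lift
  { obj := fun a _ => a
    left := fun f _ => f
    right := fun a _ _ _ => 𝟙 a
    left_id := by simp
    left_comp := by simp
    right_id := by simp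
    right_comp := by simp }

def snd : FunnyObj A B ⥤ B := lift
  { obj := fun _ b => b
    left := fun _ b => 𝟙 b
    right := fun _ _ _ g => g
    left_id := by simp
    left_comp := by simp
    right_id := by simp
    right_comp := by simp }

variable {A' B' : Type u} [Category.{u} A'] [Category.{u} B']

def map (F : A ⥤ A') (G : B ⥤ B') : FunnyObj A B ⥤ FunnyObj A' B' := lift
  { obj := fun a b => ⟨F.obj a, G.obj b⟩
    left := fun f b => (inl A' (G.obj b)).map (F.map f)
    right := fun a _ _ g => (inr B' (F.obj a)).map (G.map g)
    left_id := fun a b => by rw [F.map_id]; exact (inl A' (G.obj b)).map_id _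
    left_comp := fun f f' b => by rw [F.map_comp]; exact (inl A' (G.obj b)).map_comp _ _
    right_id := fun a b => by rw [G.map_id]; exact (inr B' (F.obj a)).map_id _
    right_comp := fun a _ _ _ g g' => by rw [G.map_comp]; exact (inr B' (F.obj a)).map_comp _ _ }

variable (A B C)

def assocLeft (c : C) : FunnyObj A B ⥤ FunnyObj A (FunnyObj B C) :=
  map (𝟭 A) (inl B c)

def assocRight (a : A) : FunnyObj B C ⥤ FunnyObj (FunnyObj A B) C :=
  map (inr B a) (𝟭 C)

def assoc : FunnyObj (FunnyObj A B) C ⥤ FunnyObj A (FunnyObj B C) := lift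
  { obj := fun X c => ⟨X.fst, ⟨X.snd, c⟩⟩
    left := fun f c => (assocLeft A B C c).map f
    right := fun X _ _ h => (inr (FunnyObj B C) X.fst).map ((inr C X.snd).map h)
    left_id := fun _ c => (assocLeft A B C c).map_id _
    left_comp := fun _ _ c => (assocLeft A B C c).map_comp _ _
    right_id := fun X _ => (inr C X.snd ⋙ inr (FunnyObj B C) X.fst).map_id _
    right_comp := fun X _ _ _ _ _ => (inr C X.snd ⋙ inr (FunnyObj B C) X.fst).map_comp _ _ }

def assocInv : FunnyObj A (FunnyObj B C) ⥤ FunnyObj (FunnyObj A B) C := lift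
  { obj := fun a Y => ⟨⟨a, Y.fst⟩, Y.snd⟩
    left := fun f Y => (inl (FunnyObj A B) Y.snd).map ((inl A Y.fst).map f)
    right := fun a _ _ g => (assocRight A B C a).map g
    left_id := fun _ Y => (inl A Y.fst ⋙ inl (FunnyObj A B) Y.snd).map_id _
    left_comp := fun _ _ Y => (inl A Y.fst ⋙ inl (FunnyObj A B) Y.snd).map_comp _ _
    right_id := fun a _ => (assocRight A B C a).map_id _
    right_comp := fun a _ _ _ _ _ => (assocRight A B C a).map_comp _ _ }

def swap : FunnyObj A B ⥤ FunnyObj B A := lift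
  { obj := fun a b => ⟨b, a⟩
    left := fun f b => (inr A b).map f
    right := fun a _ _ g => (inl B a).map g
    left_id := fun _ b => (inr A b).map_id _
    left_comp := fun _ _ b => (inr A b).map_comp _ _
    right_id := fun a _ => (inl B a).map_id _
    right_comp := fun a _ _ _ _ _ => (inl B a).map_comp _ _ }

end
end Funny

/-! ### Whiskering over a functor -/

namespace Gray

section
variable {C : Type u} [Category.{u} C] {A : Type u} [Bicategory.{u, u} A] [Bicategory.Strict A]
  (F : C ⥤ A)

/-- Left whiskering in the 2-category `A` by the image of `f` under the functor `F`. -/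
def wl {X Y Z : C} (f : X ⟶ Y) {g h : Y ⟶ Z} (η : F.map g ⟶ F.map h) :
    F.map (f ≫ g) ⟶ F.map (f ≫ h) :=
  eqToHom (F.map_comp f g) ≫ F.map f ◁ η ≫ eqToHom (F.map_comp f h).symm

/-- Right whiskering in the 2-category `A` by the image of `h` under the functor `F`. -/
def wr {X Y Z : C} {f g : X ⟶ Y} (η : F.map f ⟶ F.map g) (h : Y ⟶ Z) :
    F.map (f ≫ h) ⟶ F.map (g ≫ h) :=
  eqToHom (F.map_comp f h) ≫ η ▷ F.map h ≫ eqToHom (F.map_comp g h).symm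

theorem wl_id {X Y Z : C} (f : X ⟶ Y) (g : Y ⟶ Z) : wl F f (𝟙 (F.map g)) = 𝟙 _ := by
  simp [wl]

theorem wr_id {X Y Z : C} (f : X ⟶ Y) (g : Y ⟶ Z) : wr F (𝟙 (F.map f)) g = 𝟙 _ := by
  simp [wr]

theorem wl_comp {X Y Z : C} (f : X ⟶ Y) {g h i : Y ⟶ Z} (η : F.map g ⟶ F.map h)
    (θ : F.map h ⟶ F.map i) : wl F f (η ≫ θ) = wl F f η ≫ wl F f θ := by
  simp [wl]

theorem wr_comp {X Y Z : C} {f g h : X ⟶ Y} (η : F.map f ⟶ F.map g)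
    (θ : F.map g ⟶ F.map h) (i : Y ⟶ Z) : wr F (η ≫ θ) i = wr F η i ≫ wr F θ i := by
  simp [wr]

theorem wl_congr {a b c : A} {k k' : a ⟶ b} (hk : k = k') {g h : b ⟶ c} (η : g ⟶ h) :
    k ◁ η = eqToHom (by rw [hk]) ≫ k' ◁ η ≫ eqToHom (by rw [hk]) := by
  subst hk; simp

theorem wr_congr {a b c : A} {f g : a ⟶ b} (η : f ⟶ g) {k k' : b ⟶ c} (hk : k = k') :
    η ▷ k = eqToHom (by rw [hk]) ≫ η ▷ k' ≫ eqToHom (by rw [hk]) := by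
  subst hk; simp

theorem wl_eqToHom {X Y Z : C} (f : X ⟶ Y) {g h : Y ⟶ Z} (e : F.map g = F.map h) :
    wl F f (eqToHom e) = eqToHom (by simp [F.map_comp, e]) := by
  simp [wl]

theorem wr_eqToHom {X Y Z : C} {f g : X ⟶ Y} (e : F.map f = F.map g) (h : Y ⟶ Z) :
    wr F (eqToHom e) h = eqToHom (by simp [F.map_comp, e]) := by
  simp [wr]

theorem id_wl {X Y : C} {f g : X ⟶ Y} (η : F.map f ⟶ F.map g) :
    wl F (𝟙 X) η = eqToHom (by simp) ≫ η ≫ eqToHom (by simp) := by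
  simp [wl, wl_congr (F.map_id X), Bicategory.Strict.leftUnitor_eqToIso]

theorem wr_one {X Y : C} {f g : X ⟶ Y} (η : F.map f ⟶ F.map g) :
    wr F η (𝟙 Y) = eqToHom (by simp) ≫ η ≫ eqToHom (by simp) := by
  simp [wr, wr_congr _ (F.map_id Y), Bicategory.Strict.rightUnitor_eqToIso]

theorem comp_wl {X Y Z W : C} (f : X ⟶ Y) (g : Y ⟶ Z) {h h' : Z ⟶ W} (η : F.map h ⟶ F.map h') :
    wl F (f ≫ g) η = eqToHom (by simp) ≫ wl F f (wl F g η) ≫ eqToHom (by simp) := by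
  simp [wl, wl_congr (F.map_comp f g), Bicategory.Strict.associator_eqToIso]

theorem wr_comp' {X Y Z W : C} {f f' : X ⟶ Y} (η : F.map f ⟶ F.map f') (g : Y ⟶ Z) (h : Z ⟶ W) :
    wr F η (g ≫ h) = eqToHom (by simp) ≫ wr F (wr F η g) h ≫ eqToHom (by simp) := by
  simp [wr, wr_congr _ (F.map_comp g h), Bicategory.Strict.associator_eqToIso]

theorem wl_wr {X Y Z W : C} (f : X ⟶ Y) {g g' : Y ⟶ Z} (η : F.map g ⟶ F.map g') (h : Z ⟶ W) :
    wr F (wl F f η) h = eqToHom (by simp) ≫ wl F f (wr F η h) ≫ eqToHom (by simp) := by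
  simp [wr, wl, Bicategory.Strict.associator_eqToIso]

theorem exchange {X Y Z : C} {f g : X ⟶ Y} {h i : Y ⟶ Z} (η : F.map f ⟶ F.map g)
    (θ : F.map h ⟶ F.map i) : wl F f θ ≫ wr F η i = wr F η h ≫ wl F g θ := by
  simp [wr, wl, Bicategory.whisker_exchange_assoc]

end

/-! ### The Gray tensor product -/

section
variable {A B : Type u} [Bicategory.{u, u} A] [Bicategory.Strict A]
  [Bicategory.{u, u} B] [Bicategory.Strict B]

/-- The 2-cells `f ⟹ g` of the Gray tensor product: pairs of 2-cells `π₁ f ⟹ π₁ g` in `A` and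
`π₂ f ⟹ π₂ g` in `B`. -/
@[ext]
structure Cell {X Y : FunnyObj A B} (f g : X ⟶ Y) : Type u where
  fst : Funny.fst.map f ⟶ Funny.fst.map g
  snd : Funny.snd.map f ⟶ Funny.snd.map g

instance homCategory (X Y : FunnyObj A B) : Category.{u} (X ⟶ Y) where
  Hom f g := Cell f g
  id _ := ⟨𝟙 _, 𝟙 _⟩
  comp η θ := ⟨η.fst ≫ θ.fst, η.snd ≫ θ.snd⟩
  id_comp _ := Cell.ext (Category.id_comp _) (Category.id_comp _)
  comp_id _ := Cell.ext (Category.comp_id _) (Category.comp_id _)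
  assoc _ _ _ := Cell.ext (Category.assoc _ _ _) (Category.assoc _ _ _)

theorem cell_ext {X Y : FunnyObj A B} {f g : X ⟶ Y} {η θ : f ⟶ g}
  (h₁ : Cell.fst η = Cell.fst θ) (h₂ : Cell.snd η = Cell.snd θ) : η = θ := Cell.ext h₁ h₂

theorem eqToHom_fst {X Y : FunnyObj A B} {f g : X ⟶ Y} (h : f = g) :
    Cell.fst (eqToHom h) = eqToHom (by rw [h]) := by subst h; rfl

theorem eqToHom_snd {X Y : FunnyObj A B} {f g : X ⟶ Y} (h : f = g) :
    Cell.snd (eqToHom h) = eqToHom (by rw [h]) := by subst h; rfl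

theorem comp_fst {X Y : FunnyObj A B} {f g h : X ⟶ Y} (η : f ⟶ g) (θ : g ⟶ h) :
    Cell.fst (η ≫ θ) = Cell.fst η ≫ Cell.fst θ := rfl

theorem comp_snd {X Y : FunnyObj A B} {f g h : X ⟶ Y} (η : f ⟶ g) (θ : g ⟶ h) :
    Cell.snd (η ≫ θ) = Cell.snd η ≫ Cell.snd θ := rfl

/-- The Gray tensor product of two 2-categories: its underlying category is the funny tensor product
of the underlying categories, and the comparison with the cartesian product `A × B` is locally
fully faithful. -/
instance bicategory : Bicategory.{u, u} (FunnyObj A B) where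
  homCategory X Y := homCategory X Y
  whiskerLeft f _ _ η := ⟨wl Funny.fst f η.fst, wl Funny.snd f η.snd⟩
  whiskerRight η h := ⟨wr Funny.fst η.fst h, wr Funny.snd η.snd h⟩
  associator f g h := eqToIso (Category.assoc f g h)
  leftUnitor f := eqToIso (Category.id_comp f)
  rightUnitor f := eqToIso (Category.comp_id f)
  whiskerLeft_id f g := cell_ext (wl_id _ f g) (wl_id _ f g)
  whiskerLeft_comp f _ _ _ η θ := cell_ext (wl_comp _ f _ _) (wl_comp _ f _ _)
  id_whiskerLeft η := cell_ext
    (by simp [comp_fst, eqToHom_fst, id_wl]) (by simp [comp_snd, eqToHom_snd, id_wl])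
  comp_whiskerLeft f g _ _ η := cell_ext
    (by simp [comp_fst, eqToHom_fst, comp_wl]) (by simp [comp_snd, eqToHom_snd, comp_wl])
  id_whiskerRight f g := cell_ext (wr_id _ f g) (wr_id _ f g)
  comp_whiskerRight _ _ _ := cell_ext (wr_comp _ _ _ _) (wr_comp _ _ _ _)
  whiskerRight_id η := cell_ext
    (by simp [comp_fst, eqToHom_fst, wr_one]) (by simp [comp_snd, eqToHom_snd, wr_one])
  whiskerRight_comp η g h := cell_ext
    (by simp [comp_fst, eqToHom_fst, wr_comp']) (by simp [comp_snd, eqToHom_snd, wr_comp'])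
  whisker_assoc f _ _ η h := cell_ext
    (by simp [comp_fst, eqToHom_fst, wl_wr]) (by simp [comp_snd, eqToHom_snd, wl_wr])
  whisker_exchange η θ := cell_ext (exchange _ _ _) (exchange _ _ _)
  pentagon f g h i := cell_ext
    (by simp [comp_fst, eqToHom_fst, wl_eqToHom, wr_eqToHom])
    (by simp [comp_snd, eqToHom_snd, wl_eqToHom, wr_eqToHom])
  triangle f g := cell_ext
    (by simp [comp_fst, eqToHom_fst, wl_eqToHom, wr_eqToHom])
    (by simp [comp_snd, eqToHom_snd, wl_eqToHom, wr_eqToHom])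

instance strict : Bicategory.Strict (FunnyObj A B) where
  id_comp f := Funny.category.id_comp f
  comp_id f := Funny.category.comp_id f
  assoc f g h := Funny.category.assoc f g h
  leftUnitor_eqToIso _ := rfl
  rightUnitor_eqToIso _ := rfl
  associator_eqToIso _ _ _ := rfl

end
end Gray

/-! ### 2-functors as functors acting on 2-cells -/

namespace TwoCat

section
variable {X A B : Type u} [Bicategory.{u, u} X] [Bicategory.Strict X]
  [Bicategory.{u, u} A] [Bicategory.Strict A] [Bicategory.{u, u} B] [Bicategory.Strict B]

/-- An action on 2-cells turning a functor between the underlying categories into a 2-functor. -/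
structure Cells (φ : X ⥤ A) where
  map₂ : ∀ {x y : X} {f g : x ⟶ y}, (f ⟶ g) → (φ.map f ⟶ φ.map g)
  map₂_id : ∀ {x y : X} (f : x ⟶ y), map₂ (𝟙 f) = 𝟙 (φ.map f)
  map₂_comp : ∀ {x y : X} {f g h : x ⟶ y} (η : f ⟶ g) (θ : g ⟶ h),
    map₂ (η ≫ θ) = map₂ η ≫ map₂ θ
  map₂_left : ∀ {x y z : X} (f : x ⟶ y) {g h : y ⟶ z} (η : g ⟶ h),
    map₂ (f ◁ η) = Gray.wl φ f (map₂ η)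
  map₂_right : ∀ {x y z : X} {f g : x ⟶ y} (η : f ⟶ g) (h : y ⟶ z),
    map₂ (η ▷ h) = Gray.wr φ (map₂ η) h

def Cells.toHom {φ : X ⥤ A} (c : Cells φ) : StrictPseudofunctor X A :=
  StrictPseudofunctor.mk''
    { obj := φ.obj
      map := φ.map
      map_id := φ.map_id
      map_comp := φ.map_comp
      map₂ := c.map₂
      map₂_id := c.map₂_id
      map₂_comp := c.map₂_comp
      map₂_whisker_left := c.map₂_left
      map₂_whisker_right := c.map₂_right }

def cells (F : StrictPseudofunctor X A) : Cells F.toFunctor where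
  map₂ := F.map₂
  map₂_id := F.map₂_id
  map₂_comp := F.map₂_comp
  map₂_left f _ _ η := by
    rw [F.map₂_whisker_left, F.mapComp_eq_eqToIso, F.mapComp_eq_eqToIso]
    rfl
  map₂_right η h := by
    rw [F.map₂_whisker_right, F.mapComp_eq_eqToIso, F.mapComp_eq_eqToIso]
    rfl

theorem toHom_cells (F : StrictPseudofunctor X A) : (cells F).toHom = F :=
  functor_ext rfl fun _ => HEq.rfl

def Cells.cast {φ ψ : X ⥤ A} (h : φ = ψ) (c : Cells ψ) : Cells φ := h ▸ c

theorem map₂_cast {φ ψ : X ⥤ A} (h : φ = ψ) (c : Cells ψ) {x y : X} {f g : x ⟶ y} (η : f ⟶ g) :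
    (c.cast h).map₂ η ≍ c.map₂ η := by
  subst h; rfl

theorem map₂_congr {F G : StrictPseudofunctor X A} (h : F = G) {x y : X} {f g : x ⟶ y}
    (η : f ⟶ g) : F.map₂ η ≍ G.map₂ η := by
  subst h; rfl

theorem wl_fst (φ : X ⥤ FunnyObj A B) {x y z : X} (f : x ⟶ y) {g h : y ⟶ z}
    (η : φ.map g ⟶ φ.map h) :
    Gray.Cell.fst (Gray.wl φ f η) = Gray.wl (φ ⋙ Funny.fst) f (Gray.Cell.fst η) := by
  have : Gray.Cell.fst (φ.map f ◁ η) = Gray.wl Funny.fst (φ.map f) (Gray.Cell.fst η) := rfl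
  simp only [Gray.wl, Gray.comp_fst, Gray.eqToHom_fst, this, eqToHom_trans_assoc,
    Category.assoc, eqToHom_trans]
  rfl

theorem wl_snd (φ : X ⥤ FunnyObj A B) {x y z : X} (f : x ⟶ y) {g h : y ⟶ z}
    (η : φ.map g ⟶ φ.map h) :
    Gray.Cell.snd (Gray.wl φ f η) = Gray.wl (φ ⋙ Funny.snd) f (Gray.Cell.snd η) := by
  have : Gray.Cell.snd (φ.map f ◁ η) = Gray.wl Funny.snd (φ.map f) (Gray.Cell.snd η) := rfl
  simp only [Gray.wl, Gray.comp_snd, Gray.eqToHom_snd, this, eqToHom_trans_assoc,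
    Category.assoc, eqToHom_trans]
  rfl

theorem wr_fst (φ : X ⥤ FunnyObj A B) {x y z : X} {f g : x ⟶ y}
    (η : φ.map f ⟶ φ.map g) (h : y ⟶ z) :
    Gray.Cell.fst (Gray.wr φ η h) = Gray.wr (φ ⋙ Funny.fst) (Gray.Cell.fst η) h := by
  have : Gray.Cell.fst (η ▷ φ.map h) = Gray.wr Funny.fst (Gray.Cell.fst η) (φ.map h) := rfl
  simp only [Gray.wr, Gray.comp_fst, Gray.eqToHom_fst, this, eqToHom_trans_assoc,
    Category.assoc, eqToHom_trans]
  rfl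

theorem wr_snd (φ : X ⥤ FunnyObj A B) {x y z : X} {f g : x ⟶ y}
    (η : φ.map f ⟶ φ.map g) (h : y ⟶ z) :
    Gray.Cell.snd (Gray.wr φ η h) = Gray.wr (φ ⋙ Funny.snd) (Gray.Cell.snd η) h := by
  have : Gray.Cell.snd (η ▷ φ.map h) = Gray.wr Funny.snd (Gray.Cell.snd η) (φ.map h) := rfl
  simp only [Gray.wr, Gray.comp_snd, Gray.eqToHom_snd, this, eqToHom_trans_assoc,
    Category.assoc, eqToHom_trans]
  rfl

def pairCells {φ : X ⥤ FunnyObj A B} (c : Cells (φ ⋙ Funny.fst)) (d : Cells (φ ⋙ Funny.snd)) :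
    Cells φ where
  map₂ η := ⟨c.map₂ η, d.map₂ η⟩
  map₂_id f := Gray.cell_ext (c.map₂_id f) (d.map₂_id f)
  map₂_comp η θ := Gray.cell_ext (c.map₂_comp η θ) (d.map₂_comp η θ)
  map₂_left f _ _ η := Gray.cell_ext
    ((c.map₂_left f η).trans
      (wl_fst φ f (⟨c.map₂ η, d.map₂ η⟩ : Gray.Cell _ _)).symm) ((d.map₂_left f η).trans
      (wl_snd φ f (⟨c.map₂ η, d.map₂ η⟩ : Gray.Cell _ _)).symm)
  map₂_right η h := Gray.cell_ext
    ((c.map₂_right η h).trans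
      (wr_fst φ (⟨c.map₂ η, d.map₂ η⟩ : Gray.Cell _ _) h).symm) ((d.map₂_right η h).trans
      (wr_snd φ (⟨c.map₂ η, d.map₂ η⟩ : Gray.Cell _ _) h).symm)

end

/-- The Gray tensor product `A ⊠ B`. -/
def gray (A B : TwoCat.{u}) : TwoCat.{u} := ⟨FunnyObj A B⟩

section
variable {X A B C D : TwoCat.{u}}

def U (F : A ⟶ B) : A ⥤ B := StrictPseudofunctor.toFunctor F

/-- The projection `A ⊠ B ⟶ A`. -/
def pr₁ (A B : TwoCat.{u}) : gray A B ⟶ A :=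
  Cells.toHom (φ := Funny.fst (A := A) (B := B))
    { map₂ := fun η => Gray.Cell.fst η
      map₂_id := fun _ => rfl
      map₂_comp := fun _ _ => rfl
      map₂_left := fun _ _ _ _ => rfl
      map₂_right := fun _ _ => rfl }

/-- The projection `A ⊠ B ⟶ B`. -/
def pr₂ (A B : TwoCat.{u}) : gray A B ⟶ B :=
  Cells.toHom (φ := Funny.snd (A := A) (B := B))
    { map₂ := fun η => Gray.Cell.snd η
      map₂_id := fun _ => rfl
      map₂_comp := fun _ _ => rfl
      map₂_left := fun _ _ _ _ => rfl
      map₂_right := fun _ _ => rfl }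

/-- A 2-functor into `A ⊠ B` is a functor into the funny tensor product whose two projections are
extended to 2-functors. -/
def grayLift (φ : X ⥤ FunnyObj A B) (ψ₁ : X ⟶ A) (ψ₂ : X ⟶ B)
    (h₁ : φ ⋙ Funny.fst = U ψ₁) (h₂ : φ ⋙ Funny.snd = U ψ₂) : X ⟶ gray A B :=
  Cells.toHom (φ := φ) (pairCells ((cells ψ₁).cast h₁) ((cells ψ₂).cast h₂))

theorem grayLift_pr₁ (φ : X ⥤ FunnyObj A B) (ψ₁ : X ⟶ A) (ψ₂ : X ⟶ B)
    (h₁ : φ ⋙ Funny.fst = U ψ₁) (h₂ : φ ⋙ Funny.snd = U ψ₂) :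
    grayLift φ ψ₁ ψ₂ h₁ h₂ ≫ pr₁ A B = ψ₁ :=
  functor_ext h₁ fun η => map₂_cast h₁ (cells ψ₁) η

theorem grayLift_pr₂ (φ : X ⥤ FunnyObj A B) (ψ₁ : X ⟶ A) (ψ₂ : X ⟶ B)
    (h₁ : φ ⋙ Funny.fst = U ψ₁) (h₂ : φ ⋙ Funny.snd = U ψ₂) :
    grayLift φ ψ₁ ψ₂ h₁ h₂ ≫ pr₂ A B = ψ₂ :=
  functor_ext h₂ fun η => map₂_cast h₂ (cells ψ₂) η

theorem gray_ext {F G : X ⟶ gray A B} (h : U F = U G)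
    (h₁ : F ≫ pr₁ A B = G ≫ pr₁ A B) (h₂ : F ≫ pr₂ A B = G ≫ pr₂ A B) : F = G := by
  obtain ⟨φ, c, rfl⟩ : ∃ (φ : X ⥤ FunnyObj A B) (c : Cells φ), F = c.toHom :=
    ⟨U F, cells F, (toHom_cells F).symm⟩
  obtain ⟨ψ, d, rfl⟩ : ∃ (φ : X ⥤ FunnyObj A B) (c : Cells φ), G = c.toHom :=
    ⟨U G, cells G, (toHom_cells G).symm⟩
  obtain rfl : φ = ψ := h
  refine functor_ext rfl fun η => heq_of_eq ?_
  exact Gray.cell_ext (eq_of_heq (map₂_congr h₁ η)) (eq_of_heq (map₂_congr h₂ η))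

def const (X : TwoCat.{u}) {A : TwoCat.{u}} (a : A) : X ⟶ A :=
  Cells.toHom (φ := (Functor.const X).obj a)
    { map₂ := fun _ => 𝟙 (𝟙 a)
      map₂_id := fun _ => rfl
      map₂_comp := fun _ _ => (Category.comp_id _).symm
      map₂_left := fun f g _ _ => (Gray.wl_id ((Functor.const X).obj a) f g).symm
      map₂_right := fun {_ _ _ f _} _ h => (Gray.wr_id ((Functor.const X).obj a) f h).symm }

theorem U_id (A : TwoCat.{u}) : U (𝟙 A) = 𝟭 A := rfl
theorem U_comp (F : A ⟶ B) (G : B ⟶ C) : U (F ≫ G) = U F ⋙ U G := rfl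

def inl (A : TwoCat.{u}) {B : TwoCat.{u}} (b : B) : A ⟶ gray A B :=
  grayLift (Funny.inl A b) (𝟙 A) (const A b) rfl rfl

def inr {A : TwoCat.{u}} (B : TwoCat.{u}) (a : A) : B ⟶ gray A B :=
  grayLift (Funny.inr B a) (const B a) (𝟙 B) rfl rfl

theorem inl_pr₁ (b : B) :
    inl A b ≫ pr₁ A B = 𝟙 A := grayLift_pr₁ _ _ _ _ _

theorem inl_pr₁_assoc (b : B) {Z : TwoCat.{u}} (k : _ ⟶ Z) :
    inl A b ≫ pr₁ A B ≫ k = k := by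
  rw [← Category.assoc, inl_pr₁]; exact Category.id_comp k

theorem inl_pr₂ (b : B) :
    inl A b ≫ pr₂ A B = const A b := grayLift_pr₂ _ _ _ _ _

theorem inl_pr₂_assoc (b : B) {Z : TwoCat.{u}} (k : _ ⟶ Z) :
    inl A b ≫ pr₂ A B ≫ k = const A b ≫ k := by
  rw [← Category.assoc, inl_pr₂]

theorem inr_pr₁ (a : A) :
    inr B a ≫ pr₁ A B = const B a := grayLift_pr₁ _ _ _ _ _

theorem inr_pr₁_assoc (a : A) {Z : TwoCat.{u}} (k : _ ⟶ Z) :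
    inr B a ≫ pr₁ A B ≫ k = const B a ≫ k := by
  rw [← Category.assoc, inr_pr₁]

theorem inr_pr₂ (a : A) :
    inr B a ≫ pr₂ A B = 𝟙 B := grayLift_pr₂ _ _ _ _ _

theorem inr_pr₂_assoc (a : A) {Z : TwoCat.{u}} (k : _ ⟶ Z) :
    inr B a ≫ pr₂ A B ≫ k = k := by
  rw [← Category.assoc, inr_pr₂]; exact Category.id_comp k


theorem hom_ext {F G : gray A B ⟶ gray C D} (hl : ∀ b, inl A b ≫ F = inl A b ≫ G)
    (hr : ∀ a, inr B a ≫ F = inr B a ≫ G) (h₁ : F ≫ pr₁ C D = G ≫ pr₁ C D)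
    (h₂ : F ≫ pr₂ C D = G ≫ pr₂ C D) : F = G :=
  gray_ext (Funny.functor_ext (fun b => congrArg U (hl b)) (fun a => congrArg U (hr a))) h₁ h₂

theorem id_heq {a b : A} {k k' : a ⟶ b} (h : k = k') : 𝟙 k ≍ 𝟙 k' := by subst h; rfl

theorem const_comp (x : A) (F : A ⟶ B) : const X x ≫ F = const X ((U F).obj x) :=
  functor_ext
    (CategoryTheory.Functor.ext (fun _ => rfl) fun _ _ _ =>
      ((U F).map_id x).trans (by
        change 𝟙 _ = 𝟙 _ ≫ 𝟙 _ ≫ 𝟙 _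
        rw [Category.id_comp, Category.id_comp]))
    fun _ => (heq_of_eq (F.map₂_id (𝟙 x))).trans (id_heq ((U F).map_id x))

theorem comp_const (F : X ⟶ A) (b : B) : F ≫ const A b = const X b :=
  functor_ext rfl fun _ => HEq.rfl

def grayMap (F : A ⟶ C) (G : B ⟶ D) : gray A B ⟶ gray C D :=
  grayLift (Funny.map (U F) (U G)) (pr₁ A B ≫ F) (pr₂ A B ≫ G)
    (Funny.functor_ext (fun _ => rfl) (fun a => congrArg U (const_comp (X := B) a F).symm))
    (Funny.functor_ext (fun b => congrArg U (const_comp (X := A) b G).symm) (fun _ => rfl))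

theorem grayMap_pr₁ (F : A ⟶ C) (G : B ⟶ D) :
    grayMap F G ≫ pr₁ C D = pr₁ A B ≫ F := grayLift_pr₁ _ _ _ _ _

theorem grayMap_pr₁_assoc (F : A ⟶ C) (G : B ⟶ D) {Z : TwoCat.{u}} (k : _ ⟶ Z) :
    grayMap F G ≫ pr₁ C D ≫ k = pr₁ A B ≫ F ≫ k := by
  rw [← Category.assoc, grayMap_pr₁, Category.assoc]

theorem grayMap_pr₂ (F : A ⟶ C) (G : B ⟶ D) :
    grayMap F G ≫ pr₂ C D = pr₂ A B ≫ G := grayLift_pr₂ _ _ _ _ _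

theorem grayMap_pr₂_assoc (F : A ⟶ C) (G : B ⟶ D) {Z : TwoCat.{u}} (k : _ ⟶ Z) :
    grayMap F G ≫ pr₂ C D ≫ k = pr₂ A B ≫ G ≫ k := by
  rw [← Category.assoc, grayMap_pr₂, Category.assoc]


theorem inl_grayMap (F : A ⟶ C) (G : B ⟶ D) (b : B) :
    inl A b ≫ grayMap F G = F ≫ inl C ((U G).obj b) :=
  gray_ext rfl
    (by simp only [Category.assoc, grayMap_pr₁, inl_pr₁_assoc, inl_pr₁, Category.comp_id])
    (by simp only [Category.assoc, grayMap_pr₂, inl_pr₂_assoc, inl_pr₂, const_comp, comp_const])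

theorem inl_grayMap_assoc (F : A ⟶ C) (G : B ⟶ D) (b : B) {Z : TwoCat.{u}} (k : _ ⟶ Z) :
    inl A b ≫ grayMap F G ≫ k = F ≫ inl C ((U G).obj b) ≫ k := by
  rw [← Category.assoc, inl_grayMap, Category.assoc]

theorem inr_grayMap (F : A ⟶ C) (G : B ⟶ D) (a : A) :
    inr B a ≫ grayMap F G = G ≫ inr D ((U F).obj a) :=
  gray_ext rfl
    (by simp only [Category.assoc, grayMap_pr₁, inr_pr₁_assoc, inr_pr₁, const_comp, comp_const])
    (by simp only [Category.assoc, grayMap_pr₂, inr_pr₂_assoc, inr_pr₂, Category.comp_id])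

theorem inr_grayMap_assoc (F : A ⟶ C) (G : B ⟶ D) (a : A) {Z : TwoCat.{u}} (k : _ ⟶ Z) :
    inr B a ≫ grayMap F G ≫ k = G ≫ inr D ((U F).obj a) ≫ k := by
  rw [← Category.assoc, inr_grayMap, Category.assoc]


def assocHom (A B C : TwoCat.{u}) : gray (gray A B) C ⟶ gray A (gray B C) :=
  grayLift (Funny.assoc A B C) (pr₁ (gray A B) C ≫ pr₁ A B) (grayMap (pr₂ A B) (𝟙 C))
    (Funny.functor_ext (fun _ => Funny.functor_ext (fun _ => rfl) (fun _ => rfl)) (fun _ => rfl))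
    (Funny.functor_ext (fun c => Funny.functor_ext
      (fun b => congrArg U (const_comp (X := A) b (inl B c)).symm) (fun _ => rfl)) (fun _ => rfl))

def assocInv (A B C : TwoCat.{u}) : gray A (gray B C) ⟶ gray (gray A B) C :=
  grayLift (Funny.assocInv A B C) (grayMap (𝟙 A) (pr₁ B C)) (pr₂ A (gray B C) ≫ pr₂ B C)
    (Funny.functor_ext (fun _ => rfl) (fun a => Funny.functor_ext (fun _ => rfl)
      (fun b => congrArg U (const_comp (X := C) b (inr B a)).symm)))
    (Funny.functor_ext (fun _ => rfl) (fun _ => Funny.functor_ext (fun _ => rfl) (fun _ => rfl)))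

def swap (A B : TwoCat.{u}) : gray A B ⟶ gray B A :=
  grayLift (Funny.swap A B) (pr₂ A B) (pr₁ A B)
    (Funny.functor_ext (fun _ => rfl) (fun _ => rfl))
    (Funny.functor_ext (fun _ => rfl) (fun _ => rfl))


theorem assocHom_pr₁ (A B C : TwoCat.{u}) :
    assocHom A B C ≫ pr₁ A (gray B C) = pr₁ (gray A B) C ≫ pr₁ A B := grayLift_pr₁ _ _ _ _ _

theorem assocHom_pr₁_assoc (A B C : TwoCat.{u}) {Z : TwoCat.{u}} (k : _ ⟶ Z) :
    assocHom A B C ≫ pr₁ A (gray B C) ≫ k = pr₁ (gray A B) C ≫ pr₁ A B ≫ k := by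
  rw [← Category.assoc, assocHom_pr₁, Category.assoc]

theorem assocHom_pr₂ (A B C : TwoCat.{u}) :
    assocHom A B C ≫ pr₂ A (gray B C) = grayMap (pr₂ A B) (𝟙 C) := grayLift_pr₂ _ _ _ _ _

theorem assocHom_pr₂_assoc (A B C : TwoCat.{u}) {Z : TwoCat.{u}} (k : _ ⟶ Z) :
    assocHom A B C ≫ pr₂ A (gray B C) ≫ k = grayMap (pr₂ A B) (𝟙 C) ≫ k := by
  rw [← Category.assoc, assocHom_pr₂]

theorem assocInv_pr₁ (A B C : TwoCat.{u}) :
    assocInv A B C ≫ pr₁ (gray A B) C = grayMap (𝟙 A) (pr₁ B C) := grayLift_pr₁ _ _ _ _ _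

theorem assocInv_pr₁_assoc (A B C : TwoCat.{u}) {Z : TwoCat.{u}} (k : _ ⟶ Z) :
    assocInv A B C ≫ pr₁ (gray A B) C ≫ k = grayMap (𝟙 A) (pr₁ B C) ≫ k := by
  rw [← Category.assoc, assocInv_pr₁]

theorem assocInv_pr₂ (A B C : TwoCat.{u}) :
    assocInv A B C ≫ pr₂ (gray A B) C = pr₂ A (gray B C) ≫ pr₂ B C := grayLift_pr₂ _ _ _ _ _

theorem assocInv_pr₂_assoc (A B C : TwoCat.{u}) {Z : TwoCat.{u}} (k : _ ⟶ Z) :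
    assocInv A B C ≫ pr₂ (gray A B) C ≫ k = pr₂ A (gray B C) ≫ pr₂ B C ≫ k := by
  rw [← Category.assoc, assocInv_pr₂, Category.assoc]

theorem swap_pr₁ (A B : TwoCat.{u}) :
    swap A B ≫ pr₁ B A = pr₂ A B := grayLift_pr₁ _ _ _ _ _

theorem swap_pr₁_assoc (A B : TwoCat.{u}) {Z : TwoCat.{u}} (k : _ ⟶ Z) :
    swap A B ≫ pr₁ B A ≫ k = pr₂ A B ≫ k := by
  rw [← Category.assoc, swap_pr₁]

theorem swap_pr₂ (A B : TwoCat.{u}) :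
    swap A B ≫ pr₂ B A = pr₁ A B := grayLift_pr₂ _ _ _ _ _

theorem swap_pr₂_assoc (A B : TwoCat.{u}) {Z : TwoCat.{u}} (k : _ ⟶ Z) :
    swap A B ≫ pr₂ B A ≫ k = pr₁ A B ≫ k := by
  rw [← Category.assoc, swap_pr₂]


def pt (a : A) (b : B) : gray A B := (⟨a, b⟩ : FunnyObj A B)
def pfst (x : gray A B) : A := FunnyObj.fst x
def psnd (x : gray A B) : B := FunnyObj.snd x
theorem pfst_pt (a : A) (b : B) : pfst (pt a b) = a := rfl
theorem psnd_pt (a : A) (b : B) : psnd (pt a b) = b := rfl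
theorem pt_eta (x : gray A B) : pt (pfst x) (psnd x) = x := rfl
theorem U_const (x : A) : U (const X x) = (Functor.const X).obj x := rfl

theorem inl_swap (b : B) :
    inl A b ≫ swap A B = inr A b :=
  gray_ext rfl (by simp only [Category.assoc, swap_pr₁, inl_pr₂, inr_pr₁])
    (by simp only [Category.assoc, swap_pr₂, inl_pr₁, inr_pr₂])

theorem inl_swap_assoc (b : B) {Z : TwoCat.{u}} (k : _ ⟶ Z) :
    inl A b ≫ swap A B ≫ k = inr A b ≫ k := by
  rw [← Category.assoc, inl_swap]

theorem inr_swap (a : A) :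
    inr B a ≫ swap A B = inl B a :=
  gray_ext rfl (by simp only [Category.assoc, swap_pr₁, inr_pr₂, inl_pr₁])
    (by simp only [Category.assoc, swap_pr₂, inr_pr₁, inl_pr₂])

theorem inr_swap_assoc (a : A) {Z : TwoCat.{u}} (k : _ ⟶ Z) :
    inr B a ≫ swap A B ≫ k = inl B a ≫ k := by
  rw [← Category.assoc, inr_swap]


theorem inl_assocHom (c : C) :
    inl (gray A B) c ≫ assocHom A B C = grayMap (𝟙 A) (inl B c) :=
  gray_ext rfl
    (by simp only [Category.assoc, assocHom_pr₁, inl_pr₁_assoc, grayMap_pr₁, Category.comp_id])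
    (by simp only [Category.assoc, assocHom_pr₂, inl_grayMap, grayMap_pr₂]; rfl)

theorem inl_assocHom_assoc (c : C) {Z : TwoCat.{u}} (k : _ ⟶ Z) :
    inl (gray A B) c ≫ assocHom A B C ≫ k = grayMap (𝟙 A) (inl B c) ≫ k := by
  rw [← Category.assoc, inl_assocHom]

theorem inr_assocHom (X : gray A B) :
    inr C X ≫ assocHom A B C = inr C (psnd X) ≫ inr (gray B C) (pfst X) :=
  gray_ext rfl
    (by simp only [Category.assoc, assocHom_pr₁, inr_pr₁_assoc, inr_pr₁, const_comp, comp_const]; rfl)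
    (by simp only [Category.assoc, assocHom_pr₂, inr_grayMap, inr_pr₂, Category.id_comp,
      Category.comp_id]; rfl)

theorem inr_assocHom_assoc (X : gray A B) {Z : TwoCat.{u}} (k : _ ⟶ Z) :
    inr C X ≫ assocHom A B C ≫ k = inr C (psnd X) ≫ inr (gray B C) (pfst X) ≫ k := by
  rw [← Category.assoc, inr_assocHom, Category.assoc]

theorem inl_assocInv (Y : gray B C) :
    inl A Y ≫ assocInv A B C = inl A (pfst Y) ≫ inl (gray A B) (psnd Y) :=
  gray_ext rfl
    (by simp only [Category.assoc, assocInv_pr₁, inl_grayMap, inl_pr₁, Category.id_comp,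
      Category.comp_id]; rfl)
    (by simp only [Category.assoc, assocInv_pr₂, inl_pr₂_assoc, inl_pr₂, const_comp, comp_const]; rfl)

theorem inl_assocInv_assoc (Y : gray B C) {Z : TwoCat.{u}} (k : _ ⟶ Z) :
    inl A Y ≫ assocInv A B C ≫ k = inl A (pfst Y) ≫ inl (gray A B) (psnd Y) ≫ k := by
  rw [← Category.assoc, inl_assocInv, Category.assoc]

theorem inr_assocInv (a : A) :
    inr (gray B C) a ≫ assocInv A B C = grayMap (inr B a) (𝟙 C) :=
  gray_ext rfl
    (by simp only [Category.assoc, assocInv_pr₁, inr_grayMap, grayMap_pr₁]; rfl)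
    (by simp only [Category.assoc, assocInv_pr₂, inr_pr₂_assoc, grayMap_pr₂, Category.comp_id])

theorem inr_assocInv_assoc (a : A) {Z : TwoCat.{u}} (k : _ ⟶ Z) :
    inr (gray B C) a ≫ assocInv A B C ≫ k = grayMap (inr B a) (𝟙 C) ≫ k := by
  rw [← Category.assoc, inr_assocInv]


theorem U_id_obj (x : A) : (U (𝟙 A)).obj x = x := rfl
theorem U_comp_obj (F : A ⟶ B) (G : B ⟶ C) (x : A) :
    (U (F ≫ G)).obj x = (U G).obj ((U F).obj x) := rfl
theorem U_const_obj (x : X) (a : A) : (U (const X a)).obj x = a := rfl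
theorem U_pr₁_obj (x : gray A B) : (U (pr₁ A B)).obj x = pfst x := rfl
theorem U_pr₂_obj (x : gray A B) : (U (pr₂ A B)).obj x = psnd x := rfl
theorem U_inl_obj (a : A) (b : B) : (U (inl A b)).obj a = pt a b := rfl
theorem U_inr_obj (a : A) (b : B) : (U (inr B a)).obj b = pt a b := rfl
theorem U_grayMap_obj (F : A ⟶ C) (G : B ⟶ D) (x : gray A B) :
    (U (grayMap F G)).obj x = pt ((U F).obj (pfst x)) ((U G).obj (psnd x)) := rfl
theorem U_assocHom_obj (x : gray (gray A B) C) : (U (assocHom A B C)).obj x =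
    pt (pfst (pfst x)) (pt (psnd (pfst x)) (psnd x)) := rfl
theorem U_assocInv_obj (x : gray A (gray B C)) : (U (assocInv A B C)).obj x =
    pt (pt (pfst x) (pfst (psnd x))) (psnd (psnd x)) := rfl
theorem U_swap_obj (x : gray A B) : (U (swap A B)).obj x = pt (psnd x) (pfst x) := rfl

attribute [local simp] U_const_obj pfst_pt psnd_pt pt_eta U_id_obj U_comp_obj U_pr₁_obj U_pr₂_obj U_inl_obj U_inr_obj U_grayMap_obj
  U_assocHom_obj U_assocInv_obj U_swap_obj inl_pr₁ inl_pr₂ inr_pr₁ inr_pr₂ inl_pr₁_assoc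
  inl_pr₂_assoc inr_pr₁_assoc inr_pr₂_assoc grayMap_pr₁ grayMap_pr₂ grayMap_pr₁_assoc
  grayMap_pr₂_assoc inl_grayMap inr_grayMap inl_grayMap_assoc inr_grayMap_assoc assocHom_pr₁
  assocHom_pr₂ assocHom_pr₁_assoc assocHom_pr₂_assoc assocInv_pr₁ assocInv_pr₂ assocInv_pr₁_assoc
  assocInv_pr₂_assoc swap_pr₁ swap_pr₂ swap_pr₁_assoc swap_pr₂_assoc inl_swap inr_swap
  inl_swap_assoc inr_swap_assoc inl_assocHom inr_assocHom inl_assocHom_assoc inr_assocHom_assoc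
  inl_assocInv inr_assocInv inl_assocInv_assoc inr_assocInv_assoc const_comp comp_const

theorem const_comp_assoc (x : A) (F : A ⟶ B) (G : B ⟶ C) :
    const X x ≫ F ≫ G = const X ((U G).obj ((U F).obj x)) := by simp

theorem grayMap_id : grayMap (𝟙 A) (𝟙 B) = 𝟙 (gray A B) := by
  apply hom_ext <;> intros <;> simp

theorem grayMap_comp {A₁ A₂ A₃ B₁ B₂ B₃ : TwoCat.{u}} (F : A₁ ⟶ A₂) (F' : A₂ ⟶ A₃)
    (G : B₁ ⟶ B₂) (G' : B₂ ⟶ B₃) :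
    grayMap F G ≫ grayMap F' G' = grayMap (F ≫ F') (G ≫ G') := by
  apply hom_ext <;> intros <;> simp

attribute [local simp] grayMap_id grayMap_comp const_comp_assoc

theorem assocHom_grayMap_pr₁ :
    assocHom A B C ≫ grayMap (𝟙 A) (pr₁ B C) = pr₁ (gray A B) C := by
  apply hom_ext <;> intros <;> simp

theorem assocInv_grayMap_pr₂ :
    assocInv A B C ≫ grayMap (pr₂ A B) (𝟙 C) = pr₂ A (gray B C) := by
  apply hom_ext <;> intros <;> simp

attribute [local simp] assocHom_grayMap_pr₁ assocInv_grayMap_pr₂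

theorem assocHom_assocInv : assocHom A B C ≫ assocInv A B C = 𝟙 _ := by
  apply hom_ext
  · intro c; apply hom_ext <;> intros <;> simp
  · intros; simp
  · simp
  · simp

theorem assocInv_assocHom : assocInv A B C ≫ assocHom A B C = 𝟙 _ := by
  apply hom_ext
  · intros; simp
  · intro c; apply hom_ext <;> intros <;> simp
  · simp
  · simp


theorem swap_swap : swap A B ≫ swap B A = 𝟙 _ := by
  apply hom_ext <;> intros <;> simp


/-! ### The unit and the symmetric monoidal structure -/

/-- The terminal 2-category. -/
def one : TwoCat.{u} := ⟨LocallyDiscrete (Discrete PUnit.{u + 1})⟩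

def star : one.{u} := ⟨⟨PUnit.unit⟩⟩

instance (x y : one.{u}) : Subsingleton (x ⟶ y) :=
  ⟨fun f g => by
    obtain ⟨⟨⟨⟩⟩⟩ := f; obtain ⟨⟨⟨⟩⟩⟩ := g; rfl⟩

instance (x y : one.{u}) (f g : x ⟶ y) : Subsingleton (f ⟶ g) :=
  ⟨fun η θ => by obtain ⟨⟨_⟩⟩ := η; obtain ⟨⟨_⟩⟩ := θ; rfl⟩

theorem obj_one (x : one.{u}) : x = star := rfl

theorem to_one_ext {X : TwoCat.{u}} (F G : X ⟶ one) : F = G :=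
  functor_ext (CategoryTheory.Functor.ext
      (fun _ => (obj_one _).trans (obj_one _).symm) fun _ _ _ => Subsingleton.elim _ _)
    fun _ => Subsingleton.helim (by congr 1 <;> exact Subsingleton.elim _ _) _ _

theorem from_one (F : one ⟶ A) : F = const one ((U F).obj star) := by
  rw [← const_comp star F, to_one_ext (const one star) (𝟙 one), Category.id_comp]

theorem pr₂_inl_star : pr₁ A one ≫ inl A star = 𝟙 _ := by
  apply hom_ext
  · intro b; obtain rfl := obj_one b; simp
  · intro a; rw [from_one (inr one a)]; simp
  · simp
  · exact to_one_ext _ _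

theorem pr₁_inr_star : pr₂ one A ≫ inr A star = 𝟙 _ := by
  apply hom_ext
  · intro a; rw [from_one (inl one a)]; simp
  · intro b; obtain rfl := obj_one b; simp
  · exact to_one_ext _ _
  · simp

/-- The Gray tensor product, with the terminal 2-category as unit and the evident structural
isomorphisms. -/
instance : MonoidalCategoryStruct TwoCat.{u} where
  tensorObj A B := gray A B
  tensorHom F G := grayMap F G
  whiskerLeft A _ _ G := grayMap (𝟙 A) G
  whiskerRight F B := grayMap F (𝟙 B)
  tensorUnit := one
  associator A B C := ⟨assocHom A B C, assocInv A B C, assocHom_assocInv, assocInv_assocHom⟩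
  leftUnitor A := ⟨pr₂ one A, inr A star, pr₁_inr_star, inr_pr₂ _⟩
  rightUnitor A := ⟨pr₁ A one, inl A star, pr₂_inl_star, inl_pr₁ _⟩

theorem assoc_naturality {A A' B B' C C' : TwoCat.{u}} (F : A ⟶ A') (G : B ⟶ B') (H : C ⟶ C') :
    grayMap (grayMap F G) H ≫ assocHom A' B' C' = assocHom A B C ≫ grayMap F (grayMap G H) := by
  apply hom_ext
  · intros; apply hom_ext <;> intros <;> simp
  · intros; simp
  · simp
  · simp

theorem gray_pentagon (A B C D : TwoCat.{u}) :
    grayMap (assocHom A B C) (𝟙 D) ≫ assocHom A (gray B C) D ≫ grayMap (𝟙 A) (assocHom B C D) =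
      assocHom (gray A B) C D ≫ assocHom A B (gray C D) := by
  apply hom_ext
  · intros; apply hom_ext
    · intros; apply hom_ext <;> intros <;> simp
    · intros; simp
    · simp
    · simp
  · intros; simp
  · simp
  · simp
    have h := assoc_naturality (pr₂ A B) (𝟙 C) (𝟙 D)
    rw [grayMap_id] at h
    rw [← h, ← Category.assoc, grayMap_comp, assocHom_pr₂, Category.comp_id]

theorem gray_triangle (A B : TwoCat.{u}) :
    assocHom A one B ≫ grayMap (𝟙 A) (pr₂ one B) = grayMap (pr₁ A one) (𝟙 B) := by
  apply hom_ext
  · intros; apply hom_ext <;> intros <;> simp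
  · intros; simp
  · simp
  · simp

instance : MonoidalCategory TwoCat.{u} :=
  MonoidalCategory.ofTensorHom
    (id_tensorHom_id := fun _ _ => grayMap_id)
    (id_tensorHom := fun _ _ _ _ => rfl)
    (tensorHom_id := fun _ _ => rfl)
    (tensorHom_comp_tensorHom := fun _ _ _ _ => grayMap_comp _ _ _ _)
    (associator_naturality := assoc_naturality)
    (leftUnitor_naturality := fun _ => grayMap_pr₂ _ _)
    (rightUnitor_naturality := fun _ => grayMap_pr₁ _ _)
    (pentagon := gray_pentagon)
    (triangle := gray_triangle)

theorem swap_naturality (F : A ⟶ C) (G : B ⟶ D) :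
    grayMap F G ≫ swap C D = swap A B ≫ grayMap G F := by
  apply hom_ext <;> intros <;> simp

theorem gray_hexagon (A B C : TwoCat.{u}) :
    assocHom A B C ≫ swap A (gray B C) ≫ assocHom B C A =
      grayMap (swap A B) (𝟙 C) ≫ assocHom B A C ≫ grayMap (𝟙 B) (swap A C) := by
  apply hom_ext
  · intros; apply hom_ext
    · intros; simp
    · intros; simp
    · simp
    · apply hom_ext <;> intros <;> simp
  · intros; simp
  · simp
  · apply hom_ext
    · intros; apply hom_ext <;> intros <;> simp
    · intros; simp
    · simp
    · simp

theorem gray_hexagon' (A B C : TwoCat.{u}) :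
    assocInv A B C ≫ swap (gray A B) C ≫ assocInv C A B =
      grayMap (𝟙 A) (swap B C) ≫ assocInv A C B ≫ grayMap (swap A C) (𝟙 B) := by
  apply hom_ext
  · intros; simp
  · intros; apply hom_ext
    · intros; simp
    · intros; simp
    · apply hom_ext <;> intros <;> simp
    · simp
  · apply hom_ext
    · intros; simp
    · intros; apply hom_ext <;> intros <;> simp
    · simp
    · simp
  · simp

instance : SymmetricCategory TwoCat.{u} where
  braiding A B := ⟨swap A B, swap B A, swap_swap, swap_swap⟩
  braiding_naturality_right A _ _ G := swap_naturality (𝟙 A) G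
  braiding_naturality_left F B := swap_naturality F (𝟙 B)
  hexagon_forward := gray_hexagon
  hexagon_reverse := gray_hexagon'
  symmetry _ _ := swap_swap

end
end TwoCat

/-! ### Asynchronous graphs -/

/-- A small asynchronous graph: a graph with a set of permutation tiles `u₁ · u₂ ⋄ v₁ · v₂` between
parallel paths of length two, which is symmetric, deterministic and has the cube property. (The
tiles in `cube` force `u₁ · u₂ · u₃` and `v₁ · v₂ · v₃` to be parallel paths.) -/
structure Asynch : Type (u + 1) where
  V : Type u
  E : Type u
  src : E → V
  tgt : E → V
  tile : E → E → E → E → Prop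
  square : ∀ {u₁ u₂ v₁ v₂ : E}, tile u₁ u₂ v₁ v₂ →
    tgt u₁ = src u₂ ∧ tgt v₁ = src v₂ ∧ src u₁ = src v₁ ∧ tgt u₂ = tgt v₂
  symm : ∀ {u₁ u₂ v₁ v₂ : E}, tile u₁ u₂ v₁ v₂ → tile v₁ v₂ u₁ u₂
  deterministic : ∀ {u₁ u₂ v₁ v₂ w₁ w₂ : E}, tile u₁ u₂ v₁ v₂ → tile u₁ u₂ w₁ w₂ →
    v₁ = w₁ ∧ v₂ = w₂
  cube : ∀ u₁ u₂ u₃ v₁ v₂ v₃ : E,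
    (∃ w₃ u₂' v₂', tile u₂ u₃ u₂' w₃ ∧ tile u₁ u₂' v₁ v₂' ∧ tile v₂' w₃ v₂ v₃) ↔
    (∃ w₁ u₂'' v₂'', tile u₁ u₂ w₁ u₂'' ∧ tile u₂'' u₃ v₂'' v₃ ∧ tile w₁ v₂'' v₁ v₂)

namespace Asynch

/-- Asynchronous homomorphisms: graph homomorphisms preserving the permutation tiles. -/
@[ext]
structure Hom (G H : Asynch.{u}) : Type u where
  onV : G.V → H.V
  onE : G.E → H.E
  src : ∀ e, H.src (onE e) = onV (G.src e)
  tgt : ∀ e, H.tgt (onE e) = onV (G.tgt e)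
  tile : ∀ {u₁ u₂ v₁ v₂ : G.E}, G.tile u₁ u₂ v₁ v₂ →
    H.tile (onE u₁) (onE u₂) (onE v₁) (onE v₂)

instance : Category Asynch.{u} where
  Hom := Hom
  id G := ⟨id, id, fun _ => rfl, fun _ => rfl, fun h => h⟩
  comp f g := ⟨g.onV ∘ f.onV, g.onE ∘ f.onE, fun e => by simp [g.src, f.src],
    fun e => by simp [g.tgt, f.tgt], fun h => g.tile (f.tile h)⟩

theorem hom_ext {G H : Asynch.{u}} {f g : G ⟶ H} (hV : ∀ x, f.onV x = g.onV x)
    (hE : ∀ e, f.onE e = g.onE e) : f = g :=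
  Hom.ext (funext hV) (funext hE)

variable (G H K L : Asynch.{u})

/-- The edges of the shuffle product: an edge of one graph together with a vertex of the other. -/
abbrev ShuffleE : Type u := (G.E × H.V) ⊕ (G.V × H.E)

/-- The permutation tiles of the shuffle product: those of `G` at a fixed vertex of `H`, those of `H`
at a fixed vertex of `G`, and `(u, y) · (x', v) ⋄ (x, v) · (u, y')` in both directions for every
pair of edges `u : x ⟶ x'` of `G` and `v : y ⟶ y'` of `H`. -/
def shuffleTile : ShuffleE G H → ShuffleE G H → ShuffleE G H → ShuffleE G H → Prop
  | .inl (u₁, y₁), .inl (u₂, y₂), .inl (v₁, y₃), .inl (v₂, y₄) =>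
      G.tile u₁ u₂ v₁ v₂ ∧ y₁ = y₂ ∧ y₁ = y₃ ∧ y₁ = y₄
  | .inr (x₁, u₁), .inr (x₂, u₂), .inr (x₃, v₁), .inr (x₄, v₂) =>
      H.tile u₁ u₂ v₁ v₂ ∧ x₁ = x₂ ∧ x₁ = x₃ ∧ x₁ = x₄
  | .inl (u, y), .inr (x', v), .inr (x, v'), .inl (u', y') =>
      u = u' ∧ v = v' ∧ x = G.src u ∧ x' = G.tgt u ∧ y = H.src v ∧ y' = H.tgt v
  | .inr (x, v), .inl (u, y'), .inl (u', y), .inr (x', v') =>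
      u = u' ∧ v = v' ∧ x = G.src u ∧ x' = G.tgt u ∧ y = H.src v ∧ y' = H.tgt v
  | _, _, _, _ => False

/-- The shuffle product of two asynchronous graphs. -/
def shuffle : Asynch.{u} where
  V := G.V × H.V
  E := ShuffleE G H
  src := Sum.elim (fun e => (G.src e.1, e.2)) (fun e => (e.1, H.src e.2))
  tgt := Sum.elim (fun e => (G.tgt e.1, e.2)) (fun e => (e.1, H.tgt e.2))
  tile := shuffleTile G H
  square := by
    rintro (⟨u₁, y₁⟩ | ⟨x₁, u₁⟩) (⟨u₂, y₂⟩ | ⟨x₂, u₂⟩) (⟨v₁, z₁⟩ | ⟨w₁, v₁⟩) (⟨v₂, z₂⟩ | ⟨w₂, v₂⟩) h <;>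
      simp only [shuffleTile] at h
    · obtain ⟨h, rfl, rfl, rfl⟩ := h
      obtain ⟨h₁, h₂, h₃, h₄⟩ := G.square h
      simp [h₁, h₂, h₃, h₄]
    · obtain ⟨rfl, rfl, rfl, rfl, rfl, rfl⟩ := h; simp
    · obtain ⟨rfl, rfl, rfl, rfl, rfl, rfl⟩ := h; simp
    · obtain ⟨h, rfl, rfl, rfl⟩ := h
      obtain ⟨h₁, h₂, h₃, h₄⟩ := H.square h
      simp [h₁, h₂, h₃, h₄]
  symm := by
    rintro (⟨u₁, y₁⟩ | ⟨x₁, u₁⟩) (⟨u₂, y₂⟩ | ⟨x₂, u₂⟩) (⟨v₁, z₁⟩ | ⟨w₁, v₁⟩) (⟨v₂, z₂⟩ | ⟨w₂, v₂⟩) h <;>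
      simp only [shuffleTile] at h ⊢
    · obtain ⟨h, rfl, rfl, rfl⟩ := h
      exact ⟨G.symm h, rfl, rfl, rfl⟩
    · obtain ⟨rfl, rfl, rfl, rfl, rfl, rfl⟩ := h; simp
    · obtain ⟨rfl, rfl, rfl, rfl, rfl, rfl⟩ := h; simp
    · obtain ⟨h, rfl, rfl, rfl⟩ := h
      exact ⟨H.symm h, rfl, rfl, rfl⟩
  deterministic := by
    rintro (⟨u₁, y₁⟩ | ⟨x₁, u₁⟩) (⟨u₂, y₂⟩ | ⟨x₂, u₂⟩) (⟨v₁, z₁⟩ | ⟨w₁, v₁⟩) (⟨v₂, z₂⟩ | ⟨w₂, v₂⟩)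
      (⟨t₁, p₁⟩ | ⟨q₁, t₁⟩) (⟨t₂, p₂⟩ | ⟨q₂, t₂⟩) h h' <;>
      simp only [shuffleTile] at h h'
    · obtain ⟨h, rfl, rfl, rfl⟩ := h
      obtain ⟨h', _, rfl, rfl⟩ := h'
      obtain ⟨rfl, rfl⟩ := G.deterministic h h'
      exact ⟨rfl, rfl⟩
    · obtain ⟨rfl, rfl, rfl, rfl, rfl, rfl⟩ := h
      obtain ⟨rfl, rfl, rfl, _, _, rfl⟩ := h'
      exact ⟨rfl, rfl⟩
    · obtain ⟨rfl, rfl, rfl, rfl, rfl, rfl⟩ := h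
      obtain ⟨rfl, rfl, _, rfl, rfl, _⟩ := h'
      exact ⟨rfl, rfl⟩
    · obtain ⟨h, rfl, rfl, rfl⟩ := h
      obtain ⟨h', _, rfl, rfl⟩ := h'
      obtain ⟨rfl, rfl⟩ := H.deterministic h h'
      exact ⟨rfl, rfl⟩
  cube := by
    rintro u₁ u₂ u₃ v₁ v₂ v₃
    constructor
    · rintro ⟨w₃, u₂', v₂', h₁, h₂, h₃⟩
      obtain (⟨u₂, y₂⟩ | ⟨x₂, u₂⟩) := u₂ <;> obtain (⟨u₃, y₃⟩ | ⟨x₃, u₃⟩) := u₃ <;>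
        obtain (⟨u₂', y₂'⟩ | ⟨x₂', u₂'⟩) := u₂' <;> obtain (⟨w₃, z₃⟩ | ⟨s₃, w₃⟩) := w₃ <;>
        simp only [shuffleTile] at h₁ <;>
        obtain (⟨u₁, y₁⟩ | ⟨x₁, u₁⟩) := u₁ <;> obtain (⟨v₁, z₁⟩ | ⟨s₁, v₁⟩) := v₁ <;>
        obtain (⟨v₂', z₂'⟩ | ⟨s₂', v₂'⟩) := v₂' <;> simp only [shuffleTile] at h₂ <;>
        obtain (⟨v₂, z₂⟩ | ⟨s₂, v₂⟩) := v₂ <;> obtain (⟨v₃, z₃⟩ | ⟨s₃, v₃⟩) := v₃ <;>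
        simp only [shuffleTile] at h₃
      · obtain ⟨w, a, b, k₁, k₂, k₃⟩ := (G.cube _ _ _ _ _ _).1 ⟨_, _, _, h₁.1, h₂.1, h₃.1⟩
        refine ⟨.inl (w, y₁), .inl (a, y₁), .inl (b, y₁), ?_, ?_, ?_⟩ <;>
          simp only [shuffleTile] <;> grind
      · have q := G.square h₁.1
        refine ⟨.inl (u₂, H.src u₁), .inr (G.tgt u₂, u₁), .inl (u₃, H.src u₁), ?_, ?_, ?_⟩ <;>
          simp only [shuffleTile] <;> grind
      · have q := G.square h₃.1
        refine ⟨.inl (v₂, H.src u₃), .inl (v₃, H.src u₃), .inr (G.src v₃, u₃), ?_, ?_, ?_⟩ <;>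
          simp only [shuffleTile] <;> grind
      · have q := H.square h₂.1
        refine ⟨.inl (u₂, H.src u₁), .inr (G.tgt u₂, u₁), .inr (G.tgt u₂, v₁), ?_, ?_, ?_⟩ <;>
          simp only [shuffleTile] <;> grind
      · have q := G.square h₂.1
        refine ⟨.inr (G.src u₁, u₂), .inl (u₁, H.tgt u₂), .inl (v₁, H.tgt u₂), ?_, ?_, ?_⟩ <;>
          simp only [shuffleTile] <;> grind
      · have q := H.square h₃.1
        refine ⟨.inr (G.src u₃, v₂), .inr (G.src u₃, v₃), .inl (u₃, H.src v₃), ?_, ?_, ?_⟩ <;>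
          simp only [shuffleTile] <;> grind
      · have q := H.square h₁.1
        refine ⟨.inr (G.src u₁, u₂), .inl (u₁, H.tgt u₂), .inr (G.src u₁, u₃), ?_, ?_, ?_⟩ <;>
          simp only [shuffleTile] <;> grind
      · obtain ⟨w, a, b, k₁, k₂, k₃⟩ := (H.cube _ _ _ _ _ _).1 ⟨_, _, _, h₁.1, h₂.1, h₃.1⟩
        refine ⟨.inr (x₁, w), .inr (x₁, a), .inr (x₁, b), ?_, ?_, ?_⟩ <;>
          simp only [shuffleTile] <;> grind
    · rintro ⟨w₁, u₂'', v₂'', h₁, h₂, h₃⟩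
      obtain (⟨u₂, y₂⟩ | ⟨x₂, u₂⟩) := u₂ <;> obtain (⟨u₁, y₁⟩ | ⟨x₁, u₁⟩) := u₁ <;>
        obtain (⟨u₂'', y₂'⟩ | ⟨x₂', u₂''⟩) := u₂'' <;> obtain (⟨w₁, r₁⟩ | ⟨r₁, w₁⟩) := w₁ <;>
        simp only [shuffleTile] at h₁ <;>
        obtain (⟨u₃, y₃⟩ | ⟨x₃, u₃⟩) := u₃ <;> obtain (⟨v₃, z₃⟩ | ⟨s₃, v₃⟩) := v₃ <;>
        obtain (⟨v₂'', z₂'⟩ | ⟨s₂', v₂''⟩) := v₂'' <;> simp only [shuffleTile] at h₂ <;>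
        obtain (⟨v₂, z₂⟩ | ⟨s₂, v₂⟩) := v₂ <;> obtain (⟨v₁, z₁⟩ | ⟨s₁, v₁⟩) := v₁ <;>
        simp only [shuffleTile] at h₃
      · obtain ⟨w, a, b, k₁, k₂, k₃⟩ := (G.cube _ _ _ _ _ _).2 ⟨_, _, _, h₁.1, h₂.1, h₃.1⟩
        refine ⟨.inl (w, y₁), .inl (a, y₁), .inl (b, y₁), ?_, ?_, ?_⟩ <;>
          simp only [shuffleTile] <;> grind
      · have q := G.square h₁.1
        refine ⟨.inl (u₂, H.tgt u₃), .inr (G.src u₂, u₃), .inl (u₁, H.tgt u₃), ?_, ?_, ?_⟩ <;>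
          simp only [shuffleTile] <;> grind
      · have q := G.square h₃.1
        refine ⟨.inl (v₂, H.tgt u₁), .inl (v₁, H.tgt u₁), .inr (G.tgt v₁, u₁), ?_, ?_, ?_⟩ <;>
          simp only [shuffleTile] <;> grind
      · have q := H.square h₂.1
        refine ⟨.inl (u₂, H.tgt u₃), .inr (G.src u₂, u₃), .inr (G.src u₂, v₃), ?_, ?_, ?_⟩ <;>
          simp only [shuffleTile] <;> grind
      · have q := G.square h₂.1
        refine ⟨.inr (G.tgt u₃, u₂), .inl (u₃, H.src u₂), .inl (v₃, H.src u₂), ?_, ?_, ?_⟩ <;>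
          simp only [shuffleTile] <;> grind
      · have q := H.square h₃.1
        refine ⟨.inr (G.tgt u₁, v₂), .inr (G.tgt u₁, v₁), .inl (u₁, H.tgt v₁), ?_, ?_, ?_⟩ <;>
          simp only [shuffleTile] <;> grind
      · have q := H.square h₁.1
        refine ⟨.inr (G.tgt u₃, u₂), .inl (u₃, H.src u₂), .inr (G.tgt u₃, u₁), ?_, ?_, ?_⟩ <;>
          simp only [shuffleTile] <;> grind
      · obtain ⟨w, a, b, k₁, k₂, k₃⟩ := (H.cube _ _ _ _ _ _).2 ⟨_, _, _, h₁.1, h₂.1, h₃.1⟩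
        refine ⟨.inr (x₁, w), .inr (x₁, a), .inr (x₁, b), ?_, ?_, ?_⟩ <;>
          simp only [shuffleTile] <;> grind


/-- The asynchronous graph with one vertex and no edge. -/
def unit : Asynch.{u} where
  V := PUnit
  E := PEmpty
  src := PEmpty.elim
  tgt := PEmpty.elim
  tile _ _ _ _ := False
  square h := h.elim
  symm h := h.elim
  deterministic h _ := h.elim
  cube u₁ := u₁.elim

variable {G H K L}

def shuffleMap (f : G ⟶ H) (g : K ⟶ L) : shuffle G K ⟶ shuffle H L where
  onV := Prod.map f.onV g.onV
  onE := Sum.map (Prod.map f.onE g.onV) (Prod.map f.onV g.onE)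
  src := by rintro (⟨e, y⟩ | ⟨x, e⟩) <;> simp [shuffle, f.src, g.src]
  tgt := by rintro (⟨e, y⟩ | ⟨x, e⟩) <;> simp [shuffle, f.tgt, g.tgt]
  tile := by
    rintro (⟨u₁, y₁⟩ | ⟨x₁, u₁⟩) (⟨u₂, y₂⟩ | ⟨x₂, u₂⟩) (⟨v₁, z₁⟩ | ⟨w₁, v₁⟩) (⟨v₂, z₂⟩ | ⟨w₂, v₂⟩) h <;>
      simp only [shuffle, shuffleTile, Sum.map_inl, Sum.map_inr, Prod.map] at h ⊢
    · obtain ⟨h, rfl, rfl, rfl⟩ := h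
      exact ⟨f.tile h, rfl, rfl, rfl⟩
    · obtain ⟨rfl, rfl, rfl, rfl, rfl, rfl⟩ := h; simp [f.src, f.tgt, g.src, g.tgt]
    · obtain ⟨rfl, rfl, rfl, rfl, rfl, rfl⟩ := h; simp [f.src, f.tgt, g.src, g.tgt]
    · obtain ⟨h, rfl, rfl, rfl⟩ := h
      exact ⟨g.tile h, rfl, rfl, rfl⟩

def assocHom (G H K : Asynch.{u}) : shuffle (shuffle G H) K ⟶ shuffle G (shuffle H K) where
  onV x := (x.1.1, (x.1.2, x.2))
  onE
    | .inl (.inl (u, y), z) => .inl (u, (y, z))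
    | .inl (.inr (x, v), z) => .inr (x, .inl (v, z))
    | .inr ((x, y), w) => .inr (x, .inr (y, w))
  src := by rintro (⟨⟨e, y⟩ | ⟨x, e⟩, z⟩ | ⟨⟨x, y⟩, e⟩) <;> rfl
  tgt := by rintro (⟨⟨e, y⟩ | ⟨x, e⟩, z⟩ | ⟨⟨x, y⟩, e⟩) <;> rfl
  tile := by
    rintro (⟨⟨u₁, y₁⟩ | ⟨x₁, u₁⟩, z₁⟩ | ⟨⟨x₁, y₁⟩, u₁⟩) (⟨⟨u₂, y₂⟩ | ⟨x₂, u₂⟩, z₂⟩ | ⟨⟨x₂, y₂⟩, u₂⟩)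
      (⟨⟨u₃, y₃⟩ | ⟨x₃, u₃⟩, z₃⟩ | ⟨⟨x₃, y₃⟩, u₃⟩) (⟨⟨u₄, y₄⟩ | ⟨x₄, u₄⟩, z₄⟩ | ⟨⟨x₄, y₄⟩, u₄⟩) h <;>
      simp [shuffle, shuffleTile] at h ⊢ <;> grind

def assocInv (G H K : Asynch.{u}) : shuffle G (shuffle H K) ⟶ shuffle (shuffle G H) K where
  onV x := ((x.1, x.2.1), x.2.2)
  onE
    | .inl (u, (y, z)) => .inl (.inl (u, y), z)
    | .inr (x, .inl (v, z)) => .inl (.inr (x, v), z)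
    | .inr (x, .inr (y, w)) => .inr ((x, y), w)
  src := by rintro (⟨e, ⟨y, z⟩⟩ | ⟨x, ⟨e, z⟩ | ⟨y, e⟩⟩) <;> rfl
  tgt := by rintro (⟨e, ⟨y, z⟩⟩ | ⟨x, ⟨e, z⟩ | ⟨y, e⟩⟩) <;> rfl
  tile := by
    rintro (⟨u₁, ⟨y₁, z₁⟩⟩ | ⟨x₁, ⟨u₁, z₁⟩ | ⟨y₁, u₁⟩⟩) (⟨u₂, ⟨y₂, z₂⟩⟩ | ⟨x₂, ⟨u₂, z₂⟩ | ⟨y₂, u₂⟩⟩)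
      (⟨u₃, ⟨y₃, z₃⟩⟩ | ⟨x₃, ⟨u₃, z₃⟩ | ⟨y₃, u₃⟩⟩) (⟨u₄, ⟨y₄, z₄⟩⟩ | ⟨x₄, ⟨u₄, z₄⟩ | ⟨y₄, u₄⟩⟩) h <;>
      simp [shuffle, shuffleTile] at h ⊢ <;> grind

def leftUnitorHom (G : Asynch.{u}) : shuffle unit G ⟶ G where
  onV x := x.2
  onE
    | .inl (u, _) => u.elim
    | .inr (_, v) => v
  src := by rintro (⟨⟨⟩, _⟩ | ⟨_, e⟩); rfl
  tgt := by rintro (⟨⟨⟩, _⟩ | ⟨_, e⟩); rfl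
  tile := by
    rintro (⟨⟨⟩, _⟩ | ⟨_, u₁⟩) (⟨⟨⟩, _⟩ | ⟨_, u₂⟩) (⟨⟨⟩, _⟩ | ⟨_, u₃⟩) (⟨⟨⟩, _⟩ | ⟨_, u₄⟩) h
    exact h.1

def leftUnitorInv (G : Asynch.{u}) : G ⟶ shuffle unit G where
  onV x := (PUnit.unit, x)
  onE v := .inr (PUnit.unit, v)
  src _ := rfl
  tgt _ := rfl
  tile h := ⟨h, rfl, rfl, rfl⟩

def rightUnitorHom (G : Asynch.{u}) : shuffle G unit ⟶ G where
  onV x := x.1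
  onE
    | .inl (u, _) => u
    | .inr (_, v) => v.elim
  src := by rintro (⟨e, _⟩ | ⟨_, ⟨⟩⟩); rfl
  tgt := by rintro (⟨e, _⟩ | ⟨_, ⟨⟩⟩); rfl
  tile := by
    rintro (⟨u₁, _⟩ | ⟨_, ⟨⟩⟩) (⟨u₂, _⟩ | ⟨_, ⟨⟩⟩) (⟨u₃, _⟩ | ⟨_, ⟨⟩⟩) (⟨u₄, _⟩ | ⟨_, ⟨⟩⟩) h
    exact h.1

def rightUnitorInv (G : Asynch.{u}) : G ⟶ shuffle G unit where
  onV x := (x, PUnit.unit)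
  onE u := .inl (u, PUnit.unit)
  src _ := rfl
  tgt _ := rfl
  tile h := ⟨h, rfl, rfl, rfl⟩

def swap (G H : Asynch.{u}) : shuffle G H ⟶ shuffle H G where
  onV := Prod.swap
  onE
    | .inl (u, y) => .inr (y, u)
    | .inr (x, v) => .inl (v, x)
  src := by rintro (⟨e, y⟩ | ⟨x, e⟩) <;> rfl
  tgt := by rintro (⟨e, y⟩ | ⟨x, e⟩) <;> rfl
  tile := by
    rintro (⟨u₁, y₁⟩ | ⟨x₁, u₁⟩) (⟨u₂, y₂⟩ | ⟨x₂, u₂⟩) (⟨v₁, z₁⟩ | ⟨w₁, v₁⟩) (⟨v₂, z₂⟩ | ⟨w₂, v₂⟩) h <;>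
      simp only [shuffle, shuffleTile] at h ⊢ <;> grind

/-- The shuffle product, with the evident structural isomorphisms. -/
instance : MonoidalCategoryStruct Asynch.{u} where
  tensorObj := shuffle
  tensorHom f g := shuffleMap f g
  whiskerLeft G _ _ g := shuffleMap (𝟙 G) g
  whiskerRight f H := shuffleMap f (𝟙 H)
  tensorUnit := unit
  associator G H K := ⟨assocHom G H K, assocInv G H K,
    hom_ext (fun _ => rfl) (by rintro (⟨⟨e, y⟩ | ⟨x, e⟩, z⟩ | ⟨⟨x, y⟩, e⟩) <;> rfl),
    hom_ext (fun _ => rfl) (by rintro (⟨e, ⟨y, z⟩⟩ | ⟨x, ⟨e, z⟩ | ⟨y, e⟩⟩) <;> rfl)⟩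
  leftUnitor G := ⟨leftUnitorHom G, leftUnitorInv G,
    hom_ext (fun _ => rfl) (by rintro (⟨⟨⟩, _⟩ | ⟨_, e⟩); rfl),
    hom_ext (fun _ => rfl) (fun _ => rfl)⟩
  rightUnitor G := ⟨rightUnitorHom G, rightUnitorInv G,
    hom_ext (fun _ => rfl) (by rintro (⟨e, _⟩ | ⟨_, ⟨⟩⟩); rfl),
    hom_ext (fun _ => rfl) (fun _ => rfl)⟩

instance : MonoidalCategory Asynch.{u} :=
  MonoidalCategory.ofTensorHom
    (id_tensorHom_id := fun _ _ =>
      hom_ext (fun _ => rfl) (by rintro (⟨e, y⟩ | ⟨x, e⟩) <;> rfl))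
    (id_tensorHom := fun _ _ _ _ => rfl)
    (tensorHom_id := fun _ _ => rfl)
    (tensorHom_comp_tensorHom := fun _ _ _ _ =>
      hom_ext (fun _ => rfl) (by rintro (⟨e, y⟩ | ⟨x, e⟩) <;> rfl))
    (associator_naturality := fun _ _ _ =>
      hom_ext (fun _ => rfl) (by rintro (⟨⟨e, y⟩ | ⟨x, e⟩, z⟩ | ⟨⟨x, y⟩, e⟩) <;> rfl))
    (leftUnitor_naturality := fun _ =>
      hom_ext (fun _ => rfl) (by rintro (⟨⟨⟩, _⟩ | ⟨_, e⟩); rfl))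
    (rightUnitor_naturality := fun _ =>
      hom_ext (fun _ => rfl) (by rintro (⟨e, _⟩ | ⟨_, ⟨⟩⟩); rfl))
    (pentagon := fun _ _ _ _ => hom_ext (fun _ => rfl)
      (by rintro (⟨⟨⟨e, y⟩ | ⟨x, e⟩, z⟩ | ⟨⟨x, y⟩, e⟩, w⟩ | ⟨⟨⟨x, y⟩, z⟩, e⟩) <;> rfl))
    (triangle := fun _ _ => hom_ext (fun _ => rfl)
      (by rintro (⟨⟨e, y⟩ | ⟨x, ⟨⟩⟩, z⟩ | ⟨⟨x, y⟩, e⟩) <;> rfl))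

instance : SymmetricCategory Asynch.{u} where
  braiding G H := ⟨swap G H, swap H G,
    hom_ext (fun _ => rfl) (by rintro (⟨e, y⟩ | ⟨x, e⟩) <;> rfl),
    hom_ext (fun _ => rfl) (by rintro (⟨e, y⟩ | ⟨x, e⟩) <;> rfl)⟩
  braiding_naturality_right _ _ _ _ :=
    hom_ext (fun _ => rfl) (by rintro (⟨e, y⟩ | ⟨x, e⟩) <;> rfl)
  braiding_naturality_left _ _ :=
    hom_ext (fun _ => rfl) (by rintro (⟨e, y⟩ | ⟨x, e⟩) <;> rfl)
  hexagon_forward _ _ _ :=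
    hom_ext (fun _ => rfl) (by rintro (⟨⟨e, y⟩ | ⟨x, e⟩, z⟩ | ⟨⟨x, y⟩, e⟩) <;> rfl)
  hexagon_reverse _ _ _ :=
    hom_ext (fun _ => rfl) (by rintro (⟨e, ⟨y, z⟩⟩ | ⟨x, ⟨e, z⟩ | ⟨y, e⟩⟩) <;> rfl)
  symmetry _ _ :=
    hom_ext (fun _ => rfl) (by rintro (⟨e, y⟩ | ⟨x, e⟩) <;> rfl)

end Asynch

/-! ### The 2-category of paths and reschedulings -/

namespace Asynch

/-- The permutation acting as `σ` on `{n, n + 1, …}`, and as the identity below `n`. -/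
def shift (n : ℕ) (σ : Equiv.Perm ℕ) : Equiv.Perm ℕ where
  toFun i := if i < n then i else n + σ (i - n)
  invFun i := if i < n then i else n + σ.symm (i - n)
  left_inv i := by
    by_cases h : i < n
    · simp [h]
    · simp [h]; omega
  right_inv i := by
    by_cases h : i < n
    · simp [h]
    · simp [h]; omega

theorem shift_apply (n : ℕ) (σ : Equiv.Perm ℕ) (i : ℕ) :
    shift n σ i = if i < n then i else n + σ (i - n) := rfl

theorem shift_one (n : ℕ) : shift n 1 = 1 := by
  ext i; simp only [shift_apply, Equiv.Perm.one_apply]; split <;> omega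

theorem shift_zero (σ : Equiv.Perm ℕ) : shift 0 σ = σ := by
  ext i; simp [shift_apply]

theorem shift_mul (n : ℕ) (σ τ : Equiv.Perm ℕ) : shift n (σ * τ) = shift n σ * shift n τ := by
  ext i
  simp only [shift_apply, Equiv.Perm.mul_apply]
  by_cases h : i < n <;> simp [h]

theorem shift_add (m n : ℕ) (σ : Equiv.Perm ℕ) : shift (m + n) σ = shift m (shift n σ) := by
  ext i
  simp only [shift_apply]
  by_cases h : i < m
  · simp [h, show i < m + n by omega]
  · by_cases h' : i < m + n
    · simp [h, h', show i - m < n by omega]; omega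
    · simp [h, h', show ¬ i - m < n by omega, Nat.sub_sub, Nat.add_assoc]

theorem shift_swap (n a b : ℕ) :
    shift n (Equiv.swap a b) = Equiv.swap (n + a) (n + b) := by
  ext i
  simp only [shift_apply, Equiv.swap_apply_def]
  split_ifs <;> omega

section
variable (G : Asynch.{u})

/-- A list of edges that is a path from one vertex to another. -/
def IsPath : G.V → List G.E → G.V → Prop
  | x, [], y => x = y
  | x, e :: l, y => G.src e = x ∧ IsPath (G.tgt e) l y

/-- The paths of the graph. -/
@[ext]
structure Path (x y : G.V) : Type u where
  edges : List G.E
  isPath : G.IsPath x edges y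

/-- Permutation steps `h₁ · p · h₂ ⟹ h₁ · q · h₂` with `p ⋄ q`, recorded with the length of `h₁`.
A step from a path leads to a path with the same source and target. -/
inductive Step : List G.E → List G.E → ℕ → Prop
  | mk (h₁ h₂ : List G.E) {u₁ u₂ v₁ v₂ : G.E} (h : G.tile u₁ u₂ v₁ v₂) :
      Step (h₁ ++ u₁ :: u₂ :: h₂) (h₁ ++ v₁ :: v₂ :: h₂) h₁.length

/-- `Tracks f g σ`: some sequence of permutation steps from `f` to `g` induces the bijection `σ` on
positions. Positions are counted from `0`, a step at position `ℓ` exchanges `ℓ` and `ℓ + 1`, and a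
bijection of `{0, …, k - 1}` is represented by the permutation of `ℕ` that extends it by the identity. -/
inductive Tracks : List G.E → List G.E → Equiv.Perm ℕ → Prop
  | nil (f : List G.E) : Tracks f f 1
  | cons {f f' g : List G.E} {ℓ : ℕ} {σ : Equiv.Perm ℕ} :
      G.Step f f' ℓ → Tracks f' g σ → Tracks f g (σ * Equiv.swap ℓ (ℓ + 1))

/-- A rescheduling `f ⟹ g`: a bijection on positions tracking a sequence of permutation steps, that is,
an equivalence class of such sequences modulo equality of the induced bijections. -/
@[ext]
structure Rescheduling {x y : G.V} (f g : G.Path x y) : Type u where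
  perm : Equiv.Perm ℕ
  tracks : G.Tracks f.edges g.edges perm

end

section
variable {G H K : Asynch.{u}}

theorem IsPath.append {x y z : G.V} {f g : List G.E} (hf : G.IsPath x f y)
    (hg : G.IsPath y g z) : G.IsPath x (f ++ g) z := by
  induction f generalizing x with
  | nil => obtain rfl : x = y := hf; exact hg
  | cons e f ih => exact ⟨hf.1, ih hf.2⟩

theorem IsPath.map (F : G ⟶ H) {x y : G.V} {f : List G.E} (hf : G.IsPath x f y) :
    H.IsPath (F.onV x) (f.map F.onE) (F.onV y) := by
  induction f generalizing x with
  | nil => obtain rfl : x = y := hf; rfl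
  | cons e f ih => exact ⟨(F.src e).trans (congrArg F.onV hf.1), F.tgt e ▸ ih hf.2⟩

theorem Step.append_left (h : List G.E) {f g : List G.E} {ℓ : ℕ} (s : G.Step f g ℓ) :
    G.Step (h ++ f) (h ++ g) (h.length + ℓ) := by
  obtain ⟨h₁, h₂, t⟩ := s
  simpa using Step.mk (h ++ h₁) h₂ t

theorem Step.append_right {f g : List G.E} {ℓ : ℕ} (s : G.Step f g ℓ) (h : List G.E) :
    G.Step (f ++ h) (g ++ h) ℓ := by
  obtain ⟨h₁, h₂, t⟩ := s
  simpa using Step.mk h₁ (h₂ ++ h) t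

theorem Step.map (F : G ⟶ H) {f g : List G.E} {ℓ : ℕ} (s : G.Step f g ℓ) :
    H.Step (f.map F.onE) (g.map F.onE) ℓ := by
  obtain ⟨h₁, h₂, t⟩ := s
  simpa using Step.mk (h₁.map F.onE) (h₂.map F.onE) (F.tile t)

theorem Tracks.trans {f g h : List G.E} {σ τ : Equiv.Perm ℕ} (s : G.Tracks f g σ)
    (t : G.Tracks g h τ) : G.Tracks f h (τ * σ) := by
  induction s with
  | nil f => simpa using t
  | cons s _ ih => rw [← mul_assoc]; exact Tracks.cons s (ih t)

theorem Tracks.append_left (h : List G.E) {f g : List G.E} {σ : Equiv.Perm ℕ}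
    (s : G.Tracks f g σ) : G.Tracks (h ++ f) (h ++ g) (shift h.length σ) := by
  induction s with
  | nil f => rw [shift_one]; exact Tracks.nil _
  | cons s _ ih =>
    rw [shift_mul, shift_swap]
    exact Tracks.cons (s.append_left h) ih

theorem Tracks.append_right {f g : List G.E} {σ : Equiv.Perm ℕ} (s : G.Tracks f g σ)
    (h : List G.E) : G.Tracks (f ++ h) (g ++ h) σ := by
  induction s with
  | nil f => exact Tracks.nil _
  | cons s _ ih => exact Tracks.cons (s.append_right h) ih

theorem Tracks.map (F : G ⟶ H) {f g : List G.E} {σ : Equiv.Perm ℕ} (s : G.Tracks f g σ) :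
    H.Tracks (f.map F.onE) (g.map F.onE) σ := by
  induction s with
  | nil f => exact Tracks.nil _
  | cons s _ ih => exact Tracks.cons (s.map F) ih

theorem Tracks.length_eq {f g : List G.E} {σ : Equiv.Perm ℕ} (s : G.Tracks f g σ) :
    f.length = g.length := by
  induction s with
  | nil f => rfl
  | cons s _ ih => obtain ⟨h₁, h₂, t⟩ := s; simpa using ih

theorem Tracks.fix {f g : List G.E} {σ : Equiv.Perm ℕ} (s : G.Tracks f g σ) {i : ℕ}
    (hi : f.length ≤ i) : σ i = i := by
  induction s with
  | nil f => rfl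
  | cons s _ ih =>
    obtain ⟨h₁, h₂, t⟩ := s
    simp only [List.length_append, List.length_cons] at hi ih
    rw [Equiv.Perm.mul_apply, Equiv.swap_apply_of_ne_of_ne (by omega) (by omega)]
    exact ih (by omega)

theorem Tracks.commute {f g : List G.E} {σ : Equiv.Perm ℕ} (s : G.Tracks f g σ)
    (τ : Equiv.Perm ℕ) : σ * shift f.length τ = shift f.length τ * σ := by
  have key : ∀ i, f.length ≤ σ i ↔ f.length ≤ i := fun i => by
    refine ⟨fun h => ?_, fun h => by rwa [s.fix h]⟩
    have := σ.injective (s.fix h)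
    rwa [this] at h
  ext i
  simp only [Equiv.Perm.mul_apply, shift_apply]
  by_cases h : f.length ≤ i
  · rw [s.fix h, if_neg (by omega), s.fix (by omega)]
  · have := (key i).not.2 h
    rw [if_pos (by omega), if_pos (by omega)]

end

/-- The objects of the 2-category of an asynchronous graph. -/
structure Vertices (G : Asynch.{u}) : Type u where
  vertex : G.V

section
variable {G H K : Asynch.{u}}

/-- The free category on the graph. -/
instance pathCategory : Category.{u} (Vertices G) where
  Hom x y := G.Path x.vertex y.vertex
  id _ := ⟨[], rfl⟩
  comp f g := ⟨f.edges ++ g.edges, f.isPath.append g.isPath⟩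
  id_comp _ := rfl
  comp_id f := Path.ext (List.append_nil f.edges)
  assoc f g h := Path.ext (List.append_assoc f.edges g.edges h.edges)

/-- Vertical composition of reschedulings: composition of bijections. -/
instance reschedulingCategory (x y : Vertices G) : Category.{u} (x ⟶ y) where
  Hom f g := G.Rescheduling f g
  id _ := ⟨1, Tracks.nil _⟩
  comp η θ := ⟨θ.perm * η.perm, η.tracks.trans θ.tracks⟩
  id_comp _ := Rescheduling.ext (mul_one _)
  comp_id _ := Rescheduling.ext (one_mul _)
  assoc _ _ _ := Rescheduling.ext (mul_assoc _ _ _).symm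

theorem cell_ext {x y : Vertices G} {f g : x ⟶ y} {η θ : f ⟶ g}
    (h : Rescheduling.perm η = Rescheduling.perm θ) : η = θ := Rescheduling.ext h

theorem perm_id {x y : Vertices G} (f : x ⟶ y) : Rescheduling.perm (𝟙 f) = 1 := rfl

theorem perm_comp {x y : Vertices G} {f g h : x ⟶ y} (η : f ⟶ g) (θ : g ⟶ h) :
    Rescheduling.perm (η ≫ θ) = Rescheduling.perm θ * Rescheduling.perm η := rfl

theorem perm_eqToHom {x y : Vertices G} {f g : x ⟶ y} (h : f = g) :
    Rescheduling.perm (eqToHom h) = 1 := by subst h; rfl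

/-- The 2-category of vertices, paths and reschedulings. -/
instance : Bicategory.{u, u} (Vertices G) where
  homCategory x y := reschedulingCategory x y
  whiskerLeft f _ _ η := ⟨shift f.edges.length η.perm, η.tracks.append_left f.edges⟩
  whiskerRight η h := ⟨η.perm, η.tracks.append_right h.edges⟩
  associator f g h := eqToIso (Category.assoc f g h)
  leftUnitor f := eqToIso (Category.id_comp f)
  rightUnitor f := eqToIso (Category.comp_id f)
  whiskerLeft_id _ _ := cell_ext (shift_one _)
  whiskerLeft_comp _ _ _ _ _ _ := cell_ext (shift_mul _ _ _)
  id_whiskerLeft η := cell_ext (by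
    simp only [perm_comp, eqToIso.hom, eqToIso.inv, perm_eqToHom, one_mul, mul_one]
    exact shift_zero _)
  comp_whiskerLeft f g _ _ η := cell_ext (by
    simp only [perm_comp, eqToIso.hom, eqToIso.inv, perm_eqToHom, one_mul, mul_one]
    exact (congrArg (shift · (Rescheduling.perm η)) List.length_append).trans (shift_add _ _ _))
  id_whiskerRight _ _ := rfl
  comp_whiskerRight _ _ _ := rfl
  whiskerRight_id _ := cell_ext (by
    simp only [perm_comp, eqToIso.hom, eqToIso.inv, perm_eqToHom, one_mul, mul_one])
  whiskerRight_comp _ _ _ := cell_ext (by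
    simp only [perm_comp, eqToIso.hom, eqToIso.inv, perm_eqToHom, one_mul, mul_one])
  whisker_assoc _ _ _ _ _ := cell_ext (by
    simp only [perm_comp, eqToIso.hom, eqToIso.inv, perm_eqToHom, one_mul, mul_one])
  whisker_exchange {_ _ _ f g _ _} η θ := cell_ext (by
    refine (Tracks.commute η.tracks θ.perm).trans ?_
    rw [show f.edges.length = g.edges.length from η.tracks.length_eq]
    rfl)
  pentagon f g h i := cell_ext (by
    simp only [perm_comp, eqToIso.hom, perm_eqToHom, mul_one, shift_one])
  triangle f g := cell_ext (by
    simp only [perm_comp, eqToIso.hom, perm_eqToHom, mul_one, shift_one])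

instance : Bicategory.Strict (Vertices G) where
  id_comp f := pathCategory.id_comp f
  comp_id f := pathCategory.comp_id f
  assoc f g h := pathCategory.assoc f g h
  leftUnitor_eqToIso _ := rfl
  rightUnitor_eqToIso _ := rfl
  associator_eqToIso _ _ _ := rfl

/-- The action of a homomorphism on paths. -/
def pathMap (F : G ⟶ H) : Vertices G ⥤ Vertices H where
  obj x := ⟨F.onV x.vertex⟩
  map f := ⟨f.edges.map F.onE, f.isPath.map F⟩
  map_id _ := rfl
  map_comp f g := Path.ext (List.map_append (l₁ := f.edges) (l₂ := g.edges))

theorem rescheduling_heq {x y : Vertices G} {f f' g g' : x ⟶ y} (hf : f = f') (hg : g = g')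
    {η : f ⟶ g} {θ : f' ⟶ g'} (h : Rescheduling.perm η = Rescheduling.perm θ) : η ≍ θ := by
  subst hf hg; exact heq_of_eq (cell_ext h)

theorem pathMap_id : pathMap (𝟙 G) = 𝟭 (Vertices G) :=
  CategoryTheory.Functor.hext (fun _ => rfl) fun _ _ f =>
    heq_of_eq (Path.ext (List.map_id f.edges))

theorem pathMap_comp (F : G ⟶ H) (F' : H ⟶ K) : pathMap (F ≫ F') = pathMap F ⋙ pathMap F' :=
  CategoryTheory.Functor.hext (fun _ => rfl) fun _ _ f =>
    heq_of_eq (Path.ext (List.map_map (f := F.onE) (g := F'.onE) (l := f.edges)).symm)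

/-- The action of a homomorphism on reschedulings leaves the underlying bijection unchanged. -/
def cellsMap (F : G ⟶ H) : TwoCat.Cells (pathMap F) where
  map₂ η := ⟨η.perm, η.tracks.map F⟩
  map₂_id _ := rfl
  map₂_comp _ _ := rfl
  map₂_left f g h η := cell_ext (by
    rw [Gray.wl, perm_comp, perm_comp, perm_eqToHom, perm_eqToHom, one_mul, mul_one]
    exact congrArg (shift · (Rescheduling.perm η)) (List.length_map ..).symm)
  map₂_right η h := cell_ext (by
    rw [Gray.wr, perm_comp, perm_comp, perm_eqToHom, perm_eqToHom, one_mul, mul_one]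
    rfl)

end

end Asynch

/-- The functor `[-]` sending an asynchronous graph to its 2-category of vertices, paths and
reschedulings. -/
def asynchTwoCat : Asynch.{u} ⥤ TwoCat.{u} where
  obj G := ⟨Asynch.Vertices G⟩
  map F := (Asynch.cellsMap F).toHom
  map_id G := TwoCat.functor_ext (Asynch.pathMap_id (G := G)) fun {_ _ f g} _ =>
    Asynch.rescheduling_heq (Asynch.Path.ext (List.map_id f.edges))
      (Asynch.Path.ext (List.map_id g.edges)) rfl
  map_comp F F' := TwoCat.functor_ext (Asynch.pathMap_comp F F') fun {_ _ f g} _ =>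
    Asynch.rescheduling_heq (Asynch.Path.ext (List.map_map (f := F.onE) (g := F'.onE) (l := f.edges)).symm)
      (Asynch.Path.ext (List.map_map (f := F.onE) (g := F'.onE) (l := g.edges)).symm) rfl

/-! A path of the shuffle product is a word that interleaves edges of `G` with edges of `H`. Path
categories are free and the funny tensor product imposes no relation between its two factors, so the
path category of the shuffle is the funny tensor product of the two path categories.

For the 2-cells, consider the positions of a path that carry edges of `G` and those that carry edges
of `H`. A tile inside one factor permutes positions of that factor only, and a mixed tile exchanges
a `G`-edge with an `H`-edge without disturbing the order within either factor. Every rescheduling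
`σ` therefore restricts to reschedulings `τ₁` and `τ₂` of the two projected paths. The restrictions
determine `σ`, because the two kinds of positions cover the path (`Splits.unique`). Conversely every
pair `(τ₁, τ₂)` occurs (`exists_splits`): mixed tiles sort any path into a block of `G`-edges
followed by a block of `H`-edges (`exists_splits_sort`), where `τ₁` and `τ₂` act on separate blocks.
The comparison `[G ⧢ H] ⟶ [G] ⊠ [H]` is thus an isomorphism of underlying categories and bijective
on 2-cells, hence an isomorphism (`TwoCat.isIso_of_bijective`).

The projections `[G ⧢ H] ⟶ [G]` do not come from graph homomorphisms, since they erase edges. They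
come from partial homomorphisms, which still act on paths and reschedulings, functorially
(`collapse_comp`). A 2-functor into a Gray product is determined by its underlying functor and its
two projections, so naturality and coherence reduce to identities on generating edges and between
partial homomorphisms.

The equalizer of asynchronous graphs consists of the vertices and edges on which the two
homomorphisms agree. By determinism a tile whose source path is equalized has an equalized target
path (`equalizer_tile`), so the reschedulings between paths of the equalizer are the same there as
in `G`; a 2-functor equalized by `[F]` and `[F']` only meets equalized edges, because homomorphisms
act edgewise. Products fail because homomorphisms cannot erase edges: the tile-free loop is its own
square in asynchronous graphs, while its 2-category has both an identity and a constant endofunctor.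
-/

namespace Asynch

/-! ### Positions of the elements kept by a partial map -/

section
variable {α β γ : Type*}

/-- The increasing enumeration of the positions in `l` of the elements on which `p` is defined,
followed by all positions after the end of `l`. -/
def positions (p : α → Option β) : List α → ℕ → ℕ
  | [], k => k
  | a :: l, k => if (p a).isSome then k.casesOn 0 (fun k => positions p l k + 1)
      else positions p l k + 1

variable (p : α → Option β) (q : β → Option γ)

theorem positions_cons_none {a : α} (h : p a = none) (l : List α) (k : ℕ) :
    positions p (a :: l) k = positions p l k + 1 := by
  simp [positions, h]

theorem positions_cons_some_zero {a : α} {b : β} (h : p a = some b) (l : List α) :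
    positions p (a :: l) 0 = 0 := by
  simp [positions, h]

theorem positions_cons_some_succ {a : α} {b : β} (h : p a = some b) (l : List α) (k : ℕ) :
    positions p (a :: l) (k + 1) = positions p l k + 1 := by
  simp [positions, h]

/-- Injectivity makes the restriction of a bijection to the kept positions unique, see
`Projects.unique`. -/
theorem positions_injective (l : List α) : Function.Injective (positions p l) := by
  induction l with
  | nil => exact fun _ _ h => h
  | cons a l ih =>
    intro i j h
    rcases hp : p a with _ | b
    · rw [positions_cons_none p hp, positions_cons_none p hp] at h
      exact ih (Nat.succ_injective h)
    · rcases i with _ | i <;> rcases j with _ | j <;>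
        simp only [positions_cons_some_zero p hp, positions_cons_some_succ p hp] at h
      · rfl
      · exact absurd h (Nat.succ_ne_zero _).symm
      · exact absurd h (Nat.succ_ne_zero _)
      · exact congrArg _ (ih (Nat.succ_injective h))

/-- The kept positions of `l` are exhausted after `(l.filterMap p).length` terms; from there on the
enumeration of `l'` takes over, offset by the full length of `l`. This is what whiskering needs. -/
theorem positions_append (l l' : List α) (k : ℕ) : positions p (l ++ l') k =
    if k < (l.filterMap p).length then positions p l k
    else l.length + positions p l' (k - (l.filterMap p).length) := by
  induction l generalizing k with
  | nil => simp
  | cons a l ih =>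
    rw [List.cons_append]
    rcases hp : p a with _ | b
    · rw [positions_cons_none p hp, positions_cons_none p hp, ih, List.filterMap_cons_none hp,
        List.length_cons]
      split <;> omega
    · rw [List.filterMap_cons_some hp, List.length_cons, List.length_cons]
      cases k with
      | zero => simp [positions_cons_some_zero p hp]
      | succ k =>
        rw [positions_cons_some_succ p hp, positions_cons_some_succ p hp, ih,
          Nat.add_sub_add_right]
        simp only [Nat.add_lt_add_iff_right]
        split <;> omega

theorem positions_of_le {l : List α} {k : ℕ} (h : (l.filterMap p).length ≤ k) :
    positions p l k = l.length + (k - (l.filterMap p).length) := by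
  have := positions_append p l [] k
  rwa [List.append_nil, if_neg (by omega)] at this

/-- The positional counterpart of `List.filterMap_filterMap`: first select among the elements kept
by `p`, then locate them in `l`. -/
theorem positions_bind (l : List α) (k : ℕ) :
    positions (fun a => (p a).bind q) l k =
      positions p l (positions q (l.filterMap p) k) := by
  induction l generalizing k with
  | nil => rfl
  | cons a l ih =>
    rcases hp : p a with _ | b
    · rw [positions_cons_none _ (by simp [hp]), positions_cons_none p hp,
        List.filterMap_cons_none hp, ih]
    · rw [List.filterMap_cons_some hp]
      rcases hq : q b with _ | c
      · rw [positions_cons_none _ (by simp [hp, hq]), positions_cons_none q hq,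
          positions_cons_some_succ p hp, ih]
      · have hpq : (fun a => (p a).bind q) a = some c := by simp [hp, hq]
        cases k with
        | zero => rw [positions_cons_some_zero (fun a => (p a).bind q) hpq, positions_cons_some_zero q hq,
            positions_cons_some_zero p hp]
        | succ k => rw [positions_cons_some_succ (fun a => (p a).bind q) hpq, positions_cons_some_succ q hq,
            positions_cons_some_succ p hp, ih]

theorem positions_total (f : α → β) (l : List α) (k : ℕ) :
    positions (fun a => some (f a)) l k = k := by
  induction l generalizing k with
  | nil => rfl
  | cons a l ih =>
    cases k with
    | zero => exact positions_cons_some_zero (fun a => some (f a)) (a := a) rfl l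
    | succ k => rw [positions_cons_some_succ (fun a => some (f a)) (a := a) rfl l, ih]

end

/-! ### Partial homomorphisms -/

/-- A homomorphism that may send an edge to a vertex. -/
@[ext]
structure PartialHom (G H : Asynch.{u}) : Type u where
  onV : G.V → H.V
  onE : G.E → Option H.E
  ends_some : ∀ {e e'}, onE e = some e' → H.src e' = onV (G.src e) ∧ H.tgt e' = onV (G.tgt e)
  ends_none : ∀ {e}, onE e = none → onV (G.src e) = onV (G.tgt e)
  -- A tile continues the strand of `u₁` by `v₂` and that of `u₂` by `v₁`. Either a tile remains
  -- after projection, or one whole strand is erased and the other keeps its image, which may itself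
  -- be erased.
  tile : ∀ {u₁ u₂ v₁ v₂ : G.E}, G.tile u₁ u₂ v₁ v₂ →
    (∃ u₁' u₂' v₁' v₂', onE u₁ = some u₁' ∧ onE u₂ = some u₂' ∧ onE v₁ = some v₁' ∧
      onE v₂ = some v₂' ∧ H.tile u₁' u₂' v₁' v₂') ∨
    (onE u₁ = none ∧ onE v₂ = none ∧ onE u₂ = onE v₁) ∨
    (onE u₂ = none ∧ onE v₁ = none ∧ onE u₁ = onE v₂)

section
variable {G H K : Asynch.{u}}

def PartialHom.comp (p : PartialHom G H) (q : PartialHom H K) : PartialHom G K where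
  onV x := q.onV (p.onV x)
  onE e := (p.onE e).bind q.onE
  ends_some {e e''} h := by
    obtain ⟨e', h, h'⟩ := Option.bind_eq_some_iff.1 h
    rw [← (p.ends_some h).1, ← (p.ends_some h).2]
    exact q.ends_some h'
  ends_none {e} h := by
    rcases h' : p.onE e with _ | e'
    · rw [p.ends_none h']
    · rw [← (p.ends_some h').1, ← (p.ends_some h').2]
      exact q.ends_none (by simpa [h'] using h)
  tile h := by
    obtain ⟨u₁', u₂', v₁', v₂', h₁, h₂, h₃, h₄, t⟩ | ⟨h₁, h₂, h₃⟩ | ⟨h₁, h₂, h₃⟩ := p.tile h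
    · simpa only [h₁, h₂, h₃, h₄, Option.bind_some] using q.tile t
    · exact Or.inr (Or.inl (by simp [h₁, h₂, h₃]))
    · exact Or.inr (Or.inr (by simp [h₁, h₂, h₃]))

def Hom.toPartial (F : G ⟶ H) : PartialHom G H where
  onV := F.onV
  onE e := some (F.onE e)
  ends_some := by rintro e _ ⟨⟩; exact ⟨F.src e, F.tgt e⟩
  ends_none h := nomatch h
  tile h := Or.inl ⟨_, _, _, _, rfl, rfl, rfl, rfl, F.tile h⟩

theorem IsPath.filterMap (p : PartialHom G H) {x y : G.V} {f : List G.E} (hf : G.IsPath x f y) :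
    H.IsPath (p.onV x) (f.filterMap p.onE) (p.onV y) := by
  induction f generalizing x with
  | nil => obtain rfl : x = y := hf; rfl
  | cons e f ih =>
    obtain ⟨rfl, hf⟩ := hf
    rcases h : p.onE e with _ | e'
    · rw [List.filterMap_cons_none h, p.ends_none h]
      exact ih hf
    · rw [List.filterMap_cons_some h]
      exact ⟨(p.ends_some h).1, (p.ends_some h).2 ▸ ih hf⟩

/-- The rescheduling `σ` of `f` as `g` restricts to the rescheduling `τ` between the images of `f`
and `g` under a partial homomorphism. -/
structure Projects (p : PartialHom G H) (f g : List G.E) (σ τ : Equiv.Perm ℕ) : Prop where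
  tracks : G.Tracks f g σ
  tracks_map : H.Tracks (f.filterMap p.onE) (g.filterMap p.onE) τ
  apply_positions : ∀ k, σ (positions p.onE f k) = positions p.onE g (τ k)

namespace Projects
variable {p : PartialHom G H} {f g h : List G.E} {σ σ' τ τ' : Equiv.Perm ℕ}

theorem nil (p : PartialHom G H) (f : List G.E) : Projects p f f 1 1 :=
  ⟨.nil _, .nil _, fun _ => rfl⟩

theorem trans (s : Projects p f g σ τ) (t : Projects p g h σ' τ') :
    Projects p f h (σ' * σ) (τ' * τ) :=
  ⟨s.tracks.trans t.tracks, s.tracks_map.trans t.tracks_map, fun k => by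
    rw [Equiv.Perm.mul_apply, Equiv.Perm.mul_apply, s.apply_positions, t.apply_positions]⟩

/-- Since `τ` depends only on `σ`, and not on the sequence of steps projected, it may be chosen
arbitrarily in `collapseCells` and the functor laws still hold. -/
theorem unique (s : Projects p f g σ τ) (t : Projects p f g σ τ') : τ = τ' :=
  Equiv.ext fun k => positions_injective p.onE g
    ((s.apply_positions k).symm.trans (t.apply_positions k))

theorem append_left (h : List G.E) (s : Projects p f g σ τ) :
    Projects p (h ++ f) (h ++ g) (shift h.length σ) (shift (h.filterMap p.onE).length τ) where
  tracks := s.tracks.append_left h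
  tracks_map := by simpa only [List.filterMap_append] using s.tracks_map.append_left _
  apply_positions k := by
    rw [positions_append, positions_append, shift_apply, shift_apply]
    by_cases hk : k < (h.filterMap p.onE).length
    · rw [if_pos hk, if_pos hk, if_pos hk, if_pos]
      -- The kept position of index `k` must lie inside `h`. If it were `h.length + j`, it would
      -- also be the position of index `(h.filterMap p.onE).length + j`, contradicting injectivity.
      by_contra hlt
      obtain ⟨j, hj⟩ := Nat.exists_eq_add_of_le (Nat.not_lt.1 hlt)
      have := positions_of_le p.onE (l := h) (k := (h.filterMap p.onE).length + j) (by omega)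
      have := positions_injective p.onE h (a₁ := k) (a₂ := (h.filterMap p.onE).length + j)
        (by omega)
      omega
    · rw [if_neg hk, if_neg hk, if_neg (by omega), if_neg (by omega), Nat.add_sub_cancel_left,
        Nat.add_sub_cancel_left, s.apply_positions]

theorem append_right (s : Projects p f g σ τ) (h : List G.E) :
    Projects p (f ++ h) (g ++ h) σ τ where
  tracks := s.tracks.append_right h
  tracks_map := by simpa only [List.filterMap_append] using s.tracks_map.append_right _
  apply_positions k := by
    have hl := s.tracks.length_eq
    have hl' := s.tracks_map.length_eq
    rw [positions_append, positions_append, ← hl, ← hl']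
    by_cases hk : k < (f.filterMap p.onE).length
    · rw [if_pos hk, s.apply_positions, if_pos]
      -- If `τ k` lay beyond the end of the projected path, `τ` would fix it, whence `τ k = k` by
      -- injectivity, although `k` lies before the end.
      by_contra hlt
      have := τ.injective (s.tracks_map.fix (Nat.not_lt.1 hlt))
      omega
    · rw [if_neg hk, s.tracks_map.fix (by omega), if_neg hk, s.tracks.fix (by omega)]

end Projects

theorem Step.single {u₁ u₂ v₁ v₂ : G.E} (h : G.tile u₁ u₂ v₁ v₂) :
    G.Tracks [u₁, u₂] [v₁, v₂] (Equiv.swap 0 1) := by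
  simpa using Tracks.cons (Step.mk [] [] h) (Tracks.nil _)

theorem Projects.tile (p : PartialHom G H) {u₁ u₂ v₁ v₂ : G.E} (h : G.tile u₁ u₂ v₁ v₂) :
    ∃ τ, Projects p [u₁, u₂] [v₁, v₂] (Equiv.swap 0 1) τ := by
  have fix : ∀ k, Equiv.swap 0 1 (k + 2) = k + 2 := fun k =>
    Equiv.swap_apply_of_ne_of_ne (by omega) (by omega)
  obtain ⟨u₁', u₂', v₁', v₂', h₁, h₂, h₃, h₄, t⟩ | ⟨h₁, h₂, h₃⟩ | ⟨h₁, h₂, h₃⟩ := p.tile h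
  · refine ⟨Equiv.swap 0 1, Step.single h, by simpa [h₁, h₂, h₃, h₄] using Step.single t, ?_⟩
    rintro (_ | _ | k)
    · simp [positions, h₁, h₂, h₃, h₄]
    · simp [positions, h₁, h₂, h₃, h₄]
    · rw [fix]; simp [positions, h₁, h₂, h₃, h₄, fix]
  -- The first strand is erased, so both projected paths are the same list of length at most one and
  -- `τ` is trivial. What remains is to follow the surviving strand from position `1` to position
  -- `0`, if it does survive.
  · refine ⟨1, Step.single h, by simpa [List.filterMap_cons, h₁, h₂, h₃] using Tracks.nil _, ?_⟩
    rcases h₄ : p.onE v₁ with _ | e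
    · intro k; simp [positions, h₁, h₂, h₃, h₄, fix]
    · rintro (_ | k) <;> simp [positions, h₁, h₂, h₃, h₄, fix]
  · refine ⟨1, Step.single h, by simpa [List.filterMap_cons, h₁, h₂, h₃] using Tracks.nil _, ?_⟩
    rcases h₄ : p.onE v₂ with _ | e
    · intro k; simp [positions, h₁, h₂, h₃, h₄, fix]
    · rintro (_ | k) <;> simp [positions, h₁, h₂, h₃, h₄, fix]

/-- Each step is a whiskered tile, which projects by `Projects.tile`; whiskering and composition of
steps are compatible with projection. -/
theorem Tracks.exists_projects (p : PartialHom G H) {f g : List G.E} {σ : Equiv.Perm ℕ}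
    (s : G.Tracks f g σ) : ∃ τ, Projects p f g σ τ := by
  induction s with
  | nil f => exact ⟨1, .nil p f⟩
  | cons s _ ih =>
    obtain ⟨h₁, h₂, t⟩ := s
    obtain ⟨τ, hτ⟩ := ih
    obtain ⟨τ', hτ'⟩ := Projects.tile p t
    have := ((hτ'.append_right h₂).append_left h₁).trans hτ
    rw [shift_swap] at this
    exact ⟨_, this⟩

theorem Projects.comp {p : PartialHom G H} {q : PartialHom H K} {f g : List G.E}
    {σ τ ρ : Equiv.Perm ℕ} (s : Projects p f g σ τ)
    (t : Projects q (f.filterMap p.onE) (g.filterMap p.onE) τ ρ) :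
    Projects (p.comp q) f g σ ρ where
  tracks := s.tracks
  tracks_map := by
    have := t.tracks_map
    rwa [List.filterMap_filterMap, List.filterMap_filterMap] at this
  apply_positions k := by
    change σ (positions (fun a => (p.onE a).bind q.onE) f k) =
      positions (fun a => (p.onE a).bind q.onE) g (ρ k)
    rw [positions_bind, positions_bind, s.apply_positions, t.apply_positions]

theorem Projects.total (F : G ⟶ H) {f g : List G.E} {σ : Equiv.Perm ℕ} (s : G.Tracks f g σ) :
    Projects (Hom.toPartial F) f g σ σ where
  tracks := s
  tracks_map := by
    simpa only [Hom.toPartial, ← Function.comp_def some, List.filterMap_eq_map] using s.map F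
  apply_positions k := by
    simp only [Hom.toPartial, positions_total]

/-! ### The 2-functor induced by a partial homomorphism -/

theorem perm_wl {C : Type u} [Category.{u} C] (φ : C ⥤ Vertices G) {x y z : C} (f : x ⟶ y)
    {g h : y ⟶ z} (η : φ.map g ⟶ φ.map h) :
    Rescheduling.perm (Gray.wl φ f η) = shift (φ.map f).edges.length (Rescheduling.perm η) := by
  rw [Gray.wl, perm_comp, perm_comp, perm_eqToHom, perm_eqToHom, one_mul, mul_one]
  rfl

theorem perm_wr {C : Type u} [Category.{u} C] (φ : C ⥤ Vertices G) {x y z : C} {f g : x ⟶ y}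
    (η : φ.map f ⟶ φ.map g) (h : y ⟶ z) :
    Rescheduling.perm (Gray.wr φ η h) = Rescheduling.perm η := by
  rw [Gray.wr, perm_comp, perm_comp, perm_eqToHom, perm_eqToHom, one_mul, mul_one]
  rfl

/-- The action of a partial homomorphism on paths. -/
def partialPathMap (p : PartialHom G H) : Vertices G ⥤ Vertices H where
  obj x := ⟨p.onV x.vertex⟩
  map f := ⟨f.edges.filterMap p.onE, f.isPath.filterMap p⟩
  map_id _ := rfl
  map_comp f g := Path.ext (List.filterMap_append (l := f.edges) (l' := g.edges))

/-- The action of a partial homomorphism on reschedulings. -/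
noncomputable def collapseCells (p : PartialHom G H) : TwoCat.Cells (partialPathMap p) where
  -- The 2-functor laws below all compare this choice with an explicit projection by means of
  -- `Projects.unique`.
  map₂ η := ⟨(η.tracks.exists_projects p).choose,
    (η.tracks.exists_projects p).choose_spec.tracks_map⟩
  map₂_id f := cell_ext
    (((𝟙 f : Rescheduling _ _ _).tracks.exists_projects p).choose_spec.unique (.nil p _))
  map₂_comp η θ := cell_ext
    (((η ≫ θ : Rescheduling _ _ _).tracks.exists_projects p).choose_spec.unique
      ((η.tracks.exists_projects p).choose_spec.trans
        (θ.tracks.exists_projects p).choose_spec))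
  map₂_left f g h η := cell_ext (by
    rw [perm_wl]
    exact ((f ◁ η : Rescheduling _ _ _).tracks.exists_projects p).choose_spec.unique
      ((η.tracks.exists_projects p).choose_spec.append_left f.edges))
  map₂_right η h := cell_ext (by
    rw [perm_wr]
    exact ((η ▷ h : Rescheduling _ _ _).tracks.exists_projects p).choose_spec.unique
      ((η.tracks.exists_projects p).choose_spec.append_right h.edges))

/-- The 2-functor induced by a partial homomorphism. -/
noncomputable def collapse (p : PartialHom G H) : asynchTwoCat.obj G ⟶ asynchTwoCat.obj H :=
  (collapseCells p).toHom

theorem collapse_projects (p : PartialHom G H) {x y : Vertices G} {f g : x ⟶ y} (η : f ⟶ g) :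
    Projects p f.edges g.edges (Rescheduling.perm η)
      (Rescheduling.perm ((collapse p).map₂ η)) :=
  (η.tracks.exists_projects p).choose_spec

/-- Through this lemma, equations between composites of projections and homomorphisms become
equations between partial homomorphisms, which hold edge by edge. -/
theorem collapse_comp (p : PartialHom G H) (q : PartialHom H K) :
    collapse (p.comp q) = collapse p ≫ collapse q :=
  TwoCat.functor_ext
    (CategoryTheory.Functor.hext (fun _ => rfl) fun _ _ _ =>
      heq_of_eq (Path.ext List.filterMap_filterMap.symm))
    fun η => rescheduling_heq (Path.ext List.filterMap_filterMap.symm)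
      (Path.ext List.filterMap_filterMap.symm)
      ((collapse_projects (p.comp q) η).unique
        ((collapse_projects p η).comp (collapse_projects q ((collapse p).map₂ η))))

theorem filterMap_toPartial (F : G ⟶ H) (l : List G.E) :
    l.filterMap (Hom.toPartial F).onE = l.map F.onE := by
  simp only [Hom.toPartial, ← Function.comp_def some, List.filterMap_eq_map]

theorem collapse_toPartial (F : G ⟶ H) : collapse (Hom.toPartial F) = asynchTwoCat.map F :=
  TwoCat.functor_ext
    (CategoryTheory.Functor.hext (fun _ => rfl) fun _ _ _ =>
      heq_of_eq (Path.ext (filterMap_toPartial F _)))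
    fun η => rescheduling_heq (Path.ext (filterMap_toPartial F _))
      (Path.ext (filterMap_toPartial F _))
      ((collapse_projects (Hom.toPartial F) η).unique (.total F η.tracks))

theorem map_comp_collapse (F : G ⟶ H) (q : PartialHom H K) :
    asynchTwoCat.map F ≫ collapse q = collapse ((Hom.toPartial F).comp q) := by
  rw [collapse_comp, collapse_toPartial]

theorem collapse_comp_map (p : PartialHom G H) (F : H ⟶ K) :
    collapse p ≫ asynchTwoCat.map F = collapse (p.comp (Hom.toPartial F)) := by
  rw [collapse_comp, collapse_toPartial]

end
end Asynch

namespace Asynch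

/-! ### The path category is free -/

section
variable {G H K L : Asynch.{u}}

def edge (e : G.E) : (⟨G.src e⟩ : Vertices G) ⟶ ⟨G.tgt e⟩ := ⟨[e], rfl, rfl⟩

theorem path_induction {P : ∀ {x y : Vertices G}, (x ⟶ y) → Prop}
    (id : ∀ x : Vertices G, P (𝟙 x))
    (comp : ∀ (e : G.E) {y : Vertices G} (f : (⟨G.tgt e⟩ : Vertices G) ⟶ y),
      P f → P (edge e ≫ f))
    {x y : Vertices G} (f : x ⟶ y) : P f := by
  obtain ⟨l, h⟩ := f
  obtain ⟨x⟩ := x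
  induction l generalizing x with
  | nil =>
    obtain ⟨y⟩ := y
    obtain rfl : x = y := h
    exact id ⟨x⟩
  | cons e l ih =>
    obtain rfl : G.src e = x := h.1
    exact comp e ⟨l, h.2⟩ (ih (G.tgt e) h.2)

/-- The uniqueness half of freeness. Edges are compared by `HEq` because the two functors need not
agree on vertices definitionally. -/
theorem path_functor_ext {C : Type u} [Category.{u} C] {φ ψ : Vertices G ⥤ C}
    (hobj : ∀ x, φ.obj x = ψ.obj x) (hmap : ∀ e : G.E, φ.map (edge e) ≍ ψ.map (edge e)) :
    φ = ψ := by
  refine CategoryTheory.Functor.hext hobj fun x y f => ?_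
  induction f using path_induction with
  | id x => rw [φ.map_id, ψ.map_id, hobj]
  | comp e f ih =>
    rw [φ.map_comp, ψ.map_comp]
    congr 1 <;> first | exact hobj _ | exact hmap e

section
variable {C : Type u} [Category.{u} C] (obj : G.V → C)
  (m : ∀ e : G.E, obj (G.src e) ⟶ obj (G.tgt e))

def liftList : ∀ (l : List G.E) {x y : G.V}, G.IsPath x l y → (obj x ⟶ obj y)
  | [], _, _, h => eqToHom (congrArg obj h)
  | e :: l, _, _, h => eqToHom (congrArg obj h.1.symm) ≫ m e ≫ liftList l h.2

theorem liftList_append (l l' : List G.E) {x y z : G.V} (h : G.IsPath x l y)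
    (h' : G.IsPath y l' z) :
    liftList obj m (l ++ l') (h.append h') = liftList obj m l h ≫ liftList obj m l' h' := by
  induction l generalizing x with
  | nil =>
    obtain rfl : x = y := h
    exact (Category.id_comp _).symm
  | cons e l ih => simp [liftList, ih h.2]

/-- The functor out of the path category with a given action on vertices and edges. -/
def liftFunctor : Vertices G ⥤ C where
  obj x := obj x.vertex
  map f := liftList obj m f.edges f.isPath
  map_id _ := rfl
  map_comp f g := liftList_append obj m f.edges g.edges f.isPath g.isPath

theorem liftFunctor_edge (e : G.E) : (liftFunctor obj m).map (edge e) = m e :=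
  (Category.id_comp _).trans (Category.comp_id _)

end

/-! ### The comparison 2-functor -/

/-- Tiles of `G` stay tiles; a mixed tile loses one strand, and a tile of `H` loses both. -/
def fstPartial (G H : Asynch.{u}) : PartialHom (shuffle G H) G where
  onV x := x.1
  onE := Sum.elim (fun e => some e.1) (fun _ => none)
  ends_some := by rintro (e | e) _ h <;> cases h; exact ⟨rfl, rfl⟩
  ends_none := by rintro (e | e) h <;> cases h; rfl
  tile := by
    rintro (⟨u₁, y₁⟩ | ⟨x₁, u₁⟩) (⟨u₂, y₂⟩ | ⟨x₂, u₂⟩) (⟨v₁, z₁⟩ | ⟨w₁, v₁⟩) (⟨v₂, z₂⟩ | ⟨w₂, v₂⟩) h <;>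
      simp only [shuffle, shuffleTile] at h <;> simp [h]

def sndPartial (G H : Asynch.{u}) : PartialHom (shuffle G H) H where
  onV x := x.2
  onE := Sum.elim (fun _ => none) (fun e => some e.2)
  ends_some := by rintro (e | e) _ h <;> cases h; exact ⟨rfl, rfl⟩
  ends_none := by rintro (e | e) h <;> cases h; rfl
  tile := by
    rintro (⟨u₁, y₁⟩ | ⟨x₁, u₁⟩) (⟨u₂, y₂⟩ | ⟨x₂, u₂⟩) (⟨v₁, z₁⟩ | ⟨w₁, v₁⟩) (⟨v₂, z₂⟩ | ⟨w₂, v₂⟩) h <;>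
      simp only [shuffle, shuffleTile] at h <;> simp [h]

def edgeInl (e : G.E) (y : H.V) :
    (⟨(G.src e, y)⟩ : Vertices (shuffle G H)) ⟶ ⟨(G.tgt e, y)⟩ :=
  edge (G := shuffle G H) (.inl (e, y))

def edgeInr (x : G.V) (e : H.E) :
    (⟨(x, H.src e)⟩ : Vertices (shuffle G H)) ⟶ ⟨(x, H.tgt e)⟩ :=
  edge (G := shuffle G H) (.inr (x, e))

theorem shuffle_functor_ext {C : Type u} [Category.{u} C] {φ ψ : Vertices (shuffle G H) ⥤ C}
    (hobj : ∀ x, φ.obj x = ψ.obj x)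
    (hl : ∀ (e : G.E) (y : H.V), φ.map (edgeInl e y) ≍ ψ.map (edgeInl e y))
    (hr : ∀ (x : G.V) (e : H.E), φ.map (edgeInr x e) ≍ ψ.map (edgeInr x e)) : φ = ψ :=
  path_functor_ext hobj fun
    | .inl (e, y) => hl e y
    | .inr (x, e) => hr x e

/-- Edges of the shuffle go to the generators of the funny tensor product. No relation has to be
respected, since the source is free. -/
def toFunny (G H : Asynch.{u}) :
    Vertices (shuffle G H) ⥤ FunnyObj (Vertices G) (Vertices H) :=
  liftFunctor (G := shuffle G H) (fun x => ⟨⟨x.1⟩, ⟨x.2⟩⟩) fun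
    | .inl (e, y) => (Funny.inl (Vertices G) (⟨y⟩ : Vertices H)).map (edge e)
    | .inr (x, e) => (Funny.inr (Vertices H) (⟨x⟩ : Vertices G)).map (edge e)

theorem toFunny_inl (e : G.E) (y : H.V) :
    (toFunny G H).map (edgeInl e y) =
      (Funny.inl (Vertices G) (⟨y⟩ : Vertices H)).map (edge e) :=
  liftFunctor_edge (G := shuffle G H) _ _ _

theorem toFunny_inr (x : G.V) (e : H.E) :
    (toFunny G H).map (edgeInr x e) =
      (Funny.inr (Vertices H) (⟨x⟩ : Vertices G)).map (edge e) :=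
  liftFunctor_edge (G := shuffle G H) _ _ _

theorem toFunny_fst : toFunny G H ⋙ Funny.fst = partialPathMap (fstPartial G H) :=
  shuffle_functor_ext (fun _ => rfl)
    (fun e y => by rw [Functor.comp_map, toFunny_inl]; rfl)
    (fun x e => by rw [Functor.comp_map, toFunny_inr]; rfl)

theorem toFunny_snd : toFunny G H ⋙ Funny.snd = partialPathMap (sndPartial G H) :=
  shuffle_functor_ext (fun _ => rfl)
    (fun e y => by rw [Functor.comp_map, toFunny_inl]; rfl)
    (fun x e => by rw [Functor.comp_map, toFunny_inr]; rfl)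

/-- The comparison 2-functor `[G ⧢ H] ⟶ [G] ⊠ [H]`. -/
noncomputable def comparison (G H : Asynch.{u}) :
    asynchTwoCat.obj (shuffle G H) ⟶ TwoCat.gray (asynchTwoCat.obj G) (asynchTwoCat.obj H) :=
  TwoCat.grayLift (toFunny G H) (collapse (fstPartial G H)) (collapse (sndPartial G H))
    toFunny_fst toFunny_snd

theorem comparison_pr₁ : comparison G H ≫ TwoCat.pr₁ _ _ = collapse (fstPartial G H) :=
  TwoCat.grayLift_pr₁ _ _ _ _ _

theorem comparison_pr₂ : comparison G H ≫ TwoCat.pr₂ _ _ = collapse (sndPartial G H) :=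
  TwoCat.grayLift_pr₂ _ _ _ _ _

theorem comparison_pr₁_assoc {Z : TwoCat.{u}} (k : _ ⟶ Z) :
    comparison G H ≫ TwoCat.pr₁ _ _ ≫ k = collapse (fstPartial G H) ≫ k := by
  rw [← Category.assoc, comparison_pr₁]

theorem comparison_pr₂_assoc {Z : TwoCat.{u}} (k : _ ⟶ Z) :
    comparison G H ≫ TwoCat.pr₂ _ _ ≫ k = collapse (sndPartial G H) ≫ k := by
  rw [← Category.assoc, comparison_pr₂]

/-! ### Compatibility of the comparison with the symmetric monoidal structures -/

theorem edge_heq {e : G.E} {x y : Vertices G} (f : x ⟶ y) (h : f.edges = [e])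
    (hx : x.vertex = G.src e) (hy : y.vertex = G.tgt e) : f ≍ edge e := by
  obtain ⟨x⟩ := x
  obtain ⟨y⟩ := y
  obtain rfl : x = _ := hx
  obtain rfl : y = _ := hy
  exact heq_of_eq (Path.ext h)

theorem map_heq_map {C D : Type u} [Category.{u} C] [Category.{u} D] (φ : C ⥤ D)
    {x y x' y' : C} {f : x ⟶ y} {g : x' ⟶ y'} (hx : x = x') (hy : y = y') (h : f ≍ g) :
    φ.map f ≍ φ.map g := by
  subst hx hy; cases h; rfl

theorem pathMap_edge (F : G ⟶ H) (e : G.E) :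
    (pathMap F).map (edge e) ≍ edge (F.onE e) :=
  edge_heq ((pathMap F).map (edge e)) rfl (F.src e).symm (F.tgt e).symm

/-- `TwoCat.gray_ext` leaves three equalities: one of underlying functors, checked on edges, and one
for each projection, where both sides are the `collapse` of a partial homomorphism. -/
theorem comparison_natural (F : G ⟶ K) (F' : H ⟶ L) :
    comparison G H ≫ TwoCat.grayMap (asynchTwoCat.map F) (asynchTwoCat.map F') =
      asynchTwoCat.map (shuffleMap F F') ≫ comparison K L := by
  refine TwoCat.gray_ext ?_ ?_ ?_
  · refine shuffle_functor_ext (fun _ => rfl) (fun e y => ?_) (fun x e => ?_)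
    · change (Funny.map (pathMap F) (pathMap F')).map ((toFunny G H).map (edgeInl e y)) ≍
        (toFunny K L).map ((pathMap (shuffleMap F F')).map (edgeInl e y))
      -- The image edge `F.onE e` has ends `K.src (F.onE e)` and `K.tgt (F.onE e)`, which equal the
      -- images of the ends of `e` only propositionally; the equality is therefore carried along
      -- these identifications of vertices.
      have h := map_heq_map (toFunny K L)
        (congrArg (fun z => (⟨(z, F'.onV y)⟩ : Vertices (shuffle K L))) (F.src e).symm)
        (congrArg (fun z => (⟨(z, F'.onV y)⟩ : Vertices (shuffle K L))) (F.tgt e).symm)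
        (pathMap_edge (shuffleMap F F') (.inl (e, y)))
      rw [toFunny_inl]
      refine HEq.trans ?_ h.symm
      refine HEq.trans ?_ (heq_of_eq (toFunny_inl (F.onE e) (F'.onV y)).symm)
      exact map_heq_map (Funny.inl (Vertices K) (⟨F'.onV y⟩ : Vertices L))
        (congrArg Vertices.mk (F.src e).symm) (congrArg Vertices.mk (F.tgt e).symm)
        (pathMap_edge F e)
    · change (Funny.map (pathMap F) (pathMap F')).map ((toFunny G H).map (edgeInr x e)) ≍
        (toFunny K L).map ((pathMap (shuffleMap F F')).map (edgeInr x e))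
      have h := map_heq_map (toFunny K L)
        (congrArg (fun z => (⟨(F.onV x, z)⟩ : Vertices (shuffle K L))) (F'.src e).symm)
        (congrArg (fun z => (⟨(F.onV x, z)⟩ : Vertices (shuffle K L))) (F'.tgt e).symm)
        (pathMap_edge (shuffleMap F F') (.inr (x, e)))
      rw [toFunny_inr]
      refine HEq.trans ?_ h.symm
      refine HEq.trans ?_ (heq_of_eq (toFunny_inr (F.onV x) (F'.onE e)).symm)
      exact map_heq_map (Funny.inr (Vertices L) (⟨F.onV x⟩ : Vertices K))
        (congrArg Vertices.mk (F'.src e).symm) (congrArg Vertices.mk (F'.tgt e).symm)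
        (pathMap_edge F' e)
  · rw [Category.assoc, Category.assoc, TwoCat.grayMap_pr₁, comparison_pr₁, comparison_pr₁_assoc,
      map_comp_collapse, collapse_comp_map]
    congr 1
    exact PartialHom.ext rfl (by ext (_ | _) <;> rfl)
  · rw [Category.assoc, Category.assoc, TwoCat.grayMap_pr₂, comparison_pr₂, comparison_pr₂_assoc,
      map_comp_collapse, collapse_comp_map]
    congr 1
    exact PartialHom.ext rfl (by ext (_ | _) <;> rfl)

theorem comparison_assoc (G H K : Asynch.{u}) :
    comparison (shuffle G H) K ≫ TwoCat.grayMap (comparison G H) (𝟙 _) ≫ TwoCat.assocHom _ _ _ =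
      asynchTwoCat.map (assocHom G H K) ≫ comparison G (shuffle H K) ≫
        TwoCat.grayMap (𝟙 _) (comparison H K) := by
  refine TwoCat.gray_ext ?_ ?_ ?_
  · refine shuffle_functor_ext (fun _ => rfl) ?_ ?_
    · rintro (⟨e, y⟩ | ⟨x, e⟩) z <;> refine heq_of_eq ?_
      · change (Funny.assoc _ _ _).map ((Funny.map (toFunny G H) (𝟭 (Vertices K))).map
          ((toFunny (shuffle G H) K).map (edgeInl (G := shuffle G H) (.inl (e, y)) z))) =
          (Funny.map (𝟭 (Vertices G)) (toFunny H K)).map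
          ((toFunny G (shuffle H K)).map (edgeInl (H := shuffle H K) e (y, z)))
        erw [toFunny_inl, toFunny_inl]
        change (Funny.assocLeft _ _ _ (⟨z⟩ : Vertices K)).map
          ((toFunny G H).map (edgeInl e y)) = _
        erw [toFunny_inl]; rfl
      · change (Funny.assoc _ _ _).map ((Funny.map (toFunny G H) (𝟭 (Vertices K))).map
          ((toFunny (shuffle G H) K).map (edgeInl (G := shuffle G H) (.inr (x, e)) z))) =
          (Funny.map (𝟭 (Vertices G)) (toFunny H K)).map
          ((toFunny G (shuffle H K)).map (edgeInr (H := shuffle H K) x (.inl (e, z))))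
        erw [toFunny_inl, toFunny_inr]
        change (Funny.assocLeft _ _ _ (⟨z⟩ : Vertices K)).map
          ((toFunny G H).map (edgeInr x e)) =
          (Funny.inr _ (⟨x⟩ : Vertices G)).map ((toFunny H K).map (edgeInl e z))
        erw [toFunny_inr, toFunny_inl]; rfl
    · rintro ⟨x, y⟩ e
      refine heq_of_eq ?_
      change (Funny.assoc _ _ _).map ((Funny.map (toFunny G H) (𝟭 (Vertices K))).map
          ((toFunny (shuffle G H) K).map (edgeInr (G := shuffle G H) (x, y) e))) =
          (Funny.map (𝟭 (Vertices G)) (toFunny H K)).map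
          ((toFunny G (shuffle H K)).map (edgeInr (H := shuffle H K) x (.inr (y, e))))
      erw [toFunny_inr, toFunny_inr]
      change _ = (Funny.inr _ (⟨x⟩ : Vertices G)).map ((toFunny H K).map (edgeInr y e))
      erw [toFunny_inr]; rfl
  · simp only [Category.assoc, TwoCat.assocHom_pr₁, TwoCat.grayMap_pr₁, TwoCat.grayMap_pr₁_assoc,
      comparison_pr₁, comparison_pr₁_assoc, Category.comp_id, map_comp_collapse, ← collapse_comp]
    congr 1
    exact PartialHom.ext rfl (by ext (⟨_ | _, _⟩ | _) <;> rfl)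
  · simp only [Category.assoc, TwoCat.assocHom_pr₂, TwoCat.grayMap_pr₂, comparison_pr₂_assoc,
      TwoCat.grayMap_comp, Category.comp_id, comparison_pr₂]
    -- The second projection again takes values in a Gray product, so the same three-part criterion
    -- is applied once more.
    refine TwoCat.gray_ext ?_ ?_ ?_
    · refine shuffle_functor_ext (fun _ => rfl) ?_ ?_
      · rintro (⟨e, y⟩ | ⟨x, e⟩) z <;> refine heq_of_eq ?_
        -- An edge of `G` is erased by the projection to `H` and `K`, so both sides are an identity.
        · change (Funny.map (partialPathMap (sndPartial G H)) (𝟭 (Vertices K))).map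
            ((toFunny (shuffle G H) K).map (edgeInl (G := shuffle G H) (.inl (e, y)) z)) =
            𝟙 (⟨⟨y⟩, ⟨z⟩⟩ : FunnyObj (Vertices H) (Vertices K))
          erw [toFunny_inl]
          exact (Funny.inl (Vertices H) (⟨z⟩ : Vertices K)).map_id ⟨y⟩
        · change (Funny.map (partialPathMap (sndPartial G H)) (𝟭 (Vertices K))).map
            ((toFunny (shuffle G H) K).map (edgeInl (G := shuffle G H) (.inr (x, e)) z)) =
            (toFunny H K).map (edgeInl e z)
          erw [toFunny_inl]
      · rintro ⟨x, y⟩ e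
        refine heq_of_eq ?_
        change (Funny.map (partialPathMap (sndPartial G H)) (𝟭 (Vertices K))).map
          ((toFunny (shuffle G H) K).map (edgeInr (G := shuffle G H) (x, y) e)) =
          (toFunny H K).map (edgeInr y e)
        erw [toFunny_inr]
    · simp only [Category.assoc, TwoCat.grayMap_pr₁,
        comparison_pr₁, comparison_pr₁_assoc, map_comp_collapse, ← collapse_comp]
      congr 1
      exact PartialHom.ext rfl (by ext (⟨_ | _, _⟩ | _) <;> rfl)
    · simp only [Category.assoc, TwoCat.grayMap_pr₂, Category.comp_id,
        comparison_pr₂, map_comp_collapse, ← collapse_comp]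
      congr 1
      exact PartialHom.ext rfl (by ext (⟨_ | _, _⟩ | _) <;> rfl)

theorem comparison_swap (G H : Asynch.{u}) :
    comparison G H ≫ TwoCat.swap _ _ = asynchTwoCat.map (swap G H) ≫ comparison H G := by
  refine TwoCat.gray_ext ?_ ?_ ?_
  · refine shuffle_functor_ext (fun _ => rfl) (fun e y => heq_of_eq ?_) (fun x e => heq_of_eq ?_)
    · change (Funny.swap _ _).map ((toFunny G H).map (edgeInl e y)) =
        (toFunny H G).map (edgeInr y e)
      erw [toFunny_inl, toFunny_inr]; rfl
    · change (Funny.swap _ _).map ((toFunny G H).map (edgeInr x e)) =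
        (toFunny H G).map (edgeInl e x)
      exact (congrArg (Funny.swap _ _).map (toFunny_inr x e)).trans (toFunny_inl e x).symm
  · simp only [Category.assoc, TwoCat.swap_pr₁, comparison_pr₁, comparison_pr₂, map_comp_collapse]
    congr 1
    exact PartialHom.ext rfl (by ext (_ | _) <;> rfl)
  · simp only [Category.assoc, TwoCat.swap_pr₂, comparison_pr₁, comparison_pr₂, map_comp_collapse]
    congr 1
    exact PartialHom.ext rfl (by ext (_ | _) <;> rfl)

noncomputable def counit : asynchTwoCat.obj unit.{u} ⟶ TwoCat.one :=
  TwoCat.const _ TwoCat.star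

theorem collapse_id (p : PartialHom G G) (h : p = Hom.toPartial (𝟙 G)) :
    collapse p = 𝟙 (asynchTwoCat.obj G) := by
  rw [h, collapse_toPartial, asynchTwoCat.map_id]

/-- The first projection lands in the terminal 2-category, and the second reduces to a partial
homomorphism that is the identity of `G`. -/
theorem comparison_left_unit (G : Asynch.{u}) :
    TwoCat.inr (asynchTwoCat.obj G) TwoCat.star = asynchTwoCat.map (leftUnitorInv G) ≫
      comparison unit G ≫ TwoCat.grayMap counit (𝟙 _) := by
  refine TwoCat.gray_ext ?_ (TwoCat.to_one_ext _ _) ?_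
  · refine path_functor_ext (fun _ => rfl) fun e => heq_of_eq ?_
    change (Funny.inr (Vertices G) TwoCat.star).map (edge e) =
      (Funny.map (TwoCat.U counit) (𝟭 (Vertices G))).map
        ((toFunny unit G).map (edgeInr (G := unit) PUnit.unit e))
    erw [toFunny_inr]; rfl
  · simp only [Category.assoc, TwoCat.grayMap_pr₂, TwoCat.inr_pr₂, comparison_pr₂,
      map_comp_collapse, Category.comp_id]
    exact (collapse_id _ rfl).symm

theorem comparison_right_unit (G : Asynch.{u}) :
    TwoCat.inl (asynchTwoCat.obj G) TwoCat.star = asynchTwoCat.map (rightUnitorInv G) ≫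
      comparison G unit ≫ TwoCat.grayMap (𝟙 _) counit := by
  refine TwoCat.gray_ext ?_ ?_ (TwoCat.to_one_ext _ _)
  · refine path_functor_ext (fun _ => rfl) fun e => heq_of_eq ?_
    change (Funny.inl (Vertices G) TwoCat.star).map (edge e) =
      (Funny.map (𝟭 (Vertices G)) (TwoCat.U counit)).map
        ((toFunny G unit).map (edgeInl (H := unit) e PUnit.unit))
    erw [toFunny_inl]; rfl
  · simp only [Category.assoc, TwoCat.grayMap_pr₁, TwoCat.inl_pr₁, comparison_pr₁,
      map_comp_collapse, Category.comp_id]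
    exact (collapse_id _ rfl).symm

-- The oplax direction is the convenient one: a 2-functor into a Gray product is given by a functor
-- and two projections, whereas the opposite direction would have to merge two reschedulings into
-- one.
open MonoidalCategory in
noncomputable abbrev oplaxMonoidal : (asynchTwoCat.{u}).OplaxMonoidal where
  η := counit
  δ G H := comparison G H
  δ_natural_left F H := by
    have := comparison_natural F (𝟙 H)
    rwa [asynchTwoCat.map_id] at this
  δ_natural_right G F := by
    have := comparison_natural (𝟙 G) F
    rwa [asynchTwoCat.map_id] at this
  oplax_associativity := comparison_assoc
  oplax_left_unitality := comparison_left_unit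
  oplax_right_unitality := comparison_right_unit

end
end Asynch

/-! ### A criterion for 2-functors to be isomorphisms -/

namespace TwoCat

section
variable {A : Type u} [Bicategory.{u, u} A]

theorem exists_heq {x y x' y' : A} {f g : x ⟶ y} {f' g' : x' ⟶ y'} (hx : x = x') (hy : y = y')
    (hf : f ≍ f') (hg : g ≍ g') (η : f ⟶ g) : ∃ η' : f' ⟶ g', η' ≍ η := by
  subst hx hy; cases hf; cases hg; exact ⟨η, HEq.rfl⟩

theorem id₂_heq {x y x' y' : A} {f : x ⟶ y} {f' : x' ⟶ y'} (hx : x = x') (hy : y = y')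
    (hf : f ≍ f') : 𝟙 f ≍ 𝟙 f' := by
  subst hx hy; cases hf; rfl

theorem comp₂_heq {x y x' y' : A} {f g h : x ⟶ y} {f' g' h' : x' ⟶ y'} (hx : x = x')
    (hy : y = y') (hf : f ≍ f') (hg : g ≍ g') (hh : h ≍ h') {η : f ⟶ g} {θ : g ⟶ h}
    {η' : f' ⟶ g'} {θ' : g' ⟶ h'} (hη : η ≍ η') (hθ : θ ≍ θ') : η ≫ θ ≍ η' ≫ θ' := by
  subst hx hy; cases hf; cases hg; cases hh; cases hη; cases hθ; rfl

theorem whiskerLeft_heq {x y z x' y' z' : A} {f : x ⟶ y} {f' : x' ⟶ y'} {g h : y ⟶ z}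
    {g' h' : y' ⟶ z'} (hx : x = x') (hy : y = y') (hz : z = z') (hf : f ≍ f') (hg : g ≍ g')
    (hh : h ≍ h') {η : g ⟶ h} {η' : g' ⟶ h'} (hη : η ≍ η') : f ◁ η ≍ f' ◁ η' := by
  subst hx hy hz; cases hf; cases hg; cases hh; cases hη; rfl

theorem whiskerRight_heq {x y z x' y' z' : A} {f g : x ⟶ y} {f' g' : x' ⟶ y'} {h : y ⟶ z}
    {h' : y' ⟶ z'} (hx : x = x') (hy : y = y') (hz : z = z') (hf : f ≍ f') (hg : g ≍ g')
    (hh : h ≍ h') {η : f ⟶ g} {η' : f' ⟶ g'} (hη : η ≍ η') : η ▷ h ≍ η' ▷ h' := by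
  subst hx hy hz; cases hf; cases hg; cases hh; cases hη; rfl

end

section
variable {C : Type u} [Category.{u} C] {A : Type u} [Bicategory.{u, u} A] [Bicategory.Strict A]
  (F : C ⥤ A)

theorem wl_heq {X Y Z : C} (f : X ⟶ Y) {g h : Y ⟶ Z} (η : F.map g ⟶ F.map h) :
    Gray.wl F f η ≍ F.map f ◁ η :=
  (eqToHom_comp_heq _ _).trans (comp_eqToHom_heq _ _)

theorem wr_heq {X Y Z : C} {f g : X ⟶ Y} (η : F.map f ⟶ F.map g) (h : Y ⟶ Z) :
    Gray.wr F η h ≍ η ▷ F.map h :=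
  (eqToHom_comp_heq _ _).trans (comp_eqToHom_heq _ _)

end

section
variable {A B : Type u} [Bicategory.{u, u} A] [Bicategory.Strict A]
  [Bicategory.{u, u} B] [Bicategory.Strict B] (F : StrictPseudofunctor A B)

omit [Bicategory.Strict B] in
theorem map₂_heq {x y x' y' : A} {f g : x ⟶ y} {f' g' : x' ⟶ y'} (hx : x = x') (hy : y = y')
    (hf : f ≍ f') (hg : g ≍ g') {η : f ⟶ g} {η' : f' ⟶ g'} (h : η ≍ η') :
    F.map₂ η ≍ F.map₂ η' := by
  subst hx hy; cases hf; cases hg; cases h; rfl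

omit [Bicategory.Strict B] in
theorem heq_of_map₂_heq (hF : ∀ {x y : A} {f g : x ⟶ y} {η θ : f ⟶ g}, F.map₂ η = F.map₂ θ → η = θ)
    {x y x' y' : A} {f g : x ⟶ y} {f' g' : x' ⟶ y'} (hx : x = x') (hy : y = y')
    (hf : f ≍ f') (hg : g ≍ g') {η : f ⟶ g} {η' : f' ⟶ g'} (h : F.map₂ η ≍ F.map₂ η') :
    η ≍ η' := by
  subst hx hy; cases hf; cases hg; exact heq_of_eq (hF (eq_of_heq h))

theorem map₂_whiskerLeft_heq {x y z : A} (f : x ⟶ y) {g h : y ⟶ z} (η : g ⟶ h) :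
    F.map₂ (f ◁ η) ≍ F.map f ◁ F.map₂ η :=
  (heq_of_eq ((cells F).map₂_left f η)).trans (wl_heq F.toFunctor f _)

theorem map₂_whiskerRight_heq {x y z : A} {f g : x ⟶ y} (η : f ⟶ g) (h : y ⟶ z) :
    F.map₂ (η ▷ h) ≍ F.map₂ η ▷ F.map h :=
  (heq_of_eq ((cells F).map₂_right η h)).trans (wr_heq F.toFunctor _ h)

end

/-- A 2-functor that is an isomorphism on underlying categories and locally bijective on 2-cells is
an isomorphism. -/
theorem isIso_of_bijective {A B : TwoCat.{u}} (F : A ⟶ B) (Ψ : B ⥤ A) (h₁ : U F ⋙ Ψ = 𝟭 A)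
    (h₂ : Ψ ⋙ U F = 𝟭 B)
    (inj : ∀ {x y : A} {f g : x ⟶ y} {η θ : f ⟶ g}, F.map₂ η = F.map₂ θ → η = θ)
    (surj : ∀ {x y : A} {f g : x ⟶ y} (η : F.map f ⟶ F.map g), ∃ θ : f ⟶ g, F.map₂ θ = η) :
    IsIso F := by
  have ho (x : B) : F.obj (Ψ.obj x) = x := Functor.congr_obj h₂ x
  have hm {x y : B} (f : x ⟶ y) : F.map (Ψ.map f) ≍ f := Functor.hcongr_hom h₂ f
  -- A 2-cell `η : f ⟶ g` is transported along `F (Ψ f) = f` and `F (Ψ g) = g`, then lifted by local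
  -- surjectivity.
  have ex {x y : B} {f g : x ⟶ y} (η : f ⟶ g) : ∃ θ : Ψ.map f ⟶ Ψ.map g, F.map₂ θ ≍ η := by
    obtain ⟨η', hη'⟩ := exists_heq (ho x).symm (ho y).symm (hm f).symm (hm g).symm η
    obtain ⟨θ, rfl⟩ := surj η'
    exact ⟨θ, hη'⟩
  choose inv hinv using @ex
  -- Each law for the chosen lifts holds after applying `F`, since `F` is a 2-functor, and descends
  -- by local injectivity.
  let c : Cells Ψ :=
    { map₂ := inv
      map₂_id := fun {x y} f => inj (eq_of_heq ((hinv _).trans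
        ((id₂_heq (ho x) (ho y) (hm f)).symm.trans (heq_of_eq (F.map₂_id _).symm))))
      map₂_comp := fun {x y f g h} η θ => inj (eq_of_heq ((hinv _).trans
        ((comp₂_heq (ho x) (ho y) (hm f) (hm g) (hm h) (hinv η) (hinv θ)).symm.trans
          (heq_of_eq (F.map₂_comp _ _).symm))))
      map₂_left := fun {x y z} f g h η => inj (eq_of_heq ((hinv _).trans
        ((whiskerLeft_heq (ho x) (ho y) (ho z) (hm f) (hm g) (hm h) (hinv η)).symm.trans
          ((map₂_whiskerLeft_heq F (Ψ.map f) (inv η)).symm.trans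
            (map₂_heq F rfl rfl (heq_of_eq (Ψ.map_comp f g).symm)
              (heq_of_eq (Ψ.map_comp f h).symm) (wl_heq Ψ f (inv η)).symm)))))
      map₂_right := fun {x y z f g} η h => inj (eq_of_heq ((hinv _).trans
        ((whiskerRight_heq (ho x) (ho y) (ho z) (hm f) (hm g) (hm h) (hinv η)).symm.trans
          ((map₂_whiskerRight_heq F (inv η) (Ψ.map h)).symm.trans
            (map₂_heq F rfl rfl (heq_of_eq (Ψ.map_comp f h).symm)
              (heq_of_eq (Ψ.map_comp g h).symm) (wr_heq Ψ (inv η) h).symm))))) }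
  refine ⟨c.toHom, functor_ext h₁ fun {x y f g} η => ?_, functor_ext h₂ fun η => hinv η⟩
  exact heq_of_map₂_heq F inj (Functor.congr_obj h₁ x) (Functor.congr_obj h₁ y)
    (Functor.hcongr_hom h₁ f) (Functor.hcongr_hom h₁ g) (hinv _)

end TwoCat

namespace Asynch

/-! ### The comparison 2-functor is an isomorphism -/

section
variable {G H : Asynch.{u}}

theorem Tracks.symm {f g : List G.E} {σ : Equiv.Perm ℕ} (s : G.Tracks f g σ) :
    G.Tracks g f σ⁻¹ := by
  induction s with
  | nil f => exact .nil f
  | cons s _ ih =>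
    obtain ⟨h₁, h₂, t⟩ := s
    rw [mul_inv_rev, Equiv.swap_inv]
    have := Tracks.cons (Step.mk h₁ h₂ (G.symm t)) (.nil _)
    rw [one_mul] at this
    exact ih.trans this

theorem Tracks.eq_one {f g : List G.E} {σ : Equiv.Perm ℕ} (s : G.Tracks f g σ)
    (hf : f.length ≤ 1) : σ = 1 := by
  have fix : ∀ i, 1 ≤ i → σ i = i := fun i hi => s.fix (hf.trans hi)
  ext i
  rcases i with _ | i
  · by_contra h
    -- If `σ 0` were at least `1`, it would be fixed by `σ`, and injectivity would give `σ 0 = 0`.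
    exact h (σ.injective (fix (σ 0) (Nat.one_le_iff_ne_zero.2 h)))
  · exact fix _ (by omega)

theorem Projects.symm {p : PartialHom G H} {f g : List G.E} {σ τ : Equiv.Perm ℕ}
    (s : Projects p f g σ τ) : Projects p g f σ⁻¹ τ⁻¹ where
  tracks := s.tracks.symm
  tracks_map := s.tracks_map.symm
  apply_positions k := by
    rw [Equiv.Perm.inv_eq_iff_eq, s.apply_positions, ← Equiv.Perm.mul_apply,
      mul_inv_cancel, Equiv.Perm.one_apply]

theorem positions_map {α β γ : Type*} (F : α → β) (p : β → Option γ) (l : List α) (k : ℕ) :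
    positions p (l.map F) k = positions (fun a => p (F a)) l k := by
  induction l generalizing k with
  | nil => rfl
  | cons a l ih => cases k <;> simp [positions, ih]

theorem positions_none {α β : Type*} (l : List α) (k : ℕ) :
    positions (fun _ => (none : Option β)) l k = l.length + k := by
  rw [positions_of_le] <;> simp

/-- A homomorphism keeps every edge in its place, so positions along `F` followed by `p` are
positions of `p` in the image path. Applied to the inclusions of the two factors. -/
theorem Projects.of_total {K : Asynch.{u}} {F : G ⟶ H} {p : PartialHom H K} {f g : List G.E}
    {σ τ : Equiv.Perm ℕ} (s : Projects ((Hom.toPartial F).comp p) f g σ τ) :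
    Projects p (f.map F.onE) (g.map F.onE) σ τ where
  tracks := s.tracks.map F
  tracks_map := by
    rw [List.filterMap_map, List.filterMap_map]
    exact s.tracks_map
  apply_positions k := by
    rw [positions_map, positions_map]
    exact s.apply_positions k

/-- When every edge is erased, the enumeration only lists positions after the end, where `σ` is the
identity. -/
theorem Projects.of_none {p : PartialHom G H} (hp : p.onE = fun _ => none) {f g : List G.E}
    {σ : Equiv.Perm ℕ} (s : G.Tracks f g σ) : Projects p f g σ 1 where
  tracks := s
  tracks_map := by simpa [hp] using Tracks.nil _
  apply_positions k := by
    rw [hp, positions_none, positions_none, s.fix (Nat.le_add_right _ _), s.length_eq]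
    rfl

/-- The rescheduling `σ` of `f` as `g` is the shuffle of `τ₁` and `τ₂`. -/
structure Splits (f g : List (shuffle G H).E) (σ τ₁ τ₂ : Equiv.Perm ℕ) : Prop where
  fst : Projects (fstPartial G H) f g σ τ₁
  snd : Projects (sndPartial G H) f g σ τ₂

namespace Splits
variable {f g h : List (shuffle G H).E} {σ τ₁ τ₂ σ' τ₁' τ₂' : Equiv.Perm ℕ}

theorem nil (f : List (shuffle G H).E) : Splits f f 1 1 1 := ⟨.nil _ f, .nil _ f⟩

theorem trans (s : Splits f g σ τ₁ τ₂) (t : Splits g h σ' τ₁' τ₂') :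
    Splits f h (σ' * σ) (τ₁' * τ₁) (τ₂' * τ₂) :=
  ⟨s.fst.trans t.fst, s.snd.trans t.snd⟩

theorem symm (s : Splits f g σ τ₁ τ₂) : Splits g f σ⁻¹ τ₁⁻¹ τ₂⁻¹ := ⟨s.fst.symm, s.snd.symm⟩

theorem append_left (h : List (shuffle G H).E) (s : Splits f g σ τ₁ τ₂) :
    Splits (h ++ f) (h ++ g) (shift h.length σ)
      (shift (h.filterMap (fstPartial G H).onE).length τ₁)
      (shift (h.filterMap (sndPartial G H).onE).length τ₂) :=
  ⟨s.fst.append_left h, s.snd.append_left h⟩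

theorem append_left_one (h : List (shuffle G H).E) (s : Splits f g σ 1 1) :
    Splits (h ++ f) (h ++ g) (shift h.length σ) 1 1 := by
  simpa only [shift_one] using s.append_left h

theorem append_right (s : Splits f g σ τ₁ τ₂) (h : List (shuffle G H).E) :
    Splits (f ++ h) (g ++ h) σ τ₁ τ₂ :=
  ⟨s.fst.append_right h, s.snd.append_right h⟩

end Splits

/-- Each edge of the shuffle survives in one of the projections, and positions after the end are
listed by both. Hence a bijection is known once it is known on the two enumerations. -/
theorem exists_positions_eq (f : List (shuffle G H).E) (i : ℕ) :
    (∃ k, positions (fstPartial G H).onE f k = i) ∨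
      ∃ k, positions (sndPartial G H).onE f k = i := by
  induction f generalizing i with
  | nil => exact Or.inl ⟨i, rfl⟩
  | cons e f ih =>
    rcases e with e | e
    · rcases i with _ | i
      · exact Or.inl ⟨0, positions_cons_some_zero (fstPartial G H).onE (a := .inl e) rfl f⟩
      · obtain ⟨k, rfl⟩ | ⟨k, rfl⟩ := ih i
        · exact Or.inl ⟨k + 1,
            positions_cons_some_succ (fstPartial G H).onE (a := .inl e) rfl f k⟩
        · exact Or.inr ⟨k, positions_cons_none _ rfl f k⟩
    · rcases i with _ | i
      · exact Or.inr ⟨0, positions_cons_some_zero (sndPartial G H).onE (a := .inr e) rfl f⟩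
      · obtain ⟨k, rfl⟩ | ⟨k, rfl⟩ := ih i
        · exact Or.inl ⟨k, positions_cons_none _ rfl f k⟩
        · exact Or.inr ⟨k + 1,
            positions_cons_some_succ (sndPartial G H).onE (a := .inr e) rfl f k⟩

theorem Splits.unique {f g : List (shuffle G H).E} {σ σ' τ₁ τ₂ : Equiv.Perm ℕ}
    (s : Splits f g σ τ₁ τ₂) (t : Splits f g σ' τ₁ τ₂) : σ = σ' := by
  ext i
  obtain ⟨k, rfl⟩ | ⟨k, rfl⟩ := exists_positions_eq f i
  · rw [s.fst.apply_positions, t.fst.apply_positions]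
  · rw [s.snd.apply_positions, t.snd.apply_positions]

/-- Each projection of a mixed tile retains a single edge, and a rescheduling of a path of length
one is trivial. -/
theorem Splits.exchange (u : G.E) (v : H.E) :
    Splits (G := G) (H := H) [.inr (G.src u, v), .inl (u, H.tgt v)]
      [.inl (u, H.src v), .inr (G.tgt u, v)] (Equiv.swap 0 1) 1 1 := by
  have t : (shuffle G H).tile (.inr (G.src u, v)) (.inl (u, H.tgt v))
      (.inl (u, H.src v)) (.inr (G.tgt u, v)) := ⟨rfl, rfl, rfl, rfl, rfl, rfl⟩
  obtain ⟨τ₁, h₁⟩ := Projects.tile (fstPartial G H) t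
  obtain ⟨τ₂, h₂⟩ := Projects.tile (sndPartial G H) t
  obtain rfl := h₁.tracks_map.eq_one le_rfl
  obtain rfl := h₂.tracks_map.eq_one le_rfl
  exact ⟨h₁, h₂⟩

/-- The inclusion of `G` at a vertex of `H`. -/
def inclLeft (G : Asynch.{u}) {H : Asynch.{u}} (y : H.V) : G ⟶ shuffle G H where
  onV x := (x, y)
  onE u := .inl (u, y)
  src _ := rfl
  tgt _ := rfl
  tile h := ⟨h, rfl, rfl, rfl⟩

/-- The inclusion of `H` at a vertex of `G`. -/
def inclRight {G : Asynch.{u}} (H : Asynch.{u}) (x : G.V) : H ⟶ shuffle G H where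
  onV y := (x, y)
  onE v := .inr (x, v)
  src _ := rfl
  tgt _ := rfl
  tile h := ⟨h, rfl, rfl, rfl⟩

theorem Splits.inclLeft (y : H.V) {f g : List G.E} {σ : Equiv.Perm ℕ} (s : G.Tracks f g σ) :
    Splits (f.map (inclLeft G y).onE) (g.map (inclLeft G y).onE) σ σ 1 :=
  ⟨.of_total (.total (𝟙 G) s), .of_total (.of_none rfl s)⟩

theorem Splits.inclRight (x : G.V) {f g : List H.E} {σ : Equiv.Perm ℕ} (s : H.Tracks f g σ) :
    Splits (f.map (inclRight H x).onE) (g.map (inclRight H x).onE) σ 1 σ :=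
  ⟨.of_total (.of_none rfl s), .of_total (.total (𝟙 H) s)⟩

/-- An edge of `H` is pushed past a path of `G`, one mixed tile at a time. The path then runs at the
source of `v` instead of its target. -/
theorem exists_splits_move {x z : G.V} {f : List G.E} (hf : G.IsPath x f z) (v : H.E) :
    ∃ σ, Splits (.inr (x, v) :: f.map (inclLeft G (H.tgt v)).onE)
      (f.map (inclLeft G (H.src v)).onE ++ [.inr (z, v)]) σ 1 1 := by
  induction f generalizing x with
  | nil => obtain rfl : x = z := hf; exact ⟨1, .nil _⟩
  | cons u f ih =>
    obtain ⟨rfl, hf⟩ := hf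
    obtain ⟨σ, hσ⟩ := ih hf
    exact ⟨_, ((Splits.exchange u v).append_right (f.map (inclLeft G (H.tgt v)).onE)).trans
      (hσ.append_left_one [.inl (u, H.src v)])⟩

/-- Every path of the shuffle product can be rescheduled so as to first go through the edges of the
first graph. -/
theorem exists_splits_sort {x z : (shuffle G H).V} {f : List (shuffle G H).E}
    (hf : (shuffle G H).IsPath x f z) :
    ∃ σ, Splits f ((f.filterMap (fstPartial G H).onE).map (inclLeft G x.2).onE ++
      (f.filterMap (sndPartial G H).onE).map (inclRight H z.1).onE) σ 1 1 := by
  induction f generalizing x with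
  | nil => exact ⟨1, .nil _⟩
  | cons e f ih =>
    obtain ⟨rfl, hf⟩ := hf
    obtain ⟨σ, hσ⟩ := ih hf
    rcases e with ⟨u, y⟩ | ⟨x, v⟩
    · exact ⟨_, hσ.append_left_one [.inl (u, y)]⟩
    -- The tail is already sorted; the leading `H`-edge only has to cross the `G`-block of the tail.
    · obtain ⟨σ', hσ'⟩ := exists_splits_move (hf.filterMap (fstPartial G H)) v
      have h := (hσ.append_left_one [.inr (x, v)]).trans (hσ'.append_right _)
      rw [List.append_assoc] at h
      exact ⟨_, h⟩

/-- Sort `f`, apply `τ₁` to the `G`-block and `τ₂` to the `H`-block, then undo the sorting of `g`.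
The vertices at which the two blocks run depend only on the common ends `x` and `z`, so the pieces
fit; the sorting steps project to identities, so the composite splits into exactly `τ₁` and `τ₂`. -/
theorem exists_splits {x z : (shuffle G H).V} {f g : List (shuffle G H).E}
    (hf : (shuffle G H).IsPath x f z) (hg : (shuffle G H).IsPath x g z) {τ₁ τ₂ : Equiv.Perm ℕ}
    (h₁ : G.Tracks (f.filterMap (fstPartial G H).onE) (g.filterMap (fstPartial G H).onE) τ₁)
    (h₂ : H.Tracks (f.filterMap (sndPartial G H).onE) (g.filterMap (sndPartial G H).onE) τ₂) :
    ∃ σ, Splits f g σ τ₁ τ₂ := by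
  obtain ⟨σ, hσ⟩ := exists_splits_sort hf
  obtain ⟨σ', hσ'⟩ := exists_splits_sort hg
  have left := (Splits.inclLeft x.2 h₁).append_right
    ((f.filterMap (sndPartial G H).onE).map (inclRight H z.1).onE)
  have right := (Splits.inclRight z.1 h₂).append_left
    ((g.filterMap (fstPartial G H).onE).map (inclLeft G x.2).onE)
  -- The `G`-block contains no `H`-edge, so prefixing it shifts the second component by `0`.
  have none : ((g.filterMap (fstPartial G H).onE).map (inclLeft G x.2).onE).filterMap
      (sndPartial G H).onE = [] := by
    rw [List.filterMap_map]
    exact List.filterMap_eq_nil_iff.2 fun _ _ => rfl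
  rw [none, shift_one, List.length_nil, shift_zero] at right
  have h := (hσ.trans (left.trans right)).trans hσ'.symm
  simp only [one_mul, mul_one, inv_one] at h
  exact ⟨_, h⟩

def fromFunny (G H : Asynch.{u}) :
    FunnyObj (Vertices G) (Vertices H) ⥤ Vertices (shuffle G H) :=
  Funny.lift
    { obj := fun x y => ⟨(x.vertex, y.vertex)⟩
      left := fun f y => (pathMap (inclLeft G y.vertex)).map f
      right := fun x _ _ g => (pathMap (inclRight H x.vertex)).map g
      left_id := fun x y => (pathMap (inclLeft G y.vertex)).map_id x
      left_comp := fun f f' y => (pathMap (inclLeft G y.vertex)).map_comp f f'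
      right_id := fun x y => (pathMap (inclRight H x.vertex)).map_id y
      right_comp := fun x _ _ _ g g' => (pathMap (inclRight H x.vertex)).map_comp g g' }

theorem toFunny_fromFunny : toFunny G H ⋙ fromFunny G H = 𝟭 _ :=
  shuffle_functor_ext (fun _ => rfl)
    (fun e y => heq_of_eq (congrArg (fromFunny G H).map (toFunny_inl e y)))
    (fun x e => heq_of_eq (congrArg (fromFunny G H).map (toFunny_inr x e)))

theorem fromFunny_toFunny : fromFunny G H ⋙ toFunny G H = 𝟭 _ :=
  Funny.functor_ext
    (fun y => path_functor_ext (fun _ => rfl) fun e => heq_of_eq (toFunny_inl e y.vertex))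
    (fun x => path_functor_ext (fun _ => rfl) fun e => heq_of_eq (toFunny_inr x.vertex e))

/-! ### Bijectivity of the comparison on 2-cells -/

theorem perm_eq_of_heq {x y : Vertices G} {f f' g g' : x ⟶ y} (hf : f = f') (hg : g = g')
    {η : f ⟶ g} {θ : f' ⟶ g'} (h : η ≍ θ) : Rescheduling.perm η = Rescheduling.perm θ := by
  subst hf hg; cases h; rfl

theorem toFunny_fst_map {x y : Vertices (shuffle G H)} (f : x ⟶ y) :
    Funny.fst.map ((toFunny G H).map f) = (partialPathMap (fstPartial G H)).map f :=
  eq_of_heq (Functor.hcongr_hom toFunny_fst f)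

theorem toFunny_snd_map {x y : Vertices (shuffle G H)} (f : x ⟶ y) :
    Funny.snd.map ((toFunny G H).map f) = (partialPathMap (sndPartial G H)).map f :=
  eq_of_heq (Functor.hcongr_hom toFunny_snd f)

/-- `grayLift` transports the 2-cells of `collapse` along `toFunny_fst`; the underlying permutation
is insensitive to this transport. -/
theorem comparison_fst_perm {x y : Vertices (shuffle G H)} {f g : x ⟶ y} (η : f ⟶ g) :
    Rescheduling.perm (Gray.Cell.fst ((comparison G H).map₂ η)) =
      Rescheduling.perm ((collapse (fstPartial G H)).map₂ η) :=
  perm_eq_of_heq (toFunny_fst_map f) (toFunny_fst_map g)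
    (TwoCat.map₂_congr (comparison_pr₁ (G := G) (H := H)) η)

theorem comparison_snd_perm {x y : Vertices (shuffle G H)} {f g : x ⟶ y} (η : f ⟶ g) :
    Rescheduling.perm (Gray.Cell.snd ((comparison G H).map₂ η)) =
      Rescheduling.perm ((collapse (sndPartial G H)).map₂ η) :=
  perm_eq_of_heq (toFunny_snd_map f) (toFunny_snd_map g)
    (TwoCat.map₂_congr (comparison_pr₂ (G := G) (H := H)) η)

/-- With this description, injectivity on 2-cells is `Splits.unique` and surjectivity is
`exists_splits`. -/
theorem comparison_splits {x y : Vertices (shuffle G H)} {f g : x ⟶ y} (η : f ⟶ g) :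
    Splits f.edges g.edges (Rescheduling.perm η)
      (Rescheduling.perm (Gray.Cell.fst ((comparison G H).map₂ η)))
      (Rescheduling.perm (Gray.Cell.snd ((comparison G H).map₂ η))) := by
  rw [comparison_fst_perm, comparison_snd_perm]
  exact ⟨collapse_projects _ η, collapse_projects _ η⟩

instance (G H : Asynch.{u}) : IsIso (comparison G H) := by
  refine TwoCat.isIso_of_bijective _ (fromFunny G H) toFunny_fromFunny fromFunny_toFunny ?_ ?_
  · intro x y f g η θ h
    have := comparison_splits η
    rw [h] at this
    exact cell_ext (this.unique (comparison_splits θ))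
  · intro x y f g c
    have h₁ := (Gray.Cell.fst c).tracks
    have h₂ := (Gray.Cell.snd c).tracks
    obtain ⟨σ, hσ⟩ := exists_splits (τ₁ := Rescheduling.perm (Gray.Cell.fst c))
      (τ₂ := Rescheduling.perm (Gray.Cell.snd c)) f.isPath g.isPath
      (by
        rw [show f.edges.filterMap _ = _ from congrArg Path.edges (toFunny_fst_map f).symm,
          show g.edges.filterMap _ = _ from congrArg Path.edges (toFunny_fst_map g).symm]
        exact h₁)
      (by
        rw [show f.edges.filterMap _ = _ from congrArg Path.edges (toFunny_snd_map f).symm,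
          show g.edges.filterMap _ = _ from congrArg Path.edges (toFunny_snd_map g).symm]
        exact h₂)
    let θ : f ⟶ g := (⟨σ, hσ.fst.tracks⟩ : Rescheduling _ f g)
    have hθ := comparison_splits θ
    exact ⟨θ, Gray.cell_ext (cell_ext (hθ.fst.unique hσ.fst)) (cell_ext (hθ.snd.unique hσ.snd))⟩

instance : IsIso counit.{u} := by
  refine ⟨TwoCat.const _ (⟨PUnit.unit⟩ : Vertices unit.{u}), ?_, TwoCat.to_one_ext _ _⟩
  -- The unit has no edge, so every path is empty and its only rescheduling is the identity.
  have hp : ∀ {x y : Vertices unit.{u}} (f g : x ⟶ y), f = g := fun f g => Path.ext <| by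
    rcases f.edges with _ | ⟨⟨⟩, _⟩
    rcases g.edges with _ | ⟨⟨⟩, _⟩
    rfl
  refine TwoCat.functor_ext (CategoryTheory.Functor.hext (fun _ => rfl)
    fun _ _ _ => heq_of_eq (hp _ _)) fun {x y f g} η => rescheduling_heq (hp _ _) (hp _ _) ?_
  refine (Tracks.eq_one (Rescheduling.tracks η) ?_).symm
  rcases f.edges with _ | ⟨⟨⟩, _⟩
  exact Nat.zero_le _

/-! ### The strong symmetric monoidal structure -/

noncomputable instance : (asynchTwoCat.{u}).Monoidal :=
  letI := oplaxMonoidal.{u}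
  have : IsIso (Functor.OplaxMonoidal.η asynchTwoCat.{u}) := inferInstanceAs (IsIso counit)
  have (G H : Asynch.{u}) : IsIso (Functor.OplaxMonoidal.δ asynchTwoCat.{u} G H) :=
    inferInstanceAs (IsIso (comparison G H))
  Functor.Monoidal.ofOplaxMonoidal asynchTwoCat

open MonoidalCategory in
noncomputable abbrev braided : (asynchTwoCat.{u}).Braided where
  braided G H := by
    -- The structure map `μ` is the inverse of `δ`, so cancelling `δ` turns the claim into
    -- `comparison_swap`.
    rw [← cancel_epi (Functor.OplaxMonoidal.δ asynchTwoCat G H),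
      Functor.Monoidal.δ_μ_assoc]
    have h : Functor.OplaxMonoidal.δ asynchTwoCat G H ≫ (β_ _ _).hom =
      asynchTwoCat.map (β_ G H).hom ≫ Functor.OplaxMonoidal.δ asynchTwoCat H G :=
      comparison_swap G H
    rw [← Category.assoc, h, Category.assoc, Functor.Monoidal.δ_μ, Category.comp_id]

end
end Asynch

namespace Asynch

/-! ### Equalizers -/

section
variable {G H : Asynch.{u}} (F F' : G ⟶ H)

/-- Both homomorphisms send the tile to a tile of `H` with the same source path, and determinism
forces the same target path. -/
theorem equalizer_tile {F F' : G ⟶ H} {u₁ u₂ v₁ v₂ : G.E} (h : G.tile u₁ u₂ v₁ v₂)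
    (h₁ : F.onE u₁ = F'.onE u₁) (h₂ : F.onE u₂ = F'.onE u₂) :
    F.onE v₁ = F'.onE v₁ ∧ F.onE v₂ = F'.onE v₂ := by
  have t := F.tile h
  rw [h₁, h₂] at t
  exact H.deterministic t (F'.tile h)

/-- The equalizer of two homomorphisms of asynchronous graphs. -/
def equalizer : Asynch.{u} where
  V := { x : G.V // F.onV x = F'.onV x }
  E := { e : G.E // F.onE e = F'.onE e }
  src e := ⟨G.src e.1, by rw [← F.src, ← F'.src, e.2]⟩
  tgt e := ⟨G.tgt e.1, by rw [← F.tgt, ← F'.tgt, e.2]⟩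
  tile u₁ u₂ v₁ v₂ := G.tile u₁.1 u₂.1 v₁.1 v₂.1
  square h := by
    obtain ⟨h₁, h₂, h₃, h₄⟩ := G.square h
    exact ⟨Subtype.ext h₁, Subtype.ext h₂, Subtype.ext h₃, Subtype.ext h₄⟩
  symm h := G.symm h
  deterministic h h' := by
    obtain ⟨h₁, h₂⟩ := G.deterministic h h'
    exact ⟨Subtype.ext h₁, Subtype.ext h₂⟩
  cube u₁ u₂ u₃ v₁ v₂ v₃ := by
    constructor
    · rintro ⟨w, a, b, h₁, h₂, h₃⟩
      obtain ⟨w', a', b', k₁, k₂, k₃⟩ := (G.cube _ _ _ _ _ _).1 ⟨_, _, _, h₁, h₂, h₃⟩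
      -- The cube completed in `G` has its new edges in the equalizer: each new tile starts from
      -- equalized edges, so its other side is equalized too.
      have p := equalizer_tile k₁ u₁.2 u₂.2
      have q := equalizer_tile k₂ p.2 u₃.2
      exact ⟨⟨w', p.1⟩, ⟨a', p.2⟩, ⟨b', q.1⟩, k₁, k₂, k₃⟩
    · rintro ⟨w, a, b, h₁, h₂, h₃⟩
      obtain ⟨w', a', b', k₁, k₂, k₃⟩ := (G.cube _ _ _ _ _ _).2 ⟨_, _, _, h₁, h₂, h₃⟩
      have p := equalizer_tile k₁ u₂.2 u₃.2
      have q := equalizer_tile k₂ u₁.2 p.1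
      exact ⟨⟨w', p.2⟩, ⟨a', p.1⟩, ⟨b', q.2⟩, k₁, k₂, k₃⟩

def equalizerι : equalizer F F' ⟶ G where
  onV := Subtype.val
  onE := Subtype.val
  src _ := rfl
  tgt _ := rfl
  tile h := h

theorem equalizer_condition : equalizerι F F' ≫ F = equalizerι F F' ≫ F' :=
  hom_ext (fun x => x.2) (fun e => e.2)

def isLimitEqualizer :
    Limits.IsLimit (Limits.Fork.ofι (equalizerι F F') (equalizer_condition F F')) :=
  Limits.Fork.IsLimit.mk' _ fun s =>
    ⟨{ onV := fun x => ⟨s.ι.onV x, congrFun (congrArg Hom.onV s.condition) x⟩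
       onE := fun e => ⟨s.ι.onE e, congrFun (congrArg Hom.onE s.condition) e⟩
       src := fun e => Subtype.ext (s.ι.src e)
       tgt := fun e => Subtype.ext (s.ι.tgt e)
       tile := fun h => s.ι.tile h }, rfl, fun hm => hom_ext
      (fun x => Subtype.ext (congrFun (congrArg Hom.onV hm) x))
      (fun e => Subtype.ext (congrFun (congrArg Hom.onE hm) e))⟩

variable {F F'}

theorem IsPath.of_equalizer {l : List (equalizer F F').E} {x y : (equalizer F F').V}
    (h : G.IsPath x.1 (l.map Subtype.val) y.1) : (equalizer F F').IsPath x l y := by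
  induction l generalizing x with
  | nil => exact Subtype.ext h
  | cons e l ih => exact ⟨Subtype.ext h.1, ih h.2⟩

/-- Steps out of a path of the equalizer never leave it, by `equalizer_tile`. The target is produced
along the way, because the intermediate paths are not assumed to lie in the equalizer. -/
theorem Tracks.exists_equalizer {f g : List G.E} {σ : Equiv.Perm ℕ} (s : G.Tracks f g σ)
    (f' : List (equalizer F F').E) (hf : f'.map Subtype.val = f) :
    ∃ g' : List (equalizer F F').E, g'.map Subtype.val = g ∧ (equalizer F F').Tracks f' g' σ := by
  induction s generalizing f' with
  | nil f => exact ⟨f', hf, .nil _⟩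
  | cons s _ ih =>
    obtain ⟨h₁, h₂, t⟩ := s
    obtain ⟨h₁, l, rfl, rfl, hl⟩ := List.map_eq_append_iff.1 hf
    obtain ⟨u₁, l, rfl, rfl, hl'⟩ := List.map_eq_cons_iff.1 hl
    obtain ⟨u₂, h₂, rfl, rfl, rfl⟩ := List.map_eq_cons_iff.1 hl'
    have p := equalizer_tile t u₁.2 u₂.2
    obtain ⟨g', hg', s'⟩ := ih (h₁ ++ ⟨_, p.1⟩ :: ⟨_, p.2⟩ :: h₂) (by simp)
    refine ⟨g', hg', ?_⟩
    rw [List.length_map]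
    exact .cons (Step.mk (G := equalizer F F') h₁ h₂ (v₁ := ⟨_, p.1⟩) (v₂ := ⟨_, p.2⟩) t) s'

theorem Tracks.of_equalizer {f g : List (equalizer F F').E} {σ : Equiv.Perm ℕ}
    (s : G.Tracks (f.map Subtype.val) (g.map Subtype.val) σ) :
    (equalizer F F').Tracks f g σ := by
  obtain ⟨g', hg', s'⟩ := s.exists_equalizer f rfl
  rwa [List.map_injective_iff.2 Subtype.val_injective hg'] at s'

/-! ### Universal property of the image of an equalizer -/

theorem path_heq {x y x' y' : Vertices G} {f : x ⟶ y} {f' : x' ⟶ y'} (hx : x = x')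
    (hy : y = y') (h : f.edges = f'.edges) : f ≍ f' := by
  subst hx hy; exact heq_of_eq (Path.ext h)

theorem edges_eq_of_heq {x y x' y' : Vertices G} {f : x ⟶ y} {f' : x' ⟶ y'} (hx : x = x')
    (hy : y = y') (h : f ≍ f') : f.edges = f'.edges := by
  subst hx hy; cases h; rfl

theorem cell_heq {x y x' y' : Vertices G} {f g : x ⟶ y} {f' g' : x' ⟶ y'} (hx : x = x')
    (hy : y = y') (hf : f ≍ f') (hg : g ≍ g') {η : f ⟶ g} {θ : f' ⟶ g'}
    (h : Rescheduling.perm η = Rescheduling.perm θ) : η ≍ θ := by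
  subst hx hy; exact rescheduling_heq (eq_of_heq hf) (eq_of_heq hg) h

theorem perm_eq_of_cell_heq {x y x' y' : Vertices G} {f g : x ⟶ y} {f' g' : x' ⟶ y'}
    (hx : x = x') (hy : y = y') (hf : f ≍ f') (hg : g ≍ g') {η : f ⟶ g} {θ : f' ⟶ g'}
    (h : η ≍ θ) : Rescheduling.perm η = Rescheduling.perm θ := by
  subst hx hy; exact perm_eq_of_heq (eq_of_heq hf) (eq_of_heq hg) h

/-- The inclusion is injective on vertices and edges and keeps permutations unchanged, which gives
uniqueness of factorizations. -/
theorem equalizerι_cancel {X : TwoCat.{u}} {m m' : X ⟶ asynchTwoCat.obj (equalizer F F')}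
    (h : m ≫ asynchTwoCat.map (equalizerι F F') = m' ≫ asynchTwoCat.map (equalizerι F F')) :
    m = m' := by
  have hU := congrArg TwoCat.U h
  have ho (x : X) : m.obj x = m'.obj x :=
    congrArg Vertices.mk (Subtype.ext (congrArg Vertices.vertex (Functor.congr_obj hU x)))
  have hm {x y : X} (f : x ⟶ y) : m.map f ≍ m'.map f :=
    path_heq (ho x) (ho y) (List.map_injective_iff.2 Subtype.val_injective
      (edges_eq_of_heq (Functor.congr_obj hU x) (Functor.congr_obj hU y)
        (Functor.hcongr_hom hU f)))
  refine TwoCat.functor_ext (CategoryTheory.Functor.hext ho fun _ _ f => hm f)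
    fun {x y f g} η => cell_heq (ho x) (ho y) (hm f) (hm g) ?_
  exact perm_eq_of_cell_heq (Functor.congr_obj hU x) (Functor.congr_obj hU y)
    (Functor.hcongr_hom hU f) (Functor.hcongr_hom hU g) (TwoCat.map₂_congr h η)

section
variable {X : TwoCat.{u}} (K : X ⟶ asynchTwoCat.obj G)
  (hK : K ≫ asynchTwoCat.map F = K ≫ asynchTwoCat.map F')
include hK

theorem equalized_vertex (x : X) :
    F.onV (K.obj x : Vertices G).vertex = F'.onV (K.obj x : Vertices G).vertex :=
  congrArg Vertices.vertex (Functor.congr_obj (congrArg TwoCat.U hK) x)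

/-- Paths in `H` are lists subject to no relation, so equality of the two images of a path is
equality edge by edge. -/
theorem equalized_edge {x y : X} (f : x ⟶ y) (e : G.E) (he : e ∈ Path.edges (K.map f)) :
    F.onE e = F'.onE e := by
  have hU := congrArg TwoCat.U hK
  exact List.map_inj_left.1 (edges_eq_of_heq (Functor.congr_obj hU x) (Functor.congr_obj hU y)
    (Functor.hcongr_hom hU f)) e he

def equalizerLiftFunctor : X ⥤ Vertices (equalizer F F') where
  obj x := ⟨⟨_, equalized_vertex K hK x⟩⟩
  map f := ⟨(Path.edges (K.map f)).attachWith _ (equalized_edge K hK f),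
    IsPath.of_equalizer (by
      rw [List.attachWith_map_subtype_val]; exact Path.isPath (K.map f))⟩
  map_id x := Path.ext (List.map_injective_iff.2 Subtype.val_injective (by
    rw [List.attachWith_map_subtype_val]
    exact congrArg Path.edges (K.map_id x)))
  map_comp f g := Path.ext (List.map_injective_iff.2 Subtype.val_injective (by
    rw [List.attachWith_map_subtype_val]
    refine (congrArg Path.edges (K.map_comp f g)).trans (Eq.symm ?_)
    refine List.map_append.trans ?_
    rw [List.attachWith_map_subtype_val, List.attachWith_map_subtype_val]
    rfl))

def equalizerLiftCells : TwoCat.Cells (equalizerLiftFunctor K hK) where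
  -- The tracking sequence in `G` starts at a path of the equalizer, hence lifts to it with the same
  -- permutation.
  map₂ η := ⟨Rescheduling.perm (K.map₂ η), Tracks.of_equalizer (by
    simp only [equalizerLiftFunctor, List.attachWith_map_subtype_val]
    exact Rescheduling.tracks (K.map₂ η))⟩
  map₂_id f := cell_ext (congrArg (Rescheduling.perm (G := G)) (K.map₂_id f))
  map₂_comp η θ := cell_ext (congrArg (Rescheduling.perm (G := G)) (K.map₂_comp η θ))
  map₂_left f g h η := cell_ext (by
    refine (congrArg (Rescheduling.perm (G := G)) ((TwoCat.cells K).map₂_left f η)).trans ?_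
    refine (perm_wl (StrictPseudofunctor.toFunctor K) f (K.map₂ η)).trans (Eq.symm ?_)
    refine (perm_wl (equalizerLiftFunctor K hK) f _).trans ?_
    exact congrArg (shift · (Rescheduling.perm (K.map₂ η))) (List.length_attachWith ..))
  map₂_right η h := cell_ext (by
    refine (congrArg (Rescheduling.perm (G := G)) ((TwoCat.cells K).map₂_right η h)).trans ?_
    refine (perm_wr (StrictPseudofunctor.toFunctor K) (K.map₂ η) h).trans (Eq.symm ?_)
    exact perm_wr (equalizerLiftFunctor K hK) _ h)

theorem equalizerLift_comp :
    (equalizerLiftCells K hK).toHom ≫ asynchTwoCat.map (equalizerι F F') = K :=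
  have hm {x y : X} (f : x ⟶ y) :
      (pathMap (equalizerι F F')).map ((equalizerLiftFunctor K hK).map f) = K.map f :=
    Path.ext (List.attachWith_map_subtype_val ..)
  TwoCat.functor_ext (CategoryTheory.Functor.hext (fun _ => rfl) fun _ _ f => heq_of_eq (hm f))
    fun {_ _ f g} _ => rescheduling_heq (hm f) (hm g) rfl

end

variable (F F') in
noncomputable def isLimitMapEqualizer : Limits.IsLimit (Limits.Fork.ofι
    (asynchTwoCat.map (equalizerι F F')) (by
      rw [← Functor.map_comp, ← Functor.map_comp, equalizer_condition]) :
      Limits.Fork (asynchTwoCat.map F) (asynchTwoCat.map F')) :=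
  Limits.Fork.IsLimit.mk' _ fun s =>
    ⟨(equalizerLiftCells s.ι s.condition).toHom, equalizerLift_comp s.ι s.condition,
      fun hm => equalizerι_cancel (hm.trans (equalizerLift_comp s.ι s.condition).symm)⟩

end

theorem preservesEqualizers :
    Limits.PreservesLimitsOfShape Limits.WalkingParallelPair asynchTwoCat.{u} where
  preservesLimit {K} := by
    have : Limits.PreservesLimit (Limits.parallelPair (K.map Limits.WalkingParallelPairHom.left)
        (K.map Limits.WalkingParallelPairHom.right)) asynchTwoCat.{u} :=
      Limits.preservesLimit_of_preserves_limit_cone (isLimitEqualizer _ _)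
        ((Limits.isLimitMapConeForkEquiv asynchTwoCat (equalizer_condition _ _)).symm
          (isLimitMapEqualizer _ _))
    exact Limits.preservesLimit_of_iso_diagram _ (Limits.diagramIsoParallelPair K).symm

/-! ### Binary products -/

/-- The graph with one vertex, one edge and no tile. -/
def loop : Asynch.{u} where
  V := PUnit
  E := PUnit
  src _ := PUnit.unit
  tgt _ := PUnit.unit
  tile _ _ _ _ := False
  square h := h.elim
  symm h := h.elim
  deterministic h _ := h.elim
  cube _ _ _ _ _ _ := by simp

/-- The loop is subterminal: it receives at most one homomorphism from each graph, though none from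
a graph with a tile. Hence it is its own binary square, with identity projections. -/
theorem to_loop_ext {G : Asynch.{u}} (f g : G ⟶ loop) : f = g :=
  hom_ext (fun _ => rfl) (fun _ => rfl)

def isLimitLoop : Limits.IsLimit (Limits.BinaryFan.mk (𝟙 loop.{u}) (𝟙 loop.{u})) :=
  Limits.BinaryFan.isLimitMk (fun s => s.fst) (fun _ => to_loop_ext _ _)
    (fun _ => to_loop_ext _ _) (fun _ _ _ _ => to_loop_ext _ _)

/-- Preservation would make `[loop]` its own square with identity projections, so that any two
parallel 2-functors into it would coincide. The identity and the constant 2-functor differ on the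
edge: one gives a path of length one, the other the empty path. -/
theorem not_preservesBinaryProducts :
    ¬ Limits.PreservesLimitsOfShape (Discrete Limits.WalkingPair) asynchTwoCat.{u} := by
  intro _
  have h' := Limits.mapIsLimitOfPreservesOfIsLimit asynchTwoCat (𝟙 loop.{u}) (𝟙 loop.{u})
    isLimitLoop
  obtain ⟨l, hl₁, hl₂⟩ := Limits.BinaryFan.IsLimit.lift' h' (𝟙 (asynchTwoCat.obj loop.{u}))
    (TwoCat.const _ (⟨PUnit.unit⟩ : Vertices loop.{u}))
  have key := hl₁.symm.trans hl₂
  have := edges_eq_of_heq (G := loop) rfl rfl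
    (Functor.hcongr_hom (congrArg TwoCat.U key) (edge (G := loop.{u}) PUnit.unit))
  exact List.cons_ne_nil _ _ this

end Asynch

theorem mainTheorem5 :
    Nonempty (asynchTwoCat.{u}).Braided ∧
    Limits.PreservesLimitsOfShape Limits.WalkingParallelPair asynchTwoCat.{u} ∧
    ¬ Limits.PreservesLimitsOfShape (Discrete Limits.WalkingPair) asynchTwoCat.{u} :=
  ⟨⟨Asynch.braided⟩, Asynch.preservesEqualizers, Asynch.not_preservesBinaryProducts⟩
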